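/- Let $k\ge 0$, $n\ge 0$ and let $$H=\left(\frac{S_k}{z^k}+\cdots+\frac{S_1}{z}+S_0+N_0\right)\frac{dz}{z}$$ be an unramified Hukuhara–Turrittin–Levelt normal form of rank $n$: the $S_i\in M_n(\mathbb C)$ are diagonal, and $N_0$ is nilpotent and commutes with all $S_i$. For $0\le i\le k+1$ let the blocks of $\mathbf m_i$ be the classes of the relation on $\{1,\dots,n\}$ under which $p\sim q$ if the $p$-th and $q$-th diagonal entries $s^{(l)}_p$, $s^{(l)}_q$ of $S_l$ agree for all $l$ with $i\le l\le k$ (so $\mathbf m_{k+1}$ has one block). Fix total orderings of the blocks of $\mathbf m_1,\dots,\mathbf m_k$ for which the maps from the blocks of $\mathbf m_i$ to those of $\mathbf m_{i+1}$ are monotone. Let $\mathbb D(H)\subset\mathbb C^{k+1}$ be the Zariski open set of the $\mathbf c=(c_0,\dots,c_k)$ such that, for all $0\le i<k$ and all $p,q$ in different blocks of $\mathbf m_i$, $$\sum_{l=i}^{m}\bigl(s^{(l)}_p-s^{(l)}_q\bigr)\prod_{\nu=l+1}^{m}(c_i-c_\nu)\neq 0,$$ where $m\ge i$ is the largest index with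 $s^{(m)}_p\ne s^{(m)}_q$. It contains $0$. For $2\le l\le k$ let $\mathfrak n_l\subset M_n(\mathbb C)$ be the subalgebra of the matrices whose $(p,q)$-entry vanishes unless $p,q$ lie in the same block of $\mathbf m_{l+1}$ and the block of $p$ strictly precedes that of $q$ in $\mathbf m_l$. Put $\mathfrak n^{(l)}=\mathfrak n_l^{\oplus(l-1)}$. Let $(N^-)^{(l)}_{\mathbb D(H)}$ be the complex Lie groupoid $\mathfrak n^{(l)}\times\mathbb D(H)\to\mathbb D(H)$ whose source and target maps are the projection, whose units are the zero section, and whose multiplication on the fibre over $\mathbf c$ is transported by $$(X_1,\dots,X_{l-1})\mapsto E_n+\sum_{i=1}^{l-1}X_i(z-c_0)\cdots(z-c_{i-1})$$ from the multiplication of matrices over $\mathbb C[z]/\langle(z-c_0)\cdots(z-c_{l-1})\rangle$. Its relative cotangent bundle over $\mathbb D(H)$ is $T^*\mathfrak n^{(l)}\times\mathbb D(H)$. Let $$\theta\colon(\mathbb O_{H_{\mathrm{irr}}})_{\mathbb D(H)}=\bigoplus_{l=2}^{k}T^*\mathfrak n^{(l)}\times\mathbb D(H)\longrightarrow\mathbb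 D(H)$$ be the direct sum over $\mathbb D(H)$ of these bundles, with the Poisson structure that is the product of the standard symplectic structures of the $T^*\mathfrak n^{(l)}$ and the zero Poisson structure of $\mathbb D(H)$. Finally let $\mathrm{GL}_n(\mathbb C[z]_k)^1$ be the group of the $g\in\mathrm{GL}_n(\mathbb C[z]/\langle z^{k+1}\rangle)$ with $g(0)=E_n$, let $H_{\mathrm{irr}}$ be the linear form $Y_1z+\cdots+Y_kz^k\mapsto\sum_{i=1}^k\operatorname{tr}(Y_iS_i)$ on its Lie algebra, and let $\mathbb O_{H_{\mathrm{irr}}}$ be the coadjoint orbit of $\mathrm{GL}_n(\mathbb C[z]_k)^1$ through $H_{\mathrm{irr}}$, with its symplectic form $(\mathrm{ad}^*(Y)\eta,\mathrm{ad}^*(Y')\eta)\mapsto-\eta([Y,Y'])$. **Proposition.** The family of fibres $(\theta^{-1}(\mathbf c))_{\mathbf c\in\mathbb D(H)}$, each with the product of the standard symplectic forms of the $T^*\mathfrak n^{(l)}$, is the symplectic foliation of the Poisson manifold $(\mathbb O_{H_{\mathrm{irr}}})_{\mathbb D(H)}$: the fibres are its symplectic leaves, with their symplectic forms. The fibre $\theta^{-1}(0)$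 is isomorphic to $\mathbb O_{H_{\mathrm{irr}}}$ as a holomorphic symplectic manifold. -/

import Mathlib

set_option maxSynthPendingDepth 3

open Polynomial

attribute [local instance] Matrix.normedAddCommGroup Matrix.normedSpace

namespace Unfolding

/-! ## The rings `ℂ[z] / ∏ (z - c_j)` and their standard bases -/

/-- The complex `n × n` matrices. -/
abbrev Mat (n : ℕ) := Matrix (Fin n) (Fin n) ℂ

/-- The polynomial `(z - c₀)(z - c₁)⋯(z - c_{i-1})`. -/
noncomputable def newton (c : ℕ → ℂ) (i : ℕ) : ℂ[X] :=
  ∏ j ∈ Finset.range i, (X - C (c j))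

theorem newton_monic (c : ℕ → ℂ) (i : ℕ) : (newton c i).Monic :=
  monic_prod_of_monic _ _ fun j _ => monic_X_sub_C (c j)

theorem newton_natDegree (c : ℕ → ℂ) (i : ℕ) : (newton c i).natDegree = i := by
  unfold newton
  rw [natDegree_prod_of_monic _ _ fun j _ => monic_X_sub_C (c j)]
  simp

theorem newton_succ (c : ℕ → ℂ) (i : ℕ) :
    newton c (i + 1) = newton c i * (X - C (c i)) := by
  simp [newton, Finset.prod_range_succ]

/-- The ring `ℂ[z] / ⟨(z - c₀)⋯(z - c_{m-1})⟩`.  For `c = 0` it is `ℂ[z] / ⟨z ^ m⟩`. -/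
abbrev DefRing (c : ℕ → ℂ) (m : ℕ) := ℂ[X] ⧸ Ideal.span {newton c m}

/-- The class of `(z - c₀)⋯(z - c_{i-1})`. -/
noncomputable def newtonClass (c : ℕ → ℂ) (m i : ℕ) : DefRing c m :=
  Ideal.Quotient.mk _ (newton c i)

theorem newtonClass_eq_zero (c : ℕ → ℂ) {m i : ℕ} (h : m ≤ i) : newtonClass c m i = 0 := by
  unfold newtonClass
  rw [Ideal.Quotient.eq_zero_iff_mem, Ideal.mem_span_singleton]
  unfold newton
  exact Finset.prod_dvd_prod_of_subset _ _ _ (Finset.range_mono h)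

theorem newton_span_X_mul (c : ℕ → ℂ) (f : ℂ[X])
    (hf : f ∈ Submodule.span ℂ (Set.range (newton c))) :
    X * f ∈ Submodule.span ℂ (Set.range (newton c)) := by
  induction hf using Submodule.span_induction with
  | mem x hx =>
    obtain ⟨i, rfl⟩ := hx
    have : X * newton c i = newton c (i + 1) + (c i) • newton c i := by
      rw [newton_succ, smul_eq_C_mul]; ring
    rw [this]
    exact Submodule.add_mem _ (Submodule.subset_span ⟨_, rfl⟩)
      (Submodule.smul_mem _ _ (Submodule.subset_span ⟨_, rfl⟩))
  | zero => simp
  | add x y _ _ hx hy => rw [mul_add]; exact Submodule.add_mem _ hx hy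
  | smul a x _ hx => rw [mul_smul_comm]; exact Submodule.smul_mem _ _ hx

theorem newton_span (c : ℕ → ℂ) (f : ℂ[X]) :
    f ∈ Submodule.span ℂ (Set.range (newton c)) := by
  induction f using Polynomial.induction_on' with
  | add p q hp hq => exact Submodule.add_mem _ hp hq
  | monomial d a =>
    induction d with
    | zero =>
      have : (monomial 0 a : ℂ[X]) = a • newton c 0 := by
        simp [newton, smul_eq_C_mul]
      rw [this]
      exact Submodule.smul_mem _ _ (Submodule.subset_span ⟨0, rfl⟩)
    | succ d ih =>
      have : (monomial (d + 1) a : ℂ[X]) = X * monomial d a := by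
        rw [X_mul_monomial]
      rw [this]
      exact newton_span_X_mul c _ ih

theorem newtonClass_span (c : ℕ → ℂ) (m : ℕ) :
    ⊤ ≤ Submodule.span ℂ (Set.range fun i : Fin m => newtonClass c m i) := by
  intro x _
  obtain ⟨f, rfl⟩ := Ideal.Quotient.mk_surjective x
  induction newton_span c f using Submodule.span_induction with
  | mem x hx =>
    obtain ⟨i, rfl⟩ := hx
    by_cases h : i < m
    · exact Submodule.subset_span ⟨⟨i, h⟩, rfl⟩
    · have := newtonClass_eq_zero c (not_lt.mp h)
      unfold newtonClass at this
      rw [this]; exact Submodule.zero_mem _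
  | zero => simp
  | add x y _ _ hx hy =>
    rw [map_add]; exact Submodule.add_mem _ (hx trivial) (hy trivial)
  | smul a x _ hx =>
    have : (Ideal.Quotient.mk (Ideal.span {newton c m})) (a • x) =
      a • (Ideal.Quotient.mk (Ideal.span {newton c m})) x := rfl
    rw [this]; exact Submodule.smul_mem _ _ (hx trivial)

/-- The standard basis `1, (z - c₀), …, (z - c₀)⋯(z - c_{m-2})` of
`ℂ[z] / ⟨(z - c₀)⋯(z - c_{m-1})⟩`. -/
noncomputable def newtonBasis (c : ℕ → ℂ) (m : ℕ) : Module.Basis (Fin m) ℂ (DefRing c m) :=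
  haveI hli : LinearIndependent ℂ (fun i : Fin m => newtonClass c m i) := by
    apply linearIndependent_of_top_le_span_of_card_eq_finrank (newtonClass_span c m)
    have h := finrank_quotient_span_eq_natDegree (f := newton c m)
    rw [newton_natDegree] at h
    rw [Fintype.card_fin]
    exact h.symm
  Module.Basis.mk hli (newtonClass_span c m)

theorem newtonBasis_apply (c : ℕ → ℂ) (m : ℕ) (i : Fin m) :
    newtonBasis c m i = newtonClass c m i := by
  simp [newtonBasis]

/-- Structure constants of the standard bases. -/
noncomputable def structureConst (c : ℕ → ℂ) : ℕ → ℕ → ℕ → ℂ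
  | 0, j, t => if t = j then 1 else 0
  | i + 1, j, 0 => (c 0 - c i) * structureConst c i j 0
  | i + 1, j, t + 1 => structureConst c i j t + (c (t + 1) - c i) * structureConst c i j (t + 1)

theorem structureConst_support (c : ℕ → ℂ) (i j t : ℕ) (h : i + j < t) :
    structureConst c i j t = 0 := by
  induction i generalizing t with
  | zero => simp [structureConst]; omega
  | succ i ih =>
    cases t with
    | zero => omega
    | succ t => simp [structureConst, ih t (by omega), ih (t + 1) (by omega)]

theorem structureConst_zero (c : ℕ → ℂ) (i j : ℕ) : structureConst c (i + 1) j 0 = 0 := by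
  induction i with
  | zero => simp [structureConst]
  | succ i ih => rw [structureConst, ih, mul_zero]

theorem newton_mul (c : ℕ → ℂ) (i j N : ℕ) (hN : i + j < N) :
    newton c i * newton c j = ∑ t ∈ Finset.range N, structureConst c i j t • newton c t := by
  induction i generalizing N with
  | zero =>
    simp only [structureConst, ite_smul, one_smul, zero_smul]
    rw [Finset.sum_ite_eq' (Finset.range N) j]
    simp [newton]; omega
  | succ i ih =>
    obtain ⟨N, rfl⟩ : ∃ M, N = M + 1 := ⟨N - 1, by omega⟩
    have key : ∀ t, (X - C (c i)) * newton c t =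
        newton c (t + 1) + (c t - c i) • newton c t := by
      intro t
      rw [newton_succ, smul_eq_C_mul, C_sub]; ring
    rw [newton_succ, mul_right_comm, mul_comm, ih (N + 1) (by omega), Finset.mul_sum,
      Finset.sum_range_succ' (fun t => structureConst c (i + 1) j t • newton c t)]
    simp only [structureConst, mul_smul_comm, key, smul_add, Finset.sum_add_distrib, add_smul]
    rw [Finset.sum_range_succ (fun t => structureConst c i j t • newton c (t + 1)),
      structureConst_support c i j N (by omega), zero_smul, add_zero, add_assoc]
    congr 1
    rw [Finset.sum_range_succ' (fun t => structureConst c i j t • (c t - c i) • newton c t)]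
    simp only [smul_smul, mul_comm]

theorem newtonClass_mul (c : ℕ → ℂ) (m i j : ℕ) :
    newtonClass c m i * newtonClass c m j =
      ∑ t : Fin m, structureConst c i j t • newtonClass c m t := by
  have h := newton_mul c i j (i + j + 1 + m) (by omega)
  have h2 := congrArg (Ideal.Quotient.mk (Ideal.span {newton c m})) h
  rw [map_mul, map_sum] at h2
  have h3 : ∀ t, (Ideal.Quotient.mk (Ideal.span {newton c m}))
      (structureConst c i j t • newton c t) = structureConst c i j t • newtonClass c m t :=
    fun t => rfl
  simp only [h3] at h2
  refine h2.trans ?_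
  rw [Fin.sum_univ_eq_sum_range (fun t => structureConst c i j t • newtonClass c m t) m]
  symm
  apply Finset.sum_subset
  · intro t; simp; omega
  · intro t _ ht
    rw [newtonClass_eq_zero c (by simpa using ht), smul_zero]

/-! ## Matrices over these rings -/

/-- `∑_{i=1}^{m} X_i (z - c₀)⋯(z - c_{i-1})`, as a matrix over
`ℂ[z] / ⟨(z - c₀)⋯(z - c_m)⟩`; the coefficient `X_i` is the value at the index `i - 1 : Fin m`. -/
noncomputable def newtonMat {n : ℕ} (c : ℕ → ℂ) (m : ℕ) :
    (Fin m → Mat n) →ₗ[ℂ] Matrix (Fin n) (Fin n) (DefRing c (m + 1)) where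
  toFun Y := Matrix.of fun p q => ∑ i : Fin m, Y i p q • newtonClass c (m + 1) (i + 1)
  map_add' Y Z := by
    ext p q; simp [add_smul, Finset.sum_add_distrib]
  map_smul' a Y := by
    ext p q; simp [mul_smul, Finset.smul_sum]

/-- The coefficients `X₁, …, X_m` of a matrix `X₀ + ∑_{i=1}^{m} X_i (z - c₀)⋯(z - c_{i-1})` over
`ℂ[z] / ⟨(z - c₀)⋯(z - c_m)⟩`. -/
noncomputable def newtonCoeff {n : ℕ} (c : ℕ → ℂ) (m : ℕ) :
    Matrix (Fin n) (Fin n) (DefRing c (m + 1)) →ₗ[ℂ] (Fin m → Mat n) where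
  toFun M i := Matrix.of fun p q => (newtonBasis c (m + 1)).repr (M p q) i.succ
  map_add' Y Z := by
    ext i p q; simp
  map_smul' a Y := by
    ext i p q; simp

theorem newtonBasis_repr_newtonClass (c : ℕ → ℂ) (m : ℕ) (i t : Fin m) :
    (newtonBasis c m).repr (newtonClass c m i) t = if i = t then 1 else 0 := by
  rw [← newtonBasis_apply, Module.Basis.repr_self, Finsupp.single_apply]

theorem newtonCoeff_newtonMat {n : ℕ} (c : ℕ → ℂ) (m : ℕ) (Y : Fin m → Mat n) :
    newtonCoeff c m (newtonMat c m Y) = Y := by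
  ext t p q
  have h : ∀ i : Fin m, (newtonBasis c (m + 1)).repr (newtonClass c (m + 1) (i + 1)) t.succ =
      if i = t then 1 else 0 := by
    intro i
    have := newtonBasis_repr_newtonClass c (m + 1) i.succ t.succ
    simpa using this
  simp [newtonCoeff, newtonMat, h]

theorem newtonCoeff_one {n : ℕ} (c : ℕ → ℂ) (m : ℕ) :
    newtonCoeff c m (1 : Matrix (Fin n) (Fin n) (DefRing c (m + 1))) = 0 := by
  ext t p q
  have h1 : (1 : DefRing c (m + 1)) = newtonClass c (m + 1) 0 := by
    simp only [newtonClass, newton, Finset.range_zero, Finset.prod_empty]; rfl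
  have h := newtonBasis_repr_newtonClass c (m + 1) 0 t.succ
  rw [if_neg (Fin.succ_ne_zero t).symm] at h
  simp only [Fin.val_zero] at h
  simp only [newtonCoeff, LinearMap.coe_mk, AddHom.coe_mk, Matrix.of_apply, Matrix.one_apply]
  split_ifs
  · rw [h1, h]; rfl
  · simp

/-- The product of `∑_i X_i (z - c₀)⋯(z - c_{i-1})` and `∑_j Y_j (z - c₀)⋯(z - c_{j-1})` in
coordinates. -/
noncomputable def newtonMulCoord {n : ℕ} (c : ℕ → ℂ) (m : ℕ) (A B : Fin m → Mat n) :
    Fin m → Mat n :=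
  fun t => ∑ i : Fin m, ∑ j : Fin m, structureConst c (i + 1) (j + 1) (t + 1) • (A i * B j)

theorem newtonMat_mul {n : ℕ} (c : ℕ → ℂ) (m : ℕ) (A B : Fin m → Mat n) :
    newtonMat c m A * newtonMat c m B = newtonMat c m (newtonMulCoord c m A B) := by
  ext p q
  have hm : ∀ i j : ℕ, newtonClass c (m + 1) (i + 1) * newtonClass c (m + 1) (j + 1) =
      ∑ t : Fin m, structureConst c (i + 1) (j + 1) (t + 1) • newtonClass c (m + 1) (t + 1) := by
    intro i j
    rw [newtonClass_mul, Fin.sum_univ_succ]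
    simp [structureConst_zero]
  simp only [newtonMat, LinearMap.coe_mk, AddHom.coe_mk, Matrix.mul_apply, Matrix.of_apply,
    newtonMulCoord, Matrix.sum_apply, Matrix.smul_apply, Finset.sum_mul_sum, smul_mul_smul_comm,
    hm, Finset.smul_sum, Finset.sum_smul, smul_smul, smul_eq_mul]
  rw [Finset.sum_comm]
  conv_lhs => enter [2, i]; rw [Finset.sum_comm]
  conv_lhs => enter [2, i, 2, j]; rw [Finset.sum_comm]
  conv_lhs => enter [2, i]; rw [Finset.sum_comm]
  rw [Finset.sum_comm]
  refine Finset.sum_congr rfl fun t _ => Finset.sum_congr rfl fun i _ =>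
    Finset.sum_congr rfl fun j _ => ?_
  simp only [Finset.mul_sum, Finset.sum_smul]
  exact Finset.sum_congr rfl fun _ _ => by rw [mul_comm]

/-! ## HTL normal forms, their block decompositions, and the deformation space -/

/-- An unramified Hukuhara-Turrittin-Levelt normal form
`H = (S_k / z ^ k + ⋯ + S₁ / z + S₀ + N₀) dz / z` of rank `n`: the matrices `S_i` are diagonal
(given here by their diagonals), and `N₀` is nilpotent and commutes with every `S_i`. -/
structure HTLNormalForm (n k : ℕ) where
  S : Fin (k + 1) → Fin n → ℂ
  N₀ : Mat n
  nilpotent : IsNilpotent N₀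
  commute : ∀ i, Commute (Matrix.diagonal (S i)) N₀

namespace HTLNormalForm

variable {n k : ℕ} (H : HTLNormalForm n k)

/-- The basis vectors `e_p` and `e_q` lie in the same simultaneous eigenspace of
`(S_i, S_{i+1}, …, S_k)`.  The classes of this equivalence relation are the blocks of the
composition `𝐦_i` of `n`; for `i = k + 1` there is only one block. -/
def SameBlock (i : ℕ) (p q : Fin n) : Prop :=
  ∀ l : Fin (k + 1), i ≤ l → H.S l p = H.S l q

/-- For `p, q` in different blocks of `𝐦_i`, with `m ≥ i` the largest index such that
`S_m` has different eigenvalues on `e_p` and `e_q`, this is the polynomial `α^*_{i;p,q}`. -/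
noncomputable def alphaStar (c : Fin (k + 1) → ℂ) (i m : Fin (k + 1)) (p q : Fin n) : ℂ :=
  ∑ l ∈ Finset.Icc i m, (H.S l p - H.S l q) * ∏ ν ∈ Finset.Ioc l m, (c i - c ν)

/-- The Zariski open subset `𝔻(H)` of `ℂ^{k+1}`, as a set. -/
def deformationSet : Set (Fin (k + 1) → ℂ) :=
  {c | ∀ (i m : Fin (k + 1)) (p q : Fin n), (i : ℕ) < k → i ≤ m → H.S m p ≠ H.S m q →
    (∀ l, m < l → H.S l p = H.S l q) → H.alphaStar c i m p q ≠ 0}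

theorem isOpen_deformationSet : IsOpen H.deformationSet := by
  have : H.deformationSet = ⋂ (i : Fin (k + 1)) (m : Fin (k + 1)) (p : Fin n) (q : Fin n),
      {c | (i : ℕ) < k → i ≤ m → H.S m p ≠ H.S m q →
        (∀ l, m < l → H.S l p = H.S l q) → H.alphaStar c i m p q ≠ 0} := by
    ext c; simp [deformationSet]
  rw [this]
  refine isOpen_iInter_of_finite fun i => isOpen_iInter_of_finite fun m =>
    isOpen_iInter_of_finite fun p => isOpen_iInter_of_finite fun q => ?_
  by_cases h : (i : ℕ) < k ∧ i ≤ m ∧ H.S m p ≠ H.S m q ∧ ∀ l, m < l → H.S l p = H.S l q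
  · have h2 : {c | (i : ℕ) < k → i ≤ m → H.S m p ≠ H.S m q →
        (∀ l, m < l → H.S l p = H.S l q) → H.alphaStar c i m p q ≠ 0} =
        {c | H.alphaStar c i m p q ≠ 0} := by
      ext c; simp only [Set.mem_ofPred_eq]
      exact ⟨fun g => g h.1 h.2.1 h.2.2.1 h.2.2.2, fun g _ _ _ _ => g⟩
    rw [h2]
    refine isOpen_ne_fun ?_ continuous_const
    unfold alphaStar
    fun_prop
  · convert isOpen_univ
    ext c; simp only [Set.mem_ofPred_eq, Set.mem_univ, iff_true]
    exact fun a b d e => (h ⟨a, b, d, e⟩).elim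

/-- The deformation space `𝔻(H) ⊆ ℂ^{k+1}`. -/
def deformationSpace : TopologicalSpace.Opens (Fin (k + 1) → ℂ) :=
  ⟨H.deformationSet, H.isOpen_deformationSet⟩

theorem zero_mem_deformationSpace : (0 : Fin (k + 1) → ℂ) ∈ H.deformationSpace := by
  intro i m p q _ him hne _
  have : H.alphaStar 0 i m p q = H.S m p - H.S m q := by
    unfold alphaStar
    rw [Finset.sum_eq_single m]
    · simp
    · intro l hl hlm
      have : l < m := lt_of_le_of_ne (Finset.mem_Icc.mp hl).2 hlm
      rw [Finset.prod_eq_zero (i := m) (by simp [this]) (by simp), mul_zero]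
    · intro h; exact (h (by simp [him])).elim
  rw [this]
  exact sub_ne_zero.mpr hne

end HTLNormalForm

/-- An ordering of the sequence `𝐦₁ ≤ 𝐦₂ ≤ ⋯ ≤ 𝐦_k`: for each `i` a total ordering `⪯_i` of the
blocks of `𝐦_i`, such that the refinement maps are monotone.  An ordering of the blocks is given as
the total preorder that it induces on `{1, …, n}`. -/
structure BlockOrdering {n k : ℕ} (H : HTLNormalForm n k) where
  le : ℕ → Fin n → Fin n → Prop
  total : ∀ i, 1 ≤ i → i ≤ k → ∀ p q, le i p q ∨ le i q p
  trans : ∀ i, 1 ≤ i → i ≤ k → ∀ p q r, le i p q → le i q r → le i p r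
  antisymm_iff : ∀ i, 1 ≤ i → i ≤ k → ∀ p q, (le i p q ∧ le i q p) ↔ H.SameBlock i p q
  mono : ∀ i, 1 ≤ i → i + 1 ≤ k → ∀ p q, le i p q → le (i + 1) p q

section Nilpotent

variable {n k : ℕ} {H : HTLNormalForm n k} (o : BlockOrdering H)

/-- The pairs `(p, q)` for which matrix entries of `𝔫⁻_{𝐦_l^{l+1}}` may be nonzero: `p` and `q` are
in the same block of `𝐦_{l+1}`, and the block of `p` precedes that of `q` in `𝐦_l`.  (A matrix with
entry only at `(p, q)` maps `e_q` to a multiple of `e_p`.) -/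
def BlockOrdering.Below (l : ℕ) (p q : Fin n) : Prop :=
  H.SameBlock (l + 1) p q ∧ o.le l p q ∧ ¬ o.le l q p

theorem BlockOrdering.Below.trans {l : ℕ} (h1 : 1 ≤ l) (hk : l ≤ k) {p q r : Fin n}
    (hpq : o.Below l p q) (hqr : o.Below l q r) : o.Below l p r :=
  ⟨fun i hi => (hpq.1 i hi).trans (hqr.1 i hi), o.trans l h1 hk _ _ _ hpq.2.1 hqr.2.1,
    fun h => hpq.2.2 (o.trans l h1 hk _ _ _ hqr.2.1 h)⟩

/-- The nilpotent subalgebra `𝔫⁻_{𝐦_l^{l+1}} = 𝔩_{𝐦_{l+1}} ∩ 𝔫⁻_{𝐦_l}` of `M_n(ℂ)`. -/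
def nilMinus (l : ℕ) : Submodule ℂ (Mat n) where
  carrier := {A | ∀ p q, A p q ≠ 0 → o.Below l p q}
  add_mem' {A B} hA hB p q h := by
    by_contra hc
    have h1 : A p q = 0 := by_contra fun h => hc (hA p q h)
    have h2 : B p q = 0 := by_contra fun h => hc (hB p q h)
    exact h (by simp [h1, h2])
  zero_mem' p q h := (h rfl).elim
  smul_mem' a A hA p q h := hA p q fun h0 => h (by simp [h0])

theorem nilMinus_mul {l : ℕ} (h1 : 1 ≤ l) (hk : l ≤ k) {A B : Mat n}
    (hA : A ∈ nilMinus o l) (hB : B ∈ nilMinus o l) : A * B ∈ nilMinus o l := by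
  intro p q h
  rw [Matrix.mul_apply] at h
  obtain ⟨r, _, hr⟩ := Finset.exists_ne_zero_of_sum_ne_zero h
  exact BlockOrdering.Below.trans o h1 hk (hA p r (left_ne_zero_of_mul hr))
    (hB r q (right_ne_zero_of_mul hr))

theorem newtonMulCoord_mem {l : ℕ} (h1 : 1 ≤ l) (hk : l ≤ k) (c : ℕ → ℂ) (m : ℕ)
    {A B : Fin m → Mat n} (hA : ∀ i, A i ∈ nilMinus o l) (hB : ∀ i, B i ∈ nilMinus o l) (t : Fin m) :
    newtonMulCoord c m A B t ∈ nilMinus o l :=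
  Submodule.sum_mem _ fun i _ => Submodule.sum_mem _ fun j _ =>
    Submodule.smul_mem _ _ (nilMinus_mul o h1 hk (hA i) (hB j))

/-- The space `𝔫^{(l)} = (𝔫⁻_{𝐦_l^{l+1}})^{⊕ (l-1)}` of tuples `(X₁, …, X_{l-1})`. -/
def NilTuple (l : ℕ) : Type := Fin (l - 1) → nilMinus o l

noncomputable instance (l : ℕ) : NormedAddCommGroup (NilTuple o l) :=
  inferInstanceAs (NormedAddCommGroup (Fin (l - 1) → nilMinus o l))

noncomputable instance (l : ℕ) : NormedSpace ℂ (NilTuple o l) :=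
  inferInstanceAs (NormedSpace ℂ (Fin (l - 1) → nilMinus o l))

instance (l : ℕ) : FiniteDimensional ℂ (NilTuple o l) :=
  inferInstanceAs (FiniteDimensional ℂ (Fin (l - 1) → nilMinus o l))

variable {o} in
/-- The matrices of a tuple. -/
def NilTuple.toMat {l : ℕ} : NilTuple o l →ₗ[ℂ] (Fin (l - 1) → Mat n) where
  toFun X i := (X i : Mat n)
  map_add' _ _ := rfl
  map_smul' _ _ := rfl

variable {o} in
theorem NilTuple.toMat_mem {l : ℕ} (X : NilTuple o l) (i : Fin (l - 1)) :
    X.toMat i ∈ nilMinus o l := (X i).2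

variable {o} in
theorem NilTuple.toMat_injective {l : ℕ} :
    Function.Injective (NilTuple.toMat : NilTuple o l → Fin (l - 1) → Mat n) :=
  fun _ _ h => funext fun i => Subtype.ext (congrFun h i)

/-- The tuple with given matrices. -/
def NilTuple.ofMat {l : ℕ} (A : Fin (l - 1) → Mat n) (hA : ∀ i, A i ∈ nilMinus o l) :
    NilTuple o l := fun i => ⟨A i, hA i⟩

theorem NilTuple.toMat_ofMat {l : ℕ} (A : Fin (l - 1) → Mat n) (hA : ∀ i, A i ∈ nilMinus o l) :
    (NilTuple.ofMat o A hA).toMat = A := rfl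

/-- The isomorphism `φ_c` from `𝔫^{(l)}` onto the group
`N⁻_{𝐦_l^{l+1}}(ℂ[z] / ⟨(z - c₀)⋯(z - c_{l-1})⟩)¹`, which sends `(X_i)` to
`E_n + ∑_{i=1}^{l-1} X_i (z - c₀)⋯(z - c_{i-1})`. -/
noncomputable def phi (c : ℕ → ℂ) (l : ℕ) (X : NilTuple o l) :
    Matrix (Fin n) (Fin n) (DefRing c (l - 1 + 1)) :=
  1 + newtonMat c (l - 1) X.toMat

theorem phi_injective (c : ℕ → ℂ) (l : ℕ) : Function.Injective (phi o c l) := by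
  intro X Y h
  have h2 := congrArg (newtonCoeff c (l - 1)) (add_left_cancel h)
  rw [newtonCoeff_newtonMat, newtonCoeff_newtonMat] at h2
  exact NilTuple.toMat_injective h2

theorem phi_zero (c : ℕ → ℂ) (l : ℕ) : phi o c l 0 = 1 := by
  unfold phi
  rw [map_zero, map_zero, add_zero]

/-- The product of two elements of `𝔫^{(l)}` in coordinates. -/
noncomputable def mulTuple {l : ℕ} (h1 : 1 ≤ l) (hk : l ≤ k) (c : ℕ → ℂ) (X Y : NilTuple o l) :
    NilTuple o l :=
  X + Y + NilTuple.ofMat o (newtonMulCoord c (l - 1) X.toMat Y.toMat)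
    (newtonMulCoord_mem o h1 hk c _ X.toMat_mem Y.toMat_mem)

theorem phi_mulTuple {l : ℕ} (h1 : 1 ≤ l) (hk : l ≤ k) (c : ℕ → ℂ) (X Y : NilTuple o l) :
    phi o c l (mulTuple o h1 hk c X Y) = phi o c l X * phi o c l Y := by
  unfold phi mulTuple
  rw [map_add, map_add, map_add, map_add, NilTuple.toMat_ofMat, ← newtonMat_mul]
  noncomm_ring

/-- The inverse of `φ_c`, extended to all matrices. -/
noncomputable def phiInv (c : ℕ → ℂ) (l : ℕ)
    (M : Matrix (Fin n) (Fin n) (DefRing c (l - 1 + 1))) : NilTuple o l :=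
  Function.invFun (phi o c l) M

/-- The multiplication `φ_c⁻¹(φ_c(X) φ_c(Y))`. -/
noncomputable def fibreMul (l : ℕ) (c : ℕ → ℂ) (X Y : NilTuple o l) : NilTuple o l :=
  phiInv o c l (phi o c l X * phi o c l Y)

theorem fibreMul_eq {l : ℕ} (h1 : 1 ≤ l) (hk : l ≤ k) (c : ℕ → ℂ) (X Y : NilTuple o l) :
    fibreMul o l c X Y = mulTuple o h1 hk c X Y := by
  unfold fibreMul phiInv
  rw [← phi_mulTuple o h1 hk]
  exact Function.leftInverse_invFun (phi_injective o c l) _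

theorem phi_fibreMul {l : ℕ} (h1 : 1 ≤ l) (hk : l ≤ k) (c : ℕ → ℂ) (X Y : NilTuple o l) :
    phi o c l (fibreMul o l c X Y) = phi o c l X * phi o c l Y := by
  rw [fibreMul_eq o h1 hk, phi_mulTuple]

theorem exists_rank {l : ℕ} (h1 : 1 ≤ l) (hk : l ≤ k) :
    ∃ rk : Fin n → ℕ, (∀ p, rk p ≤ n) ∧ ∀ p q, o.Below l p q → rk p < rk q := by
  classical
  refine ⟨fun p => (Finset.univ.filter fun r => o.Below l r p).card, fun p => ?_, fun p q h => ?_⟩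
  · exact (Finset.card_filter_le _ _).trans (by simp)
  · apply Finset.card_lt_card
    rw [Finset.ssubset_iff_of_subset]
    · refine ⟨p, by simpa using h, fun hp => ?_⟩
      have hp' := (Finset.mem_filter.mp hp).2
      exact hp'.2.2 hp'.2.1
    · intro r hr
      simp only [Finset.mem_filter, Finset.mem_univ, true_and] at hr ⊢
      exact BlockOrdering.Below.trans o h1 hk hr h

theorem newtonMat_pow_entry {l : ℕ} (c : ℕ → ℂ) (m : ℕ) (A : Fin m → Mat n)
    (hA : ∀ i, A i ∈ nilMinus o l) (rk : Fin n → ℕ)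
    (hr : ∀ p q, o.Below l p q → rk p < rk q) (N : ℕ) (p q : Fin n)
    (h : ((newtonMat c m A) ^ N) p q ≠ 0) : rk p + N ≤ rk q := by
  induction N generalizing q with
  | zero =>
    rw [pow_zero, Matrix.one_apply] at h
    split_ifs at h with hpq
    · subst hpq; simp
    · exact (h rfl).elim
  | succ N ih =>
    rw [pow_succ, Matrix.mul_apply] at h
    obtain ⟨r, _, hr'⟩ := Finset.exists_ne_zero_of_sum_ne_zero h
    have h1 := ih r (left_ne_zero_of_mul hr')
    have h2 : newtonMat c m A r q ≠ 0 := right_ne_zero_of_mul hr'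
    have h3 : o.Below l r q := by
      by_contra hc
      apply h2
      simp only [newtonMat, LinearMap.coe_mk, AddHom.coe_mk, Matrix.of_apply]
      refine Finset.sum_eq_zero fun i _ => ?_
      have : A i r q = 0 := by_contra fun h => hc (hA i r q h)
      rw [this, zero_smul]
    have := hr r q h3
    omega

theorem newtonMat_neg_pow {l : ℕ} (h1 : 1 ≤ l) (hk : l ≤ k) (c : ℕ → ℂ) (X : NilTuple o l)
    (N : ℕ) : ∃ Y : NilTuple o l, (-newtonMat c (l - 1) X.toMat) ^ (N + 1) =
      newtonMat c (l - 1) Y.toMat := by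
  induction N with
  | zero => exact ⟨-X, by rw [pow_one, map_neg, map_neg]⟩
  | succ N ih =>
    obtain ⟨Y, hY⟩ := ih
    refine ⟨NilTuple.ofMat o (newtonMulCoord c (l - 1) Y.toMat (-X).toMat)
      (newtonMulCoord_mem o h1 hk c _ Y.toMat_mem (-X).toMat_mem), ?_⟩
    rw [pow_succ, hY, ← map_neg, ← map_neg, newtonMat_mul, NilTuple.toMat_ofMat]

theorem exists_fibre_inverse {l : ℕ} (h1 : 1 ≤ l) (hk : l ≤ k) (c : ℕ → ℂ) (X : NilTuple o l) :
    ∃ Y, fibreMul o l c X Y = 0 ∧ fibreMul o l c Y X = 0 := by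
  obtain ⟨rk, hn, hr⟩ := exists_rank o h1 hk
  set x := newtonMat c (l - 1) X.toMat with hx
  have hnil : (-x) ^ (n + 1) = 0 := by
    have hneg : -x = newtonMat c (l - 1) (-X).toMat := by
      rw [hx, ← map_neg, ← map_neg]
    rw [hneg]
    refine Matrix.ext fun p q => by_contra fun hc => ?_
    have := newtonMat_pow_entry o c (l - 1) _ (-X).toMat_mem rk hr (n + 1) p q hc
    have := hn q
    omega
  choose Y hY using newtonMat_neg_pow o h1 hk c X
  have hsum : ∃ Z : NilTuple o l, phi o c l Z = ∑ i ∈ Finset.range (n + 1), (-x) ^ i := by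
    refine ⟨∑ N ∈ Finset.range n, Y N, ?_⟩
    rw [Finset.sum_range_succ', pow_zero, add_comm (∑ i ∈ Finset.range n, (-x) ^ (i + 1)) 1]
    unfold phi
    congr 1
    rw [map_sum, map_sum]
    exact Finset.sum_congr rfl fun N _ => (hY N).symm
  obtain ⟨Z, hZ⟩ := hsum
  have e1 : phi o c l X = 1 - (-x) := by rw [sub_neg_eq_add]; rfl
  refine ⟨Z, phi_injective o c l ?_, phi_injective o c l ?_⟩
  · rw [phi_fibreMul o h1 hk, phi_zero, hZ, e1, mul_neg_geom_sum, hnil, sub_zero]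
  · rw [phi_fibreMul o h1 hk, phi_zero, hZ, e1, geom_sum_mul_neg, hnil, sub_zero]

end Nilpotent

/-! ## Holomorphic Poisson structures and symplectic foliations -/

section Poisson

variable {E : Type*} [NormedAddCommGroup E] [NormedSpace ℂ E]

/-- The bracket `{f, g}(x) = dg_x(X_f(x))`, where `X_f(x) = π_x^♯(df_x)`. -/
noncomputable def bracketOf (sharp : E → (E →L[ℂ] ℂ) →L[ℂ] E) (f g : E → ℂ) (x : E) : ℂ :=
  fderiv ℂ g x (sharp x (fderiv ℂ f x))

/-- A holomorphic Poisson structure on an open subset `U` of a complex vector space: a holomorphic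
bivector field, given by the maps `π_x^♯ : T_x^* → T_x`, whose bracket on holomorphic functions
satisfies the Jacobi identity. -/
structure PoissonStructure (U : TopologicalSpace.Opens E) where
  sharp : E → (E →L[ℂ] ℂ) →L[ℂ] E
  holomorphic : AnalyticOnNhd ℂ sharp U
  skew : ∀ x ∈ U, ∀ α β : E →L[ℂ] ℂ, β (sharp x α) = -α (sharp x β)
  jacobi : ∀ W : Set E, IsOpen W → W ⊆ U → ∀ f g h : E → ℂ, AnalyticOnNhd ℂ f W →
    AnalyticOnNhd ℂ g W → AnalyticOnNhd ℂ h W → ∀ x ∈ W,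
      bracketOf sharp f (bracketOf sharp g h) x + bracketOf sharp g (bracketOf sharp h f) x +
        bracketOf sharp h (bracketOf sharp f g) x = 0

namespace PoissonStructure

variable {U : TopologicalSpace.Opens E} (P : PoissonStructure U)

/-- `y` is reached from `x` by an integral curve of the Hamiltonian vector field
`X_f = π^♯(df)` of a holomorphic function `f` on an open subset of `U`. -/
def HamiltonianStep (x y : E) : Prop :=
  ∃ (W : Set E) (f : E → ℂ) (γ : ℝ → E), IsOpen W ∧ W ⊆ U ∧ AnalyticOnNhd ℂ f W ∧
    γ 0 = x ∧ γ 1 = y ∧ ∀ t ∈ Set.Icc (0 : ℝ) 1, γ t ∈ W ∧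
      HasDerivWithinAt γ (P.sharp (γ t) (fderiv ℂ f (γ t))) (Set.Icc 0 1) t

/-- The symplectic leaf through `x`: all points that are joined to `x` by a finite chain of
integral curves of Hamiltonian vector fields. -/
def leaf (x : E) : Set E :=
  {y | Relation.ReflTransGen P.HamiltonianStep x y}

end PoissonStructure

/-- `L` is an embedded complex submanifold, and its tangent space at each of its points `x` is
`T x`: around each point there is a biholomorphic chart that straightens `L` to a linear
subspace. -/
def IsComplexSubmanifold (L : Set E) (T : E → Submodule ℂ E) : Prop :=
  ∀ x ∈ L, ∃ (e : OpenPartialHomeomorph E E) (F : Submodule ℂ E), x ∈ e.source ∧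
    AnalyticOnNhd ℂ e e.source ∧ AnalyticOnNhd ℂ e.symm e.target ∧
    (∀ y ∈ e.source, y ∈ L ↔ e y ∈ F) ∧
    ∀ y ∈ e.source, y ∈ L → T y = F.comap (fderiv ℂ e y : E →ₗ[ℂ] E)

/-- The family `(L_i, ω_i)` is the symplectic foliation of the Poisson manifold `U`: the `L_i` are
the symplectic leaves, each listed once; they are complex submanifolds, whose tangent
spaces are the images of `π^♯`; and the 2-form `ω_i` on `L_i` is the symplectic form of the leaf,
that is `ω_i(π^♯ α, π^♯ β) = π(α, β)`, so that `{f, g} = ω_i(X_f, X_g)` along `L_i`. -/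
structure IsSymplecticFoliation {U : TopologicalSpace.Opens E} (P : PoissonStructure U)
    {ι : Type*} (L : ι → Set E) (ω : ι → E → E → E → ℂ) : Prop where
  nonempty : ∀ i, (L i).Nonempty
  cover : ⋃ i, L i = U
  injective : Function.Injective L
  leaf : ∀ i, ∀ x ∈ L i, P.leaf x = L i
  submanifold : ∀ i, IsComplexSubmanifold (L i) fun x => (P.sharp x).range
  form : ∀ i, ∀ x ∈ L i, ∀ α β : E →L[ℂ] ℂ, ω i x (P.sharp x α) (P.sharp x β) = β (P.sharp x α)

theorem fderiv_bracket_const (Λ : (E →L[ℂ] ℂ) →L[ℂ] E) {g h : E → ℂ} {x : E}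
    (hg : AnalyticAt ℂ g x) (hh : AnalyticAt ℂ h x) (v : E) :
    fderiv ℂ (bracketOf (fun _ => Λ) g h) x v =
      fderiv ℂ (fderiv ℂ h) x v (Λ (fderiv ℂ g x)) +
        fderiv ℂ h x (Λ (fderiv ℂ (fderiv ℂ g) x v)) := by
  have h1 : HasFDerivAt (fderiv ℂ h) (fderiv ℂ (fderiv ℂ h) x) x :=
    hh.fderiv.differentiableAt.hasFDerivAt
  have h2 : HasFDerivAt (fderiv ℂ g) (fderiv ℂ (fderiv ℂ g) x) x :=
    hg.fderiv.differentiableAt.hasFDerivAt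
  have h3 : HasFDerivAt (fun y => Λ (fderiv ℂ g y)) (Λ.comp (fderiv ℂ (fderiv ℂ g) x)) x :=
    Λ.hasFDerivAt.comp x h2
  have h4 := (h1.clm_apply h3).fderiv
  have h5 : bracketOf (fun _ => Λ) g h = fun y => (fderiv ℂ h y) (Λ (fderiv ℂ g y)) := rfl
  rw [h5, h4]
  simp [add_comm]

theorem analyticAt_symm {f : E → ℂ} {x : E} (hf : AnalyticAt ℂ f x) (u v : E) :
    fderiv ℂ (fderiv ℂ f) x u v = fderiv ℂ (fderiv ℂ f) x v u :=
  (ContDiffAt.isSymmSndFDerivAt (n := 2) hf.contDiffAt (by simp)).eq u v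

/-- The Poisson structure with constant coefficients that is given by a skew map `Λ`. -/
noncomputable def constPoisson (U : TopologicalSpace.Opens E) (Λ : (E →L[ℂ] ℂ) →L[ℂ] E)
    (hΛ : ∀ α β : E →L[ℂ] ℂ, β (Λ α) = -α (Λ β)) : PoissonStructure U where
  sharp _ := Λ
  holomorphic := analyticOnNhd_const
  skew _ _ := hΛ
  jacobi W _ _ f g h hf hg hh x hx := by
    have e : ∀ {f g h : E → ℂ}, AnalyticAt ℂ f x → AnalyticAt ℂ g x → AnalyticAt ℂ h x →
        bracketOf (fun _ => Λ) f (bracketOf (fun _ => Λ) g h) x =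
          fderiv ℂ (fderiv ℂ h) x (Λ (fderiv ℂ f x)) (Λ (fderiv ℂ g x)) -
            fderiv ℂ (fderiv ℂ g) x (Λ (fderiv ℂ f x)) (Λ (fderiv ℂ h x)) := by
      intro f g h _ hg hh
      have := fderiv_bracket_const Λ hg hh (Λ (fderiv ℂ f x))
      rw [hΛ _ (fderiv ℂ h x)] at this
      exact this.trans (sub_eq_add_neg _ _).symm
    rw [e (hf x hx) (hg x hx) (hh x hx), e (hg x hx) (hh x hx) (hf x hx),
      e (hh x hx) (hf x hx) (hg x hx),
      analyticAt_symm (hf x hx) (Λ (fderiv ℂ h x)), analyticAt_symm (hg x hx) (Λ (fderiv ℂ h x)),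
      analyticAt_symm (hh x hx) (Λ (fderiv ℂ g x))]
    ring

end Poisson

/-! ## Cotangent bundles and products with a parameter space -/

section Cotangent

variable (W : Type*) [NormedAddCommGroup W] [NormedSpace ℂ W]

/-- The cotangent bundle `T^*W = W × W^*` of a complex vector space. -/
abbrev Cotangent := W × (W →L[ℂ] ℂ)

/-- The canonical 1-form on `T^*W`. -/
noncomputable def canonicalOneForm (z : Cotangent W) : Cotangent W →L[ℂ] ℂ :=
  z.2.comp (ContinuousLinearMap.fst ℂ W (W →L[ℂ] ℂ))

/-- The bilinear map `((u, η), (u', η')) ↦ η(u')`. -/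
noncomputable def cotangentPairing : Cotangent W →L[ℂ] Cotangent W →L[ℂ] ℂ :=
  ((ContinuousLinearMap.compL ℂ (Cotangent W) W ℂ).flip
    (ContinuousLinearMap.fst ℂ W (W →L[ℂ] ℂ))).comp (ContinuousLinearMap.snd ℂ W (W →L[ℂ] ℂ))

/-- The standard symplectic form on `T^*W`, the exterior derivative of the canonical 1-form (see
`cotangentForm_eq`).  It has constant coefficients. -/
noncomputable def cotangentForm : Cotangent W →L[ℂ] Cotangent W →L[ℂ] ℂ :=
  cotangentPairing W - (cotangentPairing W).flip

variable {W}

theorem cotangentForm_apply (u v : Cotangent W) : cotangentForm W u v = u.2 v.1 - v.2 u.1 := by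
  simp [cotangentForm, cotangentPairing]

theorem cotangentForm_eq (z u v : Cotangent W) :
    cotangentForm W u v =
      fderiv ℂ (canonicalOneForm W) z u v - fderiv ℂ (canonicalOneForm W) z v u := by
  have h : canonicalOneForm W = cotangentPairing W := by
    funext z; ext <;> simp [canonicalOneForm, cotangentPairing]
  rw [h, ContinuousLinearMap.fderiv]
  simp [cotangentForm]

theorem cotangentForm_nondegenerate (u : Cotangent W) (h : ∀ v, cotangentForm W u v = 0) :
    u = 0 := by
  simp only [cotangentForm_apply] at h
  have h2 : u.2 = 0 := by ext w; simpa using h (w, 0)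
  have h1 : u.1 = 0 := by
    by_contra hne
    obtain ⟨f, hf⟩ := SeparatingDual.exists_ne_zero (R := ℂ) hne
    exact hf (by simpa using h (0, f))
  exact Prod.ext h1 h2

/-- The symplectic form of the product of cotangent bundles `T^*W_i`. -/
noncomputable def productForm {ι : Type*} [Fintype ι] (W : ι → Type*)
    [∀ i, NormedAddCommGroup (W i)] [∀ i, NormedSpace ℂ (W i)] :
    (∀ i, Cotangent (W i)) →L[ℂ] (∀ i, Cotangent (W i)) →L[ℂ] ℂ :=
  ∑ i, (cotangentForm (W i)).bilinearComp (ContinuousLinearMap.proj i)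
    (ContinuousLinearMap.proj i)

theorem productForm_apply {ι : Type*} [Fintype ι] (W : ι → Type*)
    [∀ i, NormedAddCommGroup (W i)] [∀ i, NormedSpace ℂ (W i)] (u v : ∀ i, Cotangent (W i)) :
    productForm W u v = ∑ i, cotangentForm (W i) (u i) (v i) := by
  simp [productForm]

theorem productForm_skew {ι : Type*} [Fintype ι] (W : ι → Type*)
    [∀ i, NormedAddCommGroup (W i)] [∀ i, NormedSpace ℂ (W i)] (u v : ∀ i, Cotangent (W i)) :
    productForm W u v = -productForm W v u := by
  simp only [productForm_apply, cotangentForm_apply, ← Finset.sum_neg_distrib, neg_sub]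

theorem productForm_injective {ι : Type*} [Fintype ι] (W : ι → Type*)
    [∀ i, NormedAddCommGroup (W i)] [∀ i, NormedSpace ℂ (W i)] :
    Function.Injective (productForm W) := by
  classical
  rw [injective_iff_map_eq_zero]
  intro u hu
  funext i
  refine cotangentForm_nondegenerate _ fun w => ?_
  have h := congrArg (fun f => f (Pi.single i w)) hu
  simp only [productForm_apply, zero_apply] at h
  rw [Finset.sum_eq_single i] at h
  · simpa using h
  · intro j _ hj; simp [Pi.single_eq_of_ne hj]
  · simp

end Cotangent

section Product

variable {V B : Type*} [NormedAddCommGroup V] [NormedSpace ℂ V] [FiniteDimensional ℂ V]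
  [NormedAddCommGroup B] [NormedSpace ℂ B]

/-- For a nondegenerate form `Ω` on `V`, the map `α ↦ X` with `α = Ω(·, X)`. -/
noncomputable def symplecticSharp (Ω : V →L[ℂ] V →L[ℂ] ℂ) (hΩ : Function.Injective Ω) :
    (V →L[ℂ] ℂ) →L[ℂ] V :=
  haveI h : Module.finrank ℂ V = Module.finrank ℂ (V →L[ℂ] ℂ) :=
    (Subspace.dual_finrank_eq (K := ℂ) (V := V)).symm.trans
      (LinearMap.toContinuousLinearMap (𝕜 := ℂ) (E := V) (F' := ℂ)).finrank_eq
  (-1 : ℂ) • LinearMap.toContinuousLinearMap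
    ((LinearEquiv.ofInjectiveOfFinrankEq (Ω : V →ₗ[ℂ] V →L[ℂ] ℂ) hΩ h).symm :
      (V →L[ℂ] ℂ) →ₗ[ℂ] V)

theorem symplecticSharp_spec (Ω : V →L[ℂ] V →L[ℂ] ℂ) (hΩ : Function.Injective Ω)
    (α : V →L[ℂ] ℂ) (v : V) : Ω (symplecticSharp Ω hΩ α) v = -α v := by
  have h : ∀ (e : V ≃ₗ[ℂ] (V →L[ℂ] ℂ)), (∀ x, e x = Ω x) → Ω ((-1 : ℂ) • (e.symm α)) v = -α v := by
    intro e he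
    rw [map_smul, ← he, e.apply_symm_apply]; simp
  exact h _ fun x => rfl

/-- The open subset `V × D` of `V × B`. -/
def openProd (V : Type*) [TopologicalSpace V] {B : Type*} [TopologicalSpace B]
    (D : TopologicalSpace.Opens B) : TopologicalSpace.Opens (V × B) :=
  ⟨{x | x.2 ∈ D}, D.isOpen.preimage continuous_snd⟩

/-- The Poisson manifold `V × D`, the product of the symplectic vector space `(V, Ω)` and of `D`
with the zero Poisson structure.  In terms of functions, `{f, g} = Ω(X_f, X_g)`. -/
noncomputable def productPoisson (Ω : V →L[ℂ] V →L[ℂ] ℂ) (hΩ : Function.Injective Ω)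
    (hskew : ∀ u v, Ω u v = -Ω v u) (D : TopologicalSpace.Opens B) :
    PoissonStructure (openProd V D) :=
  constPoisson _ ((ContinuousLinearMap.inl ℂ V B).comp ((symplecticSharp Ω hΩ).comp
    ((ContinuousLinearMap.compL ℂ V (V × B) ℂ).flip (ContinuousLinearMap.inl ℂ V B)))) (by
    intro α β
    set a : V →L[ℂ] ℂ := α.comp (ContinuousLinearMap.inl ℂ V B)
    set b : V →L[ℂ] ℂ := β.comp (ContinuousLinearMap.inl ℂ V B)
    change b (symplecticSharp Ω hΩ a) = -a (symplecticSharp Ω hΩ b)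
    have h1 := symplecticSharp_spec Ω hΩ a (symplecticSharp Ω hΩ b)
    have h2 := symplecticSharp_spec Ω hΩ b (symplecticSharp Ω hΩ a)
    rw [hskew, h2, neg_neg] at h1
    exact h1)

end Product

/-! ## Complex Lie groupoids and relative cotangent bundles -/

section Groupoid

variable {E F : Type*} [NormedAddCommGroup E] [NormedSpace ℂ E] [NormedAddCommGroup F]
  [NormedSpace ℂ F]

/-- A complex Lie groupoid with manifold of arrows `Γ` and manifold of units `M` (open subsets of
complex vector spaces); `M` is embedded in `Γ` by the section `unit`, and `mul g h` is the product
of `g` and `h` if `source g = target h`, and meaningless otherwise. -/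
structure ComplexLieGroupoid (Γ : TopologicalSpace.Opens E) (M : TopologicalSpace.Opens F) where
  unit : F → E
  source : E → F
  target : E → F
  mul : E → E → E
  unit_mem : ∀ x ∈ M, unit x ∈ Γ
  source_mem : ∀ g ∈ Γ, source g ∈ M
  target_mem : ∀ g ∈ Γ, target g ∈ M
  unit_holomorphic : AnalyticOnNhd ℂ unit M
  source_holomorphic : AnalyticOnNhd ℂ source Γ
  target_holomorphic : AnalyticOnNhd ℂ target Γ
  source_submersion : ∀ g ∈ Γ, Function.Surjective (fderiv ℂ source g)
  target_submersion : ∀ g ∈ Γ, Function.Surjective (fderiv ℂ target g)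
  source_unit : ∀ x ∈ M, source (unit x) = x
  target_unit : ∀ x ∈ M, target (unit x) = x
  mul_holomorphic : AnalyticOn ℂ (fun x : E × E => mul x.1 x.2)
    {x | x.1 ∈ Γ ∧ x.2 ∈ Γ ∧ source x.1 = target x.2}
  mul_mem : ∀ g ∈ Γ, ∀ h ∈ Γ, source g = target h → mul g h ∈ Γ
  source_mul : ∀ g ∈ Γ, ∀ h ∈ Γ, source g = target h → source (mul g h) = source h
  target_mul : ∀ g ∈ Γ, ∀ h ∈ Γ, source g = target h → target (mul g h) = target g
  mul_assoc : ∀ g ∈ Γ, ∀ h ∈ Γ, ∀ j ∈ Γ, source g = target h → source h = target j →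
    mul (mul g h) j = mul g (mul h j)
  unit_mul : ∀ g ∈ Γ, mul (unit (target g)) g = g
  mul_unit : ∀ g ∈ Γ, mul g (unit (source g)) = g
  inverse : ∀ g ∈ Γ, ∃ h ∈ Γ, source h = target g ∧ target h = source g ∧
    mul g h ∈ unit '' (M : Set F) ∧ mul h g ∈ unit '' (M : Set F)

/-- The relative cotangent space `T_x^* / θ^* T_{θ(x)}^*` of a map `θ` at `x`. -/
abbrev RelCotangentSpace (θ : E → F) (x : E) :=
  (E →L[ℂ] ℂ) ⧸ ((ContinuousLinearMap.compL ℂ E F ℂ).flip (fderiv ℂ θ x)).range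

/-- The relative cotangent space of a groupoid arrow, with respect to the source map. -/
abbrev ComplexLieGroupoid.RelCotangent {Γ : TopologicalSpace.Opens E}
    {M : TopologicalSpace.Opens F} (G : ComplexLieGroupoid Γ M) (g : E) :=
  RelCotangentSpace G.source g

/-- For the projection `W × F → F`, relative covectors are covectors of `W`: a covector is
restricted to the vertical vectors. -/
noncomputable def relCotangentSndEquiv (W : Type*) [NormedAddCommGroup W] [NormedSpace ℂ W]
    (x : W × F) :
    RelCotangentSpace (Prod.snd : W × F → F) x ≃ₗ[ℂ] (W →L[ℂ] ℂ) :=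
  let res : ((W × F) →L[ℂ] ℂ) →ₗ[ℂ] (W →L[ℂ] ℂ) :=
    ((ContinuousLinearMap.compL ℂ W (W × F) ℂ).flip (ContinuousLinearMap.inl ℂ W F) :
      ((W × F) →L[ℂ] ℂ) →L[ℂ] (W →L[ℂ] ℂ))
  haveI hres : ∀ α w, res α w = α (w, 0) := fun α w => rfl
  (Submodule.quotEquivOfEq _ res.ker (by
    ext α
    rw [LinearMap.mem_ker, LinearMap.mem_range]
    constructor
    · rintro ⟨β, rfl⟩
      ext w
      rw [hres]
      simp [fderiv_snd]
    · intro h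
      refine ⟨α.comp (ContinuousLinearMap.inr ℂ W F), ?_⟩
      ext y
      · have h0 : α (y, 0) = 0 := (hres α y).symm.trans (congrArg (fun f => f y) h)
        simp [fderiv_snd, h0, ← Prod.zero_eq_mk]
      · simp [fderiv_snd])).trans
    (res.quotKerEquivOfSurjective fun β =>
      ⟨β.comp (ContinuousLinearMap.fst ℂ W F), by ext w; rw [hres]; simp⟩)

/-- The relative cotangent spaces of a groupoid whose source map is the projection `W × F → F`. -/
noncomputable def ComplexLieGroupoid.relCotangentEquiv {W : Type*} [NormedAddCommGroup W]
    [NormedSpace ℂ W] {Γ : TopologicalSpace.Opens (W × F)} {M : TopologicalSpace.Opens F}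
    (G : ComplexLieGroupoid Γ M) (hG : G.source = Prod.snd) (g : W × F) :
    G.RelCotangent g ≃ₗ[ℂ] (W →L[ℂ] ℂ) :=
  (Submodule.quotEquivOfEq _ _ (by rw [hG])).trans (relCotangentSndEquiv W g)

/-- The total space of the relative cotangent bundle of such a groupoid with arrows `W × M` is
`T^*W × M`. -/
noncomputable def ComplexLieGroupoid.relCotangentBundleEquiv {W : Type*} [NormedAddCommGroup W]
    [NormedSpace ℂ W] {M : TopologicalSpace.Opens F}
    (G : ComplexLieGroupoid (openProd W M) M) (hG : G.source = Prod.snd) :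
    (Σ g : openProd W M, G.RelCotangent g) ≃ openProd (Cotangent W) M where
  toFun g := ⟨((g.1.1.1, G.relCotangentEquiv hG g.1.1 g.2), g.1.1.2), g.1.2⟩
  invFun x := ⟨⟨(x.1.1.1, x.1.2), x.2⟩, (G.relCotangentEquiv hG _).symm x.1.1.2⟩
  left_inv g := by
    obtain ⟨⟨g, hg⟩, α⟩ := g
    simp
  right_inv x := by simp

/-- The total space of the direct sum, over `M`, of the relative cotangent bundles of Lie groupoids
`G i` whose arrows form the trivial bundles `W i × M → M`: by `relCotangentBundleEquiv` each of the
summands is `T^*W_i × M → M`. -/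
noncomputable def relCotangentSum {ι : Type*} {W : ι → Type*} [∀ i, NormedAddCommGroup (W i)]
    [∀ i, NormedSpace ℂ (W i)] {M : TopologicalSpace.Opens F}
    (_G : ∀ i, ComplexLieGroupoid (openProd (W i) M) M) :
    TopologicalSpace.Opens ((∀ i, Cotangent (W i)) × F) :=
  openProd (∀ i, Cotangent (W i)) M

end Groupoid

section NilGroupoid

variable {n k : ℕ} {H : HTLNormalForm n k} (o : BlockOrdering H)

/-- The point `(c₀, …, c_k)` as a sequence. -/
def paramSeq (c : Fin (k + 1) → ℂ) (j : ℕ) : ℂ := if h : j < k + 1 then c ⟨j, h⟩ else 0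

theorem paramSeq_zero : paramSeq (0 : Fin (k + 1) → ℂ) = 0 := by
  funext j; simp [paramSeq]

theorem paramSeq_analytic (j : ℕ) (c : Fin (k + 1) → ℂ) :
    AnalyticAt ℂ (fun c : Fin (k + 1) → ℂ => paramSeq c j) c := by
  unfold paramSeq
  split_ifs with h
  · exact (ContinuousLinearMap.proj (R := ℂ) (φ := fun _ : Fin (k + 1) => ℂ) ⟨j, h⟩).analyticAt c
  · exact analyticAt_const

theorem structureConst_analytic (i j t : ℕ) (c : Fin (k + 1) → ℂ) :
    AnalyticAt ℂ (fun c : Fin (k + 1) → ℂ => structureConst (paramSeq c) i j t) c := by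
  induction i generalizing t with
  | zero => exact analyticAt_const
  | succ i ih =>
    cases t with
    | zero => exact ((paramSeq_analytic 0 c).sub (paramSeq_analytic i c)).mul (ih 0)
    | succ t =>
      exact (ih t).add (((paramSeq_analytic (t + 1) c).sub (paramSeq_analytic i c)).mul (ih (t + 1)))

theorem analyticAt_matrix {E : Type*} [NormedAddCommGroup E] [NormedSpace ℂ E] {f : E → Mat n}
    {x : E} (h : ∀ p q, AnalyticAt ℂ (fun y => f y p q) x) : AnalyticAt ℂ f x := by
  have : f = fun y => ∑ p, ∑ q, f y p q • Matrix.single p q (1 : ℂ) := by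
    funext y
    conv_lhs => rw [Matrix.matrix_eq_sum_single (f y)]
    simp
  rw [this]
  exact Finset.analyticAt_fun_sum _ fun p _ => Finset.analyticAt_fun_sum _ fun q _ =>
    (h p q).smul analyticAt_const

theorem mulTuple_analytic {l : ℕ} (h1 : 1 ≤ l) (hk : l ≤ k)
    (x : (NilTuple o l × (Fin (k + 1) → ℂ)) × (NilTuple o l × (Fin (k + 1) → ℂ))) :
    AnalyticAt ℂ (fun x : (NilTuple o l × (Fin (k + 1) → ℂ)) ×
      (NilTuple o l × (Fin (k + 1) → ℂ)) =>
        mulTuple o h1 hk (paramSeq x.1.2) x.1.1 x.2.1) x := by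
  obtain ⟨π, hπ⟩ := LinearMap.exists_leftInverse_of_injective
    (NilTuple.toMat : NilTuple o l →ₗ[ℂ] _) (LinearMap.ker_eq_bot.mpr NilTuple.toMat_injective)
  let π' : (Fin (l - 1) → Mat n) →L[ℂ] NilTuple o l := LinearMap.toContinuousLinearMap π
  have hπ' : ∀ A (hA : ∀ i, A i ∈ nilMinus o l), NilTuple.ofMat o A hA = π' A := fun A hA =>
    (congrArg (fun f => f (NilTuple.ofMat o A hA)) hπ).symm
  have hX : ∀ (i : Fin (l - 1)) (p q : Fin n), AnalyticAt ℂ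
      (fun x : (NilTuple o l × (Fin (k + 1) → ℂ)) × (NilTuple o l × (Fin (k + 1) → ℂ)) =>
        x.1.1.toMat i p q) x := by
    intro i p q
    let L : Mat n →ₗ[ℂ] ℂ := Matrix.entryLinearMap ℂ ℂ p q
    exact ((L.comp ((LinearMap.proj i).comp NilTuple.toMat)).toContinuousLinearMap.comp
      ((ContinuousLinearMap.fst ℂ _ _).comp (ContinuousLinearMap.fst ℂ _ _))).analyticAt x
  have hY : ∀ (i : Fin (l - 1)) (p q : Fin n), AnalyticAt ℂ
      (fun x : (NilTuple o l × (Fin (k + 1) → ℂ)) × (NilTuple o l × (Fin (k + 1) → ℂ)) =>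
        x.2.1.toMat i p q) x := by
    intro i p q
    let L : Mat n →ₗ[ℂ] ℂ := Matrix.entryLinearMap ℂ ℂ p q
    exact ((L.comp ((LinearMap.proj i).comp NilTuple.toMat)).toContinuousLinearMap.comp
      ((ContinuousLinearMap.fst ℂ _ _).comp (ContinuousLinearMap.snd ℂ _ _))).analyticAt x
  have hfst : AnalyticAt ℂ (fun x : (NilTuple o l × (Fin (k + 1) → ℂ)) ×
      (NilTuple o l × (Fin (k + 1) → ℂ)) => x.1.1) x :=
    ((ContinuousLinearMap.fst ℂ _ _).comp (ContinuousLinearMap.fst ℂ _ _)).analyticAt x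
  have hsnd : AnalyticAt ℂ (fun x : (NilTuple o l × (Fin (k + 1) → ℂ)) ×
      (NilTuple o l × (Fin (k + 1) → ℂ)) => x.2.1) x :=
    ((ContinuousLinearMap.fst ℂ _ _).comp (ContinuousLinearMap.snd ℂ _ _)).analyticAt x
  have hc : AnalyticAt ℂ (fun x : (NilTuple o l × (Fin (k + 1) → ℂ)) ×
      (NilTuple o l × (Fin (k + 1) → ℂ)) => x.1.2) x :=
    ((ContinuousLinearMap.snd ℂ _ _).comp (ContinuousLinearMap.fst ℂ _ _)).analyticAt x
  unfold mulTuple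
  simp only [hπ']
  refine (hfst.add hsnd).add (AnalyticAt.fun_comp (π'.analyticAt _)
    (AnalyticAt.pi fun t => analyticAt_matrix fun p q => ?_))
  simp only [newtonMulCoord, Matrix.sum_apply, Matrix.smul_apply, Matrix.mul_apply, smul_eq_mul]
  refine Finset.analyticAt_fun_sum _ fun i _ => Finset.analyticAt_fun_sum _ fun j _ => ?_
  refine AnalyticAt.mul ?_ (Finset.analyticAt_fun_sum _ fun r _ => (hX i p r).mul (hY j r q))
  exact (structureConst_analytic (i + 1) (j + 1) (t + 1) x.1.2).comp_of_eq hc rfl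

/-- The complex Lie groupoid `(N⁻)^{(l)}_{𝔻(H)}`: the trivial bundle `𝔫^{(l)} × 𝔻(H) → 𝔻(H)` with
the projection as source and target map, the zero section as units, and the multiplication
`φ_c⁻¹(φ_c(X) φ_c(Y))` on the fibre at `c`, which makes the fibre the group
`N⁻_{𝐦_l^{l+1}}(ℂ[z] / ⟨(z - c₀)⋯(z - c_{l-1})⟩)¹`. -/
noncomputable def nilGroupoid {l : ℕ} (h1 : 1 ≤ l) (hk : l ≤ k) :
    ComplexLieGroupoid (openProd (NilTuple o l) H.deformationSpace) H.deformationSpace where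
  unit c := (0, c)
  source := Prod.snd
  target := Prod.snd
  mul g h := (fibreMul o l (paramSeq g.2) g.1 h.1, g.2)
  unit_mem _ hx := hx
  source_mem _ hg := hg
  target_mem _ hg := hg
  unit_holomorphic _ _ := analyticAt_const.prod analyticAt_id
  source_holomorphic _ _ := analyticAt_snd
  target_holomorphic _ _ := analyticAt_snd
  source_submersion _ _ y := ⟨(0, y), by simp [fderiv_snd]⟩
  target_submersion _ _ y := ⟨(0, y), by simp [fderiv_snd]⟩
  source_unit _ _ := rfl
  target_unit _ _ := rfl
  mul_holomorphic := by
    simp only [fibreMul_eq o h1 hk]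
    intro x _
    exact ((mulTuple_analytic o h1 hk x).prod
      (((ContinuousLinearMap.snd ℂ _ _).comp
        (ContinuousLinearMap.fst ℂ _ _)).analyticAt x)).analyticWithinAt
  mul_mem _ hg _ _ _ := hg
  source_mul _ _ _ _ e := e
  target_mul _ _ _ _ _ := rfl
  mul_assoc g _ h _ j _ e _ := by
    obtain ⟨g, c⟩ := g
    obtain ⟨h, d⟩ := h
    obtain rfl : c = d := e
    refine Prod.ext (phi_injective o (paramSeq c) l ?_) rfl
    simp only [phi_fibreMul o h1 hk]
    exact _root_.mul_assoc _ _ _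
  unit_mul g _ := by
    refine Prod.ext (phi_injective o (paramSeq g.2) l ?_) rfl
    simp only [phi_fibreMul o h1 hk, phi_zero]
    exact one_mul _
  mul_unit g _ := by
    refine Prod.ext (phi_injective o (paramSeq g.2) l ?_) rfl
    simp only [phi_fibreMul o h1 hk, phi_zero]
    exact mul_one _
  inverse g hg := by
    obtain ⟨Y, hY1, hY2⟩ := exists_fibre_inverse o h1 hk (paramSeq g.2) g.1
    exact ⟨(Y, g.2), hg, rfl, rfl, ⟨g.2, hg, by rw [hY1]⟩, ⟨g.2, hg, by rw [hY2]⟩⟩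

/-- The total space of the relative cotangent bundle of `(N⁻)^{(l)}_{𝔻(H)}` over `𝔻(H)` is
`T^*𝔫^{(l)} × 𝔻(H)`. -/
noncomputable def nilGroupoidRelCotangentEquiv {l : ℕ} (h1 : 1 ≤ l) (hk : l ≤ k) :
    (Σ g : openProd (NilTuple o l) H.deformationSpace, (nilGroupoid o h1 hk).RelCotangent g) ≃
      openProd (Cotangent (NilTuple o l)) H.deformationSpace :=
  (nilGroupoid o h1 hk).relCotangentBundleEquiv rfl

/-! ## The deformation of the coadjoint orbit -/

/-- The direct sum of the spaces `T^*𝔫^{(l)}`, `l = 2, …, k`. -/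
abbrev DeformationFibre : Type := (l : Finset.Icc 2 k) → Cotangent (NilTuple o l)

/-- The total space `(𝕆_{H_irr})_{𝔻(H)}` of the direct sum over `𝔻(H)` of the relative cotangent
bundles `T^*𝔫^{(l)} × 𝔻(H) → 𝔻(H)` of the Lie groupoids `(N⁻)^{(l)}_{𝔻(H)}`, `l = 2, …, k`. -/
noncomputable def deformation : TopologicalSpace.Opens (DeformationFibre o × (Fin (k + 1) → ℂ)) :=
  relCotangentSum fun l : Finset.Icc 2 k =>
    nilGroupoid o (one_le_two.trans (Finset.mem_Icc.mp l.2).1) (Finset.mem_Icc.mp l.2).2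

/-- The Poisson structure of `(𝕆_{H_irr})_{𝔻(H)}`: the product of the standard symplectic
structures of the `T^*𝔫^{(l)}` and the zero Poisson structure of `𝔻(H)`. -/
noncomputable def deformationPoisson : PoissonStructure (deformation o) :=
  productPoisson (productForm fun l : Finset.Icc 2 k => NilTuple o l) (productForm_injective _)
    (productForm_skew _) H.deformationSpace

/-- The projection `θ : (𝕆_{H_irr})_{𝔻(H)} → 𝔻(H)`. -/
def theta (x : deformation o) : H.deformationSpace := ⟨x.1.2, x.2⟩

/-- The fibre `θ⁻¹(c)`, as a subset of the ambient vector space. -/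
def fibre (c : H.deformationSpace) : Set (DeformationFibre o × (Fin (k + 1) → ℂ)) :=
  (↑) '' (theta o ⁻¹' {c})

theorem mem_fibre (c : H.deformationSpace) (v : DeformationFibre o) :
    (v, (c : Fin (k + 1) → ℂ)) ∈ fibre o c :=
  ⟨⟨(v, c), c.2⟩, rfl, rfl⟩

/-- The symplectic form of the fibres `θ⁻¹(c) = ∏_l T^*𝔫^{(l)} × {c}`, which is the product of the
standard symplectic forms of the cotangent bundles.  (A vector tangent to the fibre has the form
`(u, 0)`.) -/
noncomputable def fibreForm (_c : H.deformationSpace)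
    (_x u v : DeformationFibre o × (Fin (k + 1) → ℂ)) : ℂ :=
  productForm (fun l : Finset.Icc 2 k => NilTuple o l) u.1 v.1

end NilGroupoid

/-! ## The coadjoint orbit of the irregular type -/

section Orbit

variable (n k : ℕ)

/-- Evaluation at `z = 0` on `ℂ[z] / ⟨z^{k+1}⟩`. -/
noncomputable def evalZero : DefRing 0 (k + 1) →+* ℂ :=
  Ideal.Quotient.lift _ (evalRingHom 0) (by
    intro a ha
    obtain ⟨b, rfl⟩ := Ideal.mem_span_singleton.mp ha
    simp [newton])

/-- The group `GL_n(ℂ[z]_k)¹` of the `g ∈ GL_n(ℂ[z] / ⟨z^{k+1}⟩)` with `g(0) = E_n`. -/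
noncomputable def GL1 : Subgroup (Matrix (Fin n) (Fin n) (DefRing 0 (k + 1)))ˣ :=
  (Units.map ((evalZero k).mapMatrix :
    Matrix (Fin n) (Fin n) (DefRing 0 (k + 1)) →+* Mat n).toMonoidHom).ker

/-- The Lie algebra `𝔤𝔩_n(ℂ[z]_k)¹` of `GL_n(ℂ[z]_k)¹`: the tuple `(Y₁, …, Y_k)` stands for
`Y₁ z + ⋯ + Y_k z^k`, see `LieGL1.toMat`. -/
def LieGL1 : Type := Fin k → Mat n

noncomputable instance : NormedAddCommGroup (LieGL1 n k) :=
  inferInstanceAs (NormedAddCommGroup (Fin k → Mat n))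

noncomputable instance : NormedSpace ℂ (LieGL1 n k) :=
  inferInstanceAs (NormedSpace ℂ (Fin k → Mat n))

instance : FiniteDimensional ℂ (LieGL1 n k) :=
  inferInstanceAs (FiniteDimensional ℂ (Fin k → Mat n))

variable {n k}

/-- The matrix `Y₁ z + ⋯ + Y_k z^k` over `ℂ[z] / ⟨z^{k+1}⟩`. -/
noncomputable def LieGL1.toMat : LieGL1 n k →ₗ[ℂ] Matrix (Fin n) (Fin n) (DefRing 0 (k + 1)) where
  toFun Y := newtonMat 0 k Y
  map_add' Y Z := (newtonMat 0 k).map_add Y Z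
  map_smul' a Y := (newtonMat 0 k).map_smul a Y

/-- The coefficients of `z, …, z^k` in a matrix over `ℂ[z] / ⟨z^{k+1}⟩`. -/
noncomputable def LieGL1.ofMat : Matrix (Fin n) (Fin n) (DefRing 0 (k + 1)) →ₗ[ℂ] LieGL1 n k where
  toFun M := newtonCoeff 0 k M
  map_add' Y Z := (newtonCoeff 0 k).map_add Y Z
  map_smul' a Y := (newtonCoeff 0 k).map_smul a Y

/-- The Lie bracket of `𝔤𝔩_n(ℂ[z]_k)¹`. -/
noncomputable def lieGL1 (Y Z : LieGL1 n k) : LieGL1 n k :=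
  LieGL1.ofMat (Y.toMat * Z.toMat - Z.toMat * Y.toMat)

/-- The adjoint action `Y ↦ g Y g⁻¹`. -/
noncomputable def adGL1 (g : GL1 n k) : LieGL1 n k →L[ℂ] LieGL1 n k :=
  LinearMap.toContinuousLinearMap
    { toFun := fun Y => LieGL1.ofMat
        ((g : (Matrix (Fin n) (Fin n) (DefRing 0 (k + 1)))ˣ) * Y.toMat *
          ((g⁻¹ : GL1 n k) : (Matrix (Fin n) (Fin n) (DefRing 0 (k + 1)))ˣ))
      map_add' := fun Y Z => by rw [map_add, mul_add, add_mul, map_add]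
      map_smul' := fun a Y => by
        rw [map_smul, mul_smul_comm, smul_mul_assoc, map_smul, RingHom.id_apply] }

/-- The coadjoint action `(Ad^*(g) ξ)(Y) = ξ(Ad(g⁻¹) Y)`. -/
noncomputable def coadGL1 (g : GL1 n k) (ξ : LieGL1 n k →L[ℂ] ℂ) : LieGL1 n k →L[ℂ] ℂ :=
  ξ.comp (adGL1 g⁻¹)

/-- The coadjoint orbit through `ξ`. -/
def coadjointOrbit (ξ : LieGL1 n k →L[ℂ] ℂ) : Set (LieGL1 n k →L[ℂ] ℂ) :=
  Set.range fun g : GL1 n k => coadGL1 g ξ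

/-- `τ` is the tangent vector `ad^*(Y) η = d/dt Ad^*(exp tY) η` of the orbit through `η`. -/
def IsCoadVector (η : LieGL1 n k →L[ℂ] ℂ) (Y : LieGL1 n k) (τ : LieGL1 n k →L[ℂ] ℂ) : Prop :=
  ∀ Z, τ Z = -η (lieGL1 Y Z)

/-- A map `f` from the orbit `𝕆_ξ = G / G_ξ` to a complex vector space is holomorphic: the map
`g ↦ f(Ad^*(g) ξ)` is holomorphic on `G = GL_n(ℂ[z]_k)¹`, on which the coefficients of
`z, …, z^k` are global coordinates. -/
def HolomorphicOnOrbit {E : Type*} [NormedAddCommGroup E] [NormedSpace ℂ E]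
    (ξ : LieGL1 n k →L[ℂ] ℂ) (f : coadjointOrbit ξ → E) : Prop :=
  ∃ F : LieGL1 n k → E, AnalyticOnNhd ℂ F Set.univ ∧
    ∀ g : GL1 n k, F (LieGL1.ofMat (g : (Matrix (Fin n) (Fin n) (DefRing 0 (k + 1)))ˣ).1) =
      f ⟨coadGL1 g ξ, g, rfl⟩

/-- The irregular type `H_irr` of `H`, the restriction of `H` to `𝔤𝔩_n(ℂ[z]_k)¹` under the
pairing `(A, B dz) ↦ res_{z=0} tr(A B) dz`:
`H_irr(Y₁ z + ⋯ + Y_k z^k) = tr(Y₁ S₁) + ⋯ + tr(Y_k S_k)`. -/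
noncomputable def HTLNormalForm.irregularType (H : HTLNormalForm n k) : LieGL1 n k →L[ℂ] ℂ :=
  LinearMap.toContinuousLinearMap
    { toFun := fun Y => ∑ i : Fin k, (Y i * Matrix.diagonal (H.S i.succ)).trace
      map_add' := fun Y Z => by
        rw [← Finset.sum_add_distrib]
        refine Finset.sum_congr rfl fun i _ => ?_
        rw [← Matrix.trace_add, ← add_mul]; rfl
      map_smul' := fun a Y => by
        rw [Finset.smul_sum]
        refine Finset.sum_congr rfl fun i _ => ?_
        rw [← Matrix.trace_smul, ← smul_mul_assoc]; rfl }

/-- `Φ` is an isomorphism of holomorphic symplectic manifolds from the fibre `θ⁻¹(c)` onto the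
coadjoint orbit through `ξ`: it is biholomorphic, and it pulls back the symplectic form of the
orbit to that of the fibre.  The symplectic form of the orbit is that of the reduction
`G_ξ \ μ_G⁻¹(ξ)` of `T^*G`, for the exterior derivative of the canonical 1-form of `T^*G`:
`(ad^*(Y₁) η, ad^*(Y₂) η) ↦ -η([Y₁, Y₂])`. -/
structure IsSymplecticIso {H : HTLNormalForm n k} (o : BlockOrdering H) (c : H.deformationSpace)
    (ξ : LieGL1 n k →L[ℂ] ℂ) (Φ : fibre o c ≃ coadjointOrbit ξ) : Prop where
  holomorphic : AnalyticOnNhd ℂ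
    (fun v : DeformationFibre o => (Φ ⟨(v, c), mem_fibre o c v⟩ : LieGL1 n k →L[ℂ] ℂ)) Set.univ
  holomorphic_symm : HolomorphicOnOrbit ξ
    fun η => (Φ.symm η : DeformationFibre o × (Fin (k + 1) → ℂ))
  symplectic : ∀ v u₁ u₂ : DeformationFibre o, ∃ Y₁ Y₂ : LieGL1 n k,
    IsCoadVector (Φ ⟨(v, c), mem_fibre o c v⟩ : LieGL1 n k →L[ℂ] ℂ) Y₁
      (fderiv ℂ (fun w : DeformationFibre o =>
        (Φ ⟨(w, c), mem_fibre o c w⟩ : LieGL1 n k →L[ℂ] ℂ)) v u₁) ∧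
    IsCoadVector (Φ ⟨(v, c), mem_fibre o c v⟩ : LieGL1 n k →L[ℂ] ℂ) Y₂
      (fderiv ℂ (fun w : DeformationFibre o =>
        (Φ ⟨(w, c), mem_fibre o c w⟩ : LieGL1 n k →L[ℂ] ℂ)) v u₂) ∧
    fibreForm o c (v, c) (u₁, 0) (u₂, 0) =
      -(Φ ⟨(v, c), mem_fibre o c v⟩ : LieGL1 n k →L[ℂ] ℂ) (lieGL1 Y₁ Y₂)

end Orbit

end Unfolding

namespace Unfolding

/-! ### The symplectic foliation of a symplectic vector space times a parameter space. -/

section ProductFoliation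

variable {V B : Type*} [NormedAddCommGroup V] [NormedSpace ℂ V] [FiniteDimensional ℂ V]
  [NormedAddCommGroup B] [NormedSpace ℂ B]

/-! The foliation half concerns a product `V × D` with constant Poisson tensor of image `V × 0`.
Hamiltonian curves therefore never leave a slice, and a linear function has a constant Hamiltonian
field, whose integral curves are straight lines; these join any two points of a slice
(`isSymplecticFoliation_productPoisson`).

The other half needs global Darboux coordinates on the orbit of `ξ = H_irr`. Let `𝔤_j` be the tuples
in `zM_n(ℂ)[z]/z^{k+1}` that are block diagonal for `𝐦_j`. By induction on `j`, the orbit of `ξ`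
under `1 + 𝔤_{j+1}` is identified with the sum of the `T^*𝔫^{(l)}`, `2 ≤ l ≤ j`. For `j = 1` the
orbit is a point: commutators start in degree 2, where the `S_i` are scalar on each block of `𝐦_2`.

For the step from `𝔤_j` to `𝔤_{j+1}`, note that `ξ([x, y])` couples the entry `(p, r)` of `x` in
degree `a` with the entry `(r, p)` of `y` in degree `b`, with weight `s^{(a+b)}_p - s^{(a+b)}_r`
(`irregularType_lie`). Inside a block of `𝐦_{j+1}` this weight vanishes for `a + b > j`, and for `a
+ b = j` it is nonzero across blocks of `𝐦_j`. So `ξ` pairs `𝔫^{(j)}` with the opposite entries of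
degree less than `j` by a triangular, hence perfect, pairing (`irregularType_graded`). The elements
of `𝔤_{j+1}` without component in `𝔫^{(j)}` form a subalgebra. Its group `Q` contains the stabilizer
of `ξ` (`mem_par_of_stabilizes`), and the `Q`-orbit of `ξ` consists of the orbit under `1 + 𝔤_j`
plus all functionals that live on `𝔫^{(j)}` (`exists_coad_eq_add`, `coad_unip_par`).

Hence the larger orbit fibres over `𝔫^{(j)}`, and `(v, X, P) ↦ Ad^*(1 + X)(Φ(v) + β)` is a global
parametrization, where `β` is the covector `P` at `X` in the left trivialization (`stepMap`). Since
`Φ(v)` vanishes on the strictly triangular part, the symplectic form is the old one plus the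
standard form of `T^*𝔫^{(j)}` (`stepMap_symplectic`). The inverse comes from a factorization `1 + x
= (1 + X)(1 + c)` with `1 + c` in `Q` (`stepMap_stepInv`). All series and iterations stop after
finitely many terms by nilpotency, which gives holomorphy in both directions. The step is
`orbitChart_step`, the induction `exists_orbitChart`. -/

theorem symplecticSharp_surjective (Ω : V →L[ℂ] V →L[ℂ] ℂ) (hΩ : Function.Injective Ω) :
    Function.Surjective (symplecticSharp Ω hΩ) := by
  intro v
  refine ⟨-Ω v, hΩ ?_⟩
  ext w
  rw [symplecticSharp_spec]
  simp

theorem productPoisson_sharp (Ω : V →L[ℂ] V →L[ℂ] ℂ) (hΩ : Function.Injective Ω)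
    (hskew : ∀ u v, Ω u v = -Ω v u) (D : TopologicalSpace.Opens B) (x : V × B)
    (α : V × B →L[ℂ] ℂ) :
    (productPoisson Ω hΩ hskew D).sharp x α =
      (symplecticSharp Ω hΩ (α.comp (ContinuousLinearMap.inl ℂ V B)), 0) :=
  rfl

theorem productPoisson_range_sharp (Ω : V →L[ℂ] V →L[ℂ] ℂ) (hΩ : Function.Injective Ω)
    (hskew : ∀ u v, Ω u v = -Ω v u) (D : TopologicalSpace.Opens B) (x : V × B) :
    ((productPoisson Ω hΩ hskew D).sharp x).range =
      LinearMap.range (LinearMap.inl ℂ V B) := by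
  ext ⟨v, b⟩
  constructor
  · rintro ⟨α, hα⟩
    exact ⟨symplecticSharp Ω hΩ (α.comp (ContinuousLinearMap.inl ℂ V B)), hα⟩
  · rintro ⟨w, hw⟩
    obtain ⟨α, rfl⟩ := symplecticSharp_surjective Ω hΩ w
    refine ⟨α.comp (ContinuousLinearMap.fst ℂ V B), ?_⟩
    rw [← hw]
    refine (productPoisson_sharp Ω hΩ hskew D x _).trans ?_
    rw [ContinuousLinearMap.comp_assoc, ContinuousLinearMap.fst_comp_inl]
    rfl

/-- Hamiltonian velocities have no component along `B`, so the parameter has zero derivative along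
every integral curve. -/
theorem productPoisson_hamiltonianStep_snd (Ω : V →L[ℂ] V →L[ℂ] ℂ) (hΩ : Function.Injective Ω)
    (hskew : ∀ u v, Ω u v = -Ω v u) (D : TopologicalSpace.Opens B) {x y : V × B}
    (h : (productPoisson Ω hΩ hskew D).HamiltonianStep x y) : y.2 = x.2 := by
  obtain ⟨W, f, γ, _, _, _, h0, h1, hγ⟩ := h
  have hd : ∀ t ∈ Set.Icc (0 : ℝ) 1,
      HasDerivWithinAt (fun t => (γ t).2) (0 : B) (Set.Icc 0 1) t := fun t ht => by
    have := ((ContinuousLinearMap.snd ℝ V B).hasFDerivAt).comp_hasDerivWithinAt t (hγ t ht).2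
    rwa [productPoisson_sharp] at this
  have := constant_of_has_deriv_right_zero (f := fun t => (γ t).2) (a := 0) (b := 1)
    (fun t ht => (hd t ht).continuousWithinAt)
    (fun t ht => (hd t (Set.Ico_subset_Icc_self ht)).mono_of_mem_nhdsWithin
      (Icc_mem_nhdsGE_of_mem ht)) 1 (by simp)
  simp only [h0, h1] at this
  exact this

theorem productPoisson_leaf (Ω : V →L[ℂ] V →L[ℂ] ℂ) (hΩ : Function.Injective Ω)
    (hskew : ∀ u v, Ω u v = -Ω v u) (D : TopologicalSpace.Opens B) (x : V × B) (hx : x.2 ∈ D) :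
    (productPoisson Ω hΩ hskew D).leaf x = {y | y.2 = x.2} := by
  ext y
  constructor
  · intro h
    induction h with
    | refl => rfl
    | tail _ h ih => exact (productPoisson_hamiltonianStep_snd Ω hΩ hskew D h).trans ih
  · intro (h : y.2 = x.2)
    -- The vector `y - x` is vertical, so it is the constant Hamiltonian field of some linear
    -- function `α`. The segment from `x` to `y` is an integral curve and stays over `x.2`.
    obtain ⟨α, hα⟩ : (y - x) ∈ ((productPoisson Ω hΩ hskew D).sharp x).range := by
      rw [productPoisson_range_sharp]
      exact ⟨y.1 - x.1, Prod.ext rfl (sub_eq_zero.mpr h).symm⟩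
    refine Relation.ReflTransGen.single ⟨openProd V D, α, fun t => x + t • (y - x),
      (openProd V D).isOpen, subset_rfl, fun z _ => α.analyticAt z, by simp, by simp,
      fun t _ => ⟨?_, ?_⟩⟩
    · change x.2 + t • (y.2 - x.2) ∈ D
      rw [h, sub_self, smul_zero, add_zero]
      exact hx
    · rw [α.fderiv]
      have : HasDerivAt (fun t : ℝ => x + t • (y - x)) ((1 : ℝ) • (y - x)) t :=
        ((hasDerivAt_id t).smul_const (y - x)).const_add x
      rw [one_smul] at this
      change HasDerivWithinAt _ ((productPoisson Ω hΩ hskew D).sharp x α) _ t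
      have hα' : (productPoisson Ω hΩ hskew D).sharp x α = y - x := hα
      rw [hα']
      exact this.hasDerivWithinAt

/-- One translation, moving `b` to `0`, straightens the whole slice; its derivative is the identity,
so tangent spaces need no correction. -/
theorem isComplexSubmanifold_fibre {V B : Type*} [NormedAddCommGroup V] [NormedSpace ℂ V]
    [NormedAddCommGroup B] [NormedSpace ℂ B] (b : B) {T : V × B → Submodule ℂ (V × B)}
    (hT : ∀ x, T x = LinearMap.range (LinearMap.inl ℂ V B)) :
    IsComplexSubmanifold {y : V × B | y.2 = b} T := by
  intro x hx
  refine ⟨(Homeomorph.addRight (-(0, b) : V × B)).toOpenPartialHomeomorph,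
    LinearMap.range (LinearMap.inl ℂ V B), trivial, fun y _ => ?_, fun y _ => ?_,
    fun y _ => ?_, fun y _ _ => ?_⟩
  · exact analyticAt_id.add analyticAt_const
  · exact analyticAt_id.add analyticAt_const
  · constructor
    · intro h
      exact ⟨y.1, Prod.ext (by simp) (by simpa using (add_neg_eq_zero.mpr h).symm)⟩
    · rintro ⟨v, hv⟩
      have := congrArg Prod.snd hv
      simp only [Homeomorph.toOpenPartialHomeomorph_apply, Homeomorph.coe_addRight] at this
      exact (add_neg_eq_zero (b := b)).mp (by simpa using this.symm)
  · have h : fderiv ℂ (fun z : V × B => z + -(0, b)) y = ContinuousLinearMap.id ℂ _ := by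
      rw [fderiv_add_const]
      exact fderiv_id
    rw [hT]
    change _ = Submodule.comap (fderiv ℂ (fun z : V × B => z + -(0, b)) y : V × B →ₗ[ℂ] V × B) _
    rw [h]
    rfl

theorem isSymplecticFoliation_productPoisson (Ω : V →L[ℂ] V →L[ℂ] ℂ) (hΩ : Function.Injective Ω)
    (hskew : ∀ u v, Ω u v = -Ω v u) (D : TopologicalSpace.Opens B) :
    IsSymplecticFoliation (productPoisson Ω hΩ hskew D)
      (fun c : D => {y : V × B | y.2 = c}) (fun _ _ u v => Ω u.1 v.1) where
  nonempty c := ⟨(0, c), rfl⟩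
  cover := by
    ext x
    simp only [Set.mem_iUnion]
    exact ⟨fun ⟨c, hc⟩ => by
      have : x.2 = c := hc
      change x.2 ∈ D
      rw [this]
      exact c.2, fun hx => ⟨⟨x.2, hx⟩, rfl⟩⟩
  injective c d h := by
    have : ((0 : V), (c : B)) ∈ {y : V × B | y.2 = d} := by
      rw [← show {y : V × B | y.2 = c} = {y : V × B | y.2 = d} from h]
      rfl
    exact Subtype.ext this
  leaf c x hx := by
    have hx' : x.2 = c := hx
    rw [productPoisson_leaf Ω hΩ hskew D x (hx' ▸ c.2), hx']
  submanifold c := isComplexSubmanifold_fibre _ (productPoisson_range_sharp Ω hΩ hskew D)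
  form c x hx α β := by
    -- The defining property of the sharp map yields `-α(π^♯ β)`; skewness identifies this with
    -- `β(π^♯ α)`.
    have h1 := symplecticSharp_spec Ω hΩ (α.comp (ContinuousLinearMap.inl ℂ V B))
      ((productPoisson Ω hΩ hskew D).sharp x β).1
    have h2 := (productPoisson Ω hΩ hskew D).skew x (by
      change x.2 ∈ D
      rw [show x.2 = c from hx]
      exact c.2) α β
    rw [h2]
    exact h1

end ProductFoliation

theorem fibre_eq {n k : ℕ} {H : HTLNormalForm n k} (o : BlockOrdering H)
    (c : H.deformationSpace) : fibre o c = {y | y.2 = (c : Fin (k + 1) → ℂ)} := by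
  ext y
  constructor
  · rintro ⟨x, hx, rfl⟩
    exact congrArg Subtype.val hx
  · intro (h : y.2 = (c : Fin (k + 1) → ℂ))
    refine ⟨⟨y, ?_⟩, Subtype.ext h, rfl⟩
    change y.2 ∈ H.deformationSpace
    rw [h]
    exact c.2

theorem isSymplecticFoliation_fibre {n k : ℕ} {H : HTLNormalForm n k} (o : BlockOrdering H) :
    IsSymplecticFoliation (deformationPoisson o) (fibre o) (fibreForm o) := by
  have h := isSymplecticFoliation_productPoisson
    (productForm fun l : Finset.Icc 2 k => NilTuple o l) (productForm_injective _)
    (productForm_skew _) H.deformationSpace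
  have e : fibre o = fun c : H.deformationSpace => {y | y.2 = (c : Fin (k + 1) → ℂ)} :=
    _root_.funext (fibre_eq o)
  rw [e]
  exact h

/-! ## Nilpotent ideals and coadjoint actions of their unipotent groups -/

/-- On a finite-dimensional space an operator is a fixed linear expression in its values on a basis.
Analyticity of functional-valued maps can thus be tested vector by vector. -/
theorem analyticAt_clm_of_apply {E N W : Type*} [NormedAddCommGroup E] [NormedSpace ℂ E]
    [NormedAddCommGroup N] [NormedSpace ℂ N] [FiniteDimensional ℂ N] [NormedAddCommGroup W]
    [NormedSpace ℂ W] {f : E → N →L[ℂ] W} {v : E} (h : ∀ Y, AnalyticAt ℂ (fun w => f w Y) v) :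
    AnalyticAt ℂ f v := by
  let b := Module.finBasis ℂ N
  have key : f = fun w => ∑ i,
      ContinuousLinearMap.smulRightL ℂ N W (LinearMap.toContinuousLinearMap (b.coord i))
        (f w (b i)) := by
    funext w
    ext Y
    have h := congrArg (f w) (b.sum_repr Y)
    rw [map_sum] at h
    rw [← h]
    simp
  rw [key]
  exact Finset.analyticAt_fun_sum _ fun i _ =>
    ((ContinuousLinearMap.smulRightL ℂ N W _).analyticAt _).fun_comp (h (b i))

theorem analyticAt_clm_apply {E N W : Type*} [NormedAddCommGroup E] [NormedSpace ℂ E]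
    [NormedAddCommGroup N] [NormedSpace ℂ N] [NormedAddCommGroup W]
    [NormedSpace ℂ W] {f : E → N →L[ℂ] W} {g : E → N} {v : E} (hf : AnalyticAt ℂ f v)
    (hg : AnalyticAt ℂ g v) : AnalyticAt ℂ (fun w => f w (g w)) v :=
  ((ContinuousLinearMap.id ℂ (N →L[ℂ] W)).analyticAt_bilinear (f v, g v)).comp₂ hf hg

/-- A nilpotent two-sided ideal of an algebra `A`, embedded by `e : N → A`, with a retraction `r`
and a decreasing multiplicative filtration. -/
structure NilIdeal (A N : Type*) [Ring A] [Algebra ℂ A] [NormedAddCommGroup N]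
    [NormedSpace ℂ N] where
  e : N →ₗ[ℂ] A
  r : A →ₗ[ℂ] N
  r_e : ∀ x, r (e x) = x
  e_r_mul : ∀ a x, e (r (a * e x)) = a * e x
  e_r_mul' : ∀ a x, e (r (e x * a)) = e x * a
  fil : ℕ → Submodule ℂ N
  len : ℕ
  fil_one : fil 1 = ⊤
  fil_len : fil len = ⊥
  fil_anti : Antitone fil
  fil_mul : ∀ {i j x y}, x ∈ fil i → y ∈ fil j → r (e x * e y) ∈ fil (i + j)

namespace NilIdeal

variable {A N : Type*} [Ring A] [Algebra ℂ A] [NormedAddCommGroup N] [NormedSpace ℂ N]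
  [FiniteDimensional ℂ N] (C : NilIdeal A N)

omit [FiniteDimensional ℂ N] in
theorem e_injective : Function.Injective C.e :=
  Function.LeftInverse.injective C.r_e

/-- The multiplication of the ideal. -/
noncomputable def mul : N →L[ℂ] N →L[ℂ] N :=
  LinearMap.toContinuousBilinearMap
    (LinearMap.mk₂ ℂ (fun x y => C.r (C.e x * C.e y))
      (fun x y z => by simp [add_mul]) (fun a x y => by simp)
      (fun x y z => by simp [mul_add]) (fun a x y => by simp))

theorem mul_apply (x y : N) : C.mul x y = C.r (C.e x * C.e y) := rfl

theorem e_mul (x y : N) : C.e (C.mul x y) = C.e x * C.e y := C.e_r_mul _ _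

theorem mul_mem_fil {i j : ℕ} {x y : N} (hx : x ∈ C.fil i) (hy : y ∈ C.fil j) :
    C.mul x y ∈ C.fil (i + j) := C.fil_mul hx hy

omit [FiniteDimensional ℂ N] in
theorem mem_fil_one (x : N) : x ∈ C.fil 1 := by rw [C.fil_one]; trivial

theorem mul_mem_fil_succ_right {i : ℕ} {y : N} (x : N) (hy : y ∈ C.fil i) :
    C.mul x y ∈ C.fil (i + 1) := add_comm 1 i ▸ C.mul_mem_fil (C.mem_fil_one x) hy

theorem mul_mem_fil_succ_left {i : ℕ} {x : N} (hx : x ∈ C.fil i) (y : N) :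
    C.mul x y ∈ C.fil (i + 1) := C.mul_mem_fil hx (C.mem_fil_one y)

/-- The commutator. -/
noncomputable def lie (x y : N) : N := C.mul x y - C.mul y x

theorem e_lie (x y : N) : C.e (C.lie x y) = C.e x * C.e y - C.e y * C.e x := by
  rw [lie, map_sub, e_mul, e_mul]

/-- The powers `x ^ (i + 1)`. -/
noncomputable def powSucc (x : N) : ℕ → N
  | 0 => x
  | i + 1 => C.mul (powSucc x i) x

theorem e_powSucc (x : N) (i : ℕ) : C.e (C.powSucc x i) = C.e x ^ (i + 1) := by
  induction i with
  | zero => simp [powSucc]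
  | succ i ih => rw [powSucc, e_mul, ih, ← pow_succ]

theorem powSucc_mem_fil (x : N) (i : ℕ) : C.powSucc x i ∈ C.fil (i + 1) := by
  induction i with
  | zero => exact C.mem_fil_one x
  | succ i ih => exact C.mul_mem_fil_succ_left ih x

/-- The quasi-inverse: `(1 + x)⁻¹ = 1 + quasi x`. -/
noncomputable def quasi (x : N) : N := ∑ i ∈ Finset.range C.len, C.powSucc (-x) i

theorem e_quasi (x : N) :
    1 + C.e (C.quasi x) = ∑ i ∈ Finset.range (C.len + 1), (-C.e x) ^ i := by
  rw [Finset.sum_range_succ', pow_zero, add_comm, quasi, map_sum]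
  simp only [e_powSucc, map_neg]

theorem neg_e_pow (x : N) : (-C.e x) ^ (C.len + 1) = 0 := by
  have h := C.fil_anti (Nat.le_succ C.len) (C.powSucc_mem_fil (-x) C.len)
  rw [C.fil_len, Submodule.mem_bot] at h
  rw [← map_neg, ← e_powSucc, h, map_zero]

/-- The unit `1 + x`. -/
noncomputable def unip (x : N) : Aˣ where
  val := 1 + C.e x
  inv := 1 + C.e (C.quasi x)
  val_inv := by
    have h := mul_neg_geom_sum (-C.e x) (C.len + 1)
    rwa [neg_e_pow, sub_neg_eq_add, sub_zero, ← e_quasi] at h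
  inv_val := by
    have h := geom_sum_mul_neg (-C.e x) (C.len + 1)
    rwa [neg_e_pow, sub_neg_eq_add, sub_zero, ← e_quasi] at h

theorem unip_val (x : N) : (C.unip x : A) = 1 + C.e x := rfl

theorem unip_inv_val (x : N) : ((C.unip x)⁻¹ : Aˣ).val = 1 + C.e (C.quasi x) := rfl

theorem unip_injective : Function.Injective C.unip := fun _ _ h =>
  C.e_injective (add_left_cancel (congrArg Units.val h))

theorem unip_inv (x : N) : (C.unip x)⁻¹ = C.unip (C.quasi x) := Units.ext rfl

theorem unip_mul (x y : N) : C.unip x * C.unip y = C.unip (x + y + C.mul x y) := by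
  ext
  simp only [Units.val_mul, unip_val, map_add, e_mul]
  noncomm_ring

theorem unip_zero : C.unip 0 = 1 := by
  ext
  simp [unip_val]

/-- The adjoint action. -/
noncomputable def Ad (g : Aˣ) : N →L[ℂ] N :=
  LinearMap.toContinuousLinearMap
    { toFun := fun Y => C.r (g * C.e Y * (g⁻¹ : Aˣ))
      map_add' := fun x y => by rw [map_add, mul_add, add_mul, map_add]
      map_smul' := fun a x => by
        rw [map_smul, mul_smul_comm, smul_mul_assoc, map_smul, RingHom.id_apply] }

theorem e_Ad (g : Aˣ) (Y : N) : C.e (C.Ad g Y) = g * C.e Y * (g⁻¹ : Aˣ) := by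
  change C.e (C.r (g * C.e Y * (g⁻¹ : Aˣ))) = _
  rw [← C.e_r_mul g Y, C.e_r_mul']

theorem Ad_one (Y : N) : C.Ad 1 Y = Y := C.e_injective (by simp [e_Ad])

theorem Ad_mul (g h : Aˣ) (Y : N) : C.Ad (g * h) Y = C.Ad g (C.Ad h Y) :=
  C.e_injective (by simp [e_Ad, mul_assoc])

theorem Ad_inv_Ad (g : Aˣ) (Y : N) : C.Ad g⁻¹ (C.Ad g Y) = Y := by
  rw [← Ad_mul, inv_mul_cancel, Ad_one]

theorem Ad_map_mul (g : Aˣ) (x y : N) : C.Ad g (C.mul x y) = C.mul (C.Ad g x) (C.Ad g y) :=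
  C.e_injective (by simp [e_Ad, e_mul, mul_assoc])

theorem Ad_lie (g : Aˣ) (x y : N) : C.Ad g (C.lie x y) = C.lie (C.Ad g x) (C.Ad g y) := by
  rw [lie, map_sub, Ad_map_mul, Ad_map_mul, lie]

theorem Ad_unip (x Y : N) : C.Ad (C.unip x) Y =
    Y + C.mul x Y + C.mul Y (C.quasi x) + C.mul (C.mul x Y) (C.quasi x) := by
  apply C.e_injective
  simp only [e_Ad, unip_val, unip_inv_val, map_add, e_mul]
  noncomm_ring

theorem quasi_quasi (x : N) : C.quasi (C.quasi x) = x := by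
  apply C.unip_injective
  rw [← unip_inv, ← unip_inv, inv_inv]

/-- The product `(1 + x) Y`. -/
noncomputable def lmul (x Y : N) : N := Y + C.mul x Y

theorem e_lmul (x Y : N) : C.e (C.lmul x Y) = C.unip x * C.e Y := by
  rw [lmul, map_add, e_mul, unip_val]; noncomm_ring

theorem lmul_lmul_quasi (x Y : N) : C.lmul x (C.lmul (C.quasi x) Y) = Y :=
  C.e_injective (by rw [e_lmul, e_lmul, ← unip_inv, Units.mul_inv_cancel_left])

theorem lmul_quasi_lmul (x Y : N) : C.lmul (C.quasi x) (C.lmul x Y) = Y :=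
  C.e_injective (by rw [e_lmul, e_lmul, ← unip_inv, Units.inv_mul_cancel_left])

/-- Expand `(1 + x)⁻¹(Y(1 + x) - (1 + x)Y)` and use that `x` commutes with `(1 + x)⁻¹`. The finite
coadjoint action of `1 + x` thus becomes a single commutator with `x`, with no exponential series;
in particular `1 + x` fixes `f` exactly when `f` kills all commutators with `x`. -/
theorem Ad_unip_inv_sub (x Y : N) :
    C.Ad (C.unip x)⁻¹ Y - Y = C.lie (C.lmul (C.quasi x) Y) x := by
  apply C.e_injective
  have h : C.e x = C.unip x - 1 := by rw [unip_val, add_sub_cancel_left]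
  rw [map_sub, e_Ad, e_lie, e_lmul, ← unip_inv, h, inv_inv]
  simp only [mul_sub, sub_mul, mul_one, one_mul, Units.mul_inv_cancel_left]
  abel

/-- The coadjoint action. -/
noncomputable def coad (g : Aˣ) (f : N →L[ℂ] ℂ) : N →L[ℂ] ℂ := f.comp (C.Ad g⁻¹)

theorem coad_apply (g : Aˣ) (f : N →L[ℂ] ℂ) (Y : N) : C.coad g f Y = f (C.Ad g⁻¹ Y) := rfl

theorem coad_one (f : N →L[ℂ] ℂ) : C.coad 1 f = f := by
  ext Y; rw [coad_apply, inv_one, Ad_one]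

theorem coad_mul (g h : Aˣ) (f : N →L[ℂ] ℂ) : C.coad (g * h) f = C.coad g (C.coad h f) := by
  ext Y; simp only [coad_apply, mul_inv_rev, Ad_mul]

theorem coad_add (g : Aˣ) (f f' : N →L[ℂ] ℂ) : C.coad g (f + f') = C.coad g f + C.coad g f' := rfl

theorem coad_inv_coad (g : Aˣ) (f : N →L[ℂ] ℂ) : C.coad g⁻¹ (C.coad g f) = f := by
  rw [← coad_mul, inv_mul_cancel, coad_one]

theorem coad_coad_inv (g : Aˣ) (f : N →L[ℂ] ℂ) : C.coad g (C.coad g⁻¹ f) = f := by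
  rw [← coad_mul, mul_inv_cancel, coad_one]

theorem coad_injective (g : Aˣ) : Function.Injective (C.coad g) :=
  Function.LeftInverse.injective (C.coad_inv_coad g)

theorem coad_unip_apply (x Y : N) (f : N →L[ℂ] ℂ) :
    C.coad (C.unip x) f Y = f Y + f (C.lie (C.lmul (C.quasi x) Y) x) := by
  rw [coad_apply, ← Ad_unip_inv_sub, map_sub, add_sub_cancel]

/-- `τ = ad^*(Y) f`. -/
def IsAdStar (f : N →L[ℂ] ℂ) (Y : N) (τ : N →L[ℂ] ℂ) : Prop := ∀ Z, τ Z = -f (C.lie Y Z)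

/-- Equivariance: an infinitesimal equation solved at `f` is transported to any other point of the
orbit. -/
theorem IsAdStar.coad {C : NilIdeal A N} {f τ : N →L[ℂ] ℂ} {Y : N} (h : C.IsAdStar f Y τ)
    (g : Aˣ) : C.IsAdStar (C.coad g f) (C.Ad g Y) (C.coad g τ) := fun Z => by
  rw [coad_apply, coad_apply, Ad_lie, Ad_inv_Ad, h]

/-! ### Stability of subspaces -/

/-- `S T ⊆ R`. -/
def MulLE (S T R : Submodule ℂ N) : Prop := ∀ x ∈ S, ∀ y ∈ T, C.mul x y ∈ R

variable {C}

theorem powSucc_mem {S : Submodule ℂ N} (hS : C.MulLE S S S) {x : N} (hx : x ∈ S) (i : ℕ) :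
    C.powSucc x i ∈ S := by
  induction i with
  | zero => exact hx
  | succ i ih => exact hS _ ih _ hx

theorem quasi_mem {S : Submodule ℂ N} (hS : C.MulLE S S S) {x : N} (hx : x ∈ S) :
    C.quasi x ∈ S :=
  Submodule.sum_mem _ fun i _ => powSucc_mem hS (S.neg_mem hx) i

theorem lmul_mem {S T : Submodule ℂ N} (hST : C.MulLE S T T) {x Y : N} (hx : x ∈ S) (hY : Y ∈ T) :
    C.lmul x Y ∈ T := T.add_mem hY (hST _ hx _ hY)

theorem Ad_unip_mem {S T : Submodule ℂ N} (hS : C.MulLE S S S) (hST : C.MulLE S T T)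
    (hTS : C.MulLE T S T) {x Y : N} (hx : x ∈ S) (hY : Y ∈ T) : C.Ad (C.unip x) Y ∈ T := by
  rw [Ad_unip]
  exact T.add_mem (T.add_mem (T.add_mem hY (hST _ hx _ hY)) (hTS _ hY _ (quasi_mem hS hx)))
    (hTS _ (hST _ hx _ hY) _ (quasi_mem hS hx))

/-- The group `1 + S`. -/
noncomputable def grp (S : Submodule ℂ N) (hS : C.MulLE S S S) : Subgroup Aˣ where
  carrier := {g | ∃ x ∈ S, C.unip x = g}
  one_mem' := ⟨0, S.zero_mem, C.unip_zero⟩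
  mul_mem' := by
    rintro _ _ ⟨x, hx, rfl⟩ ⟨y, hy, rfl⟩
    exact ⟨_, S.add_mem (S.add_mem hx hy) (hS x hx y hy), (C.unip_mul x y).symm⟩
  inv_mem' := by
    rintro _ ⟨x, hx, rfl⟩
    exact ⟨_, quasi_mem hS hx, (C.unip_inv x).symm⟩

theorem unip_mem_grp {S : Submodule ℂ N} (hS : C.MulLE S S S) {x : N} (hx : x ∈ S) :
    C.unip x ∈ grp S hS := ⟨x, hx, rfl⟩

theorem grp_mono {S T : Submodule ℂ N} (hS : C.MulLE S S S) (hT : C.MulLE T T T) (h : S ≤ T) :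
    grp S hS ≤ grp T hT := by
  rintro _ ⟨x, hx, rfl⟩
  exact ⟨x, h hx, rfl⟩

theorem Ad_mem_of_mem_grp {S T : Submodule ℂ N} (hS : C.MulLE S S S) (hST : C.MulLE S T T)
    (hTS : C.MulLE T S T) {g : Aˣ} (hg : g ∈ grp S hS) {Y : N} (hY : Y ∈ T) : C.Ad g Y ∈ T := by
  obtain ⟨x, hx, rfl⟩ := hg
  exact Ad_unip_mem hS hST hTS hx hY

variable (C)

/-! ### Analyticity -/

variable {E : Type*} [NormedAddCommGroup E] [NormedSpace ℂ E]

theorem analyticAt_mul {f g : E → N} {v : E} (hf : AnalyticAt ℂ f v) (hg : AnalyticAt ℂ g v) :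
    AnalyticAt ℂ (fun w => C.mul (f w) (g w)) v :=
  (C.mul.analyticAt_bilinear (f v, g v)).comp₂ hf hg

theorem analyticAt_quasi {f : E → N} {v : E} (hf : AnalyticAt ℂ f v) :
    AnalyticAt ℂ (fun w => C.quasi (f w)) v := by
  unfold quasi
  refine Finset.analyticAt_fun_sum _ fun i _ => ?_
  clear * - hf
  induction i with
  | zero => exact hf.neg
  | succ i ih => exact C.analyticAt_mul ih hf.neg

/-- The quasi-inverse is a finite sum of powers, so the adjoint action of `(1 + a)⁻¹` is polynomial
in `a`. -/
theorem analyticAt_coad {f : E → N →L[ℂ] ℂ} {a : E → N} {v : E} (hf : AnalyticAt ℂ f v)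
    (ha : AnalyticAt ℂ a v) : AnalyticAt ℂ (fun w => C.coad (C.unip (a w)) (f w)) v := by
  refine analyticAt_clm_of_apply fun Y => ?_
  simp only [coad_apply, unip_inv, Ad_unip, quasi_quasi]
  have hq := C.analyticAt_quasi ha
  have hY : AnalyticAt ℂ (fun _ : E => Y) v := analyticAt_const
  exact analyticAt_clm_apply hf (((hY.add (C.analyticAt_mul hq hY)).add
    (C.analyticAt_mul hY ha)).add (C.analyticAt_mul (C.analyticAt_mul hq hY) ha))

/-! ### Factorizations -/

/-- The iteration `z ↦ x - π(z)(z - π(z))`, whose limit solves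
`(1 + π(z))(1 + z - π(z)) = 1 + x`. -/
noncomputable def factorIter (π : N →L[ℂ] N) (x : N) : ℕ → N
  | 0 => 0
  | i + 1 => x - C.mul (π (factorIter π x i)) (factorIter π x i - π (factorIter π x i))

/-- The solution `z` of `(1 + π(z))(1 + z - π(z)) = 1 + x`. -/
noncomputable def factor (π : N →L[ℂ] N) (x : N) : N := C.factorIter π x C.len

/-- The correction term is quadratic, so an error in `fil (i + 1)` is multiplied by an element of
`fil 1`: every round gains one degree. -/
theorem factorIter_succ_sub_mem {π : N →L[ℂ] N} (hπ : ∀ i, ∀ z ∈ C.fil i, π z ∈ C.fil i) (x : N)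
    (i : ℕ) : C.factorIter π x (i + 1) - C.factorIter π x i ∈ C.fil (i + 1) := by
  induction i with
  | zero => exact C.mem_fil_one _
  | succ i ih =>
    rw [factorIter, factorIter]
    set z := C.factorIter π x i
    set z' := x - C.mul (π z) (z - π z) with hz'
    have hz : z' - z ∈ C.fil (i + 1) := ih
    have h : x - C.mul (π z') (z' - π z') - z' =
        -(C.mul (π (z' - z)) (z' - π z') + C.mul (π z) ((z' - z) - π (z' - z))) := by
      clear_value z'
      rw [eq_add_of_sub_eq hz'.symm]
      simp only [map_sub, sub_apply]
      abel
    rw [h]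
    exact Submodule.neg_mem _ (Submodule.add_mem _ (C.mul_mem_fil_succ_left (hπ _ _ hz) _)
      (C.mul_mem_fil_succ_right _ (Submodule.sub_mem _ hz (hπ _ _ hz))))

/-- After `len` rounds the error lies in a zero filtration step, so the iterate is a fixed point.
The fixed-point equation is the desired factorization with its product expanded. -/
theorem unip_factor {π : N →L[ℂ] N} (hπ : ∀ i, ∀ z ∈ C.fil i, π z ∈ C.fil i) (x : N) :
    C.unip (π (C.factor π x)) * C.unip (C.factor π x - π (C.factor π x)) = C.unip x := by
  have h := C.fil_anti (Nat.le_succ C.len) (C.factorIter_succ_sub_mem hπ x C.len)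
  rw [C.fil_len, Submodule.mem_bot, sub_eq_zero, factorIter] at h
  change x - C.mul (π (C.factor π x)) (C.factor π x - π (C.factor π x)) = C.factor π x at h
  rw [unip_mul]
  congr 1
  rw [add_sub_cancel, ← eq_sub_iff_add_eq]
  exact h.symm

theorem factor_mem {S : Submodule ℂ N} (hS : C.MulLE S S S) {π : N →L[ℂ] N}
    (hπ : ∀ z ∈ S, π z ∈ S) {x : N} (hx : x ∈ S) : C.factor π x ∈ S := by
  have h : ∀ i, C.factorIter π x i ∈ S := by
    intro i
    induction i with
    | zero => exact S.zero_mem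
    | succ i ih => exact S.sub_mem hx (hS _ (hπ _ ih) _ (S.sub_mem ih (hπ _ ih)))
  exact h _

theorem analyticAt_factor (π : N →L[ℂ] N) (x : N) : AnalyticAt ℂ (C.factor π) x := by
  have h : ∀ i, AnalyticAt ℂ (fun x => C.factorIter π x i) x := by
    intro i
    induction i with
    | zero => exact analyticAt_const
    | succ i ih =>
      have h := (π.analyticAt _).fun_comp ih
      exact analyticAt_id.sub (C.analyticAt_mul h (ih.sub h))
  exact h _

end NilIdeal

/-! ## Polarizations and the extension of charts of coadjoint orbits -/

namespace NilIdeal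

variable {A N : Type*} [Ring A] [Algebra ℂ A] [NormedAddCommGroup N] [NormedSpace ℂ N]
  [FiniteDimensional ℂ N]

theorem lmul_sub_right (C : NilIdeal A N) (x Y Z : N) :
    C.lmul x (Y - Z) = C.lmul x Y - C.lmul x Z := by
  simp only [lmul, map_sub]; abel

theorem lie_add_left (C : NilIdeal A N) (x y z : N) :
    C.lie (x + y) z = C.lie x z + C.lie y z := by
  simp only [lie, map_add, add_apply]; abel

theorem lie_add_right (C : NilIdeal A N) (x y z : N) :
    C.lie x (y + z) = C.lie x y + C.lie x z := by
  simp only [lie, map_add, add_apply]; abel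

theorem lie_skew (C : NilIdeal A N) (x y : N) : C.lie x y = -C.lie y x := by
  simp only [lie, neg_sub]

/-- The functional `ad^*(Y) f`. -/
noncomputable def adStar (C : NilIdeal A N) (f : N →L[ℂ] ℂ) (Y : N) : N →L[ℂ] ℂ :=
  f.comp (C.mul.flip Y - C.mul Y)

theorem adStar_apply (C : NilIdeal A N) (f : N →L[ℂ] ℂ) (Y Z : N) :
    C.adStar f Y Z = -f (C.lie Y Z) := by
  rw [← map_neg, lie, neg_sub]
  rfl

/-- The data for one step of the construction of Darboux coordinates on the coadjoint orbit
through `ξ`: subalgebras `l ⊆ g` of the ideal, a complement `ker p` of the image of `ι : W → g` that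
is polarizing for `ξ` modulo `l`, and the nilradical `rad` of `g ⊓ ker p`. -/
structure Polarization (C : NilIdeal A N) (ξ : N →L[ℂ] ℂ) (W : Type*) [NormedAddCommGroup W]
    [NormedSpace ℂ W] where
  g : Submodule ℂ N
  l : Submodule ℂ N
  rad : Submodule ℂ N
  neg : Submodule ℂ N
  ι : W →L[ℂ] N
  p : N →L[ℂ] W
  lev : N →L[ℂ] N
  p_ι : ∀ w, p (ι w) = w
  g_mul : C.MulLE g g g
  l_mul : C.MulLE l l l
  l_le_g : l ≤ g
  p_l : ∀ x ∈ l, p x = 0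
  rad_le_g : rad ≤ g
  p_rad : ∀ x ∈ rad, p x = 0
  mul_ker : ∀ x ∈ g, p x = 0 → ∀ y, p y = 0 → p (C.mul x y) = 0
  ker_mul : ∀ x ∈ g, p x = 0 → ∀ y, p y = 0 → p (C.mul y x) = 0
  mul_rad : ∀ x ∈ g, p x = 0 → ∀ y ∈ rad, C.mul x y ∈ rad
  rad_mul : ∀ x ∈ g, p x = 0 → ∀ y ∈ rad, C.mul y x ∈ rad
  lev_mem : ∀ x ∈ g, p x = 0 → lev x ∈ l
  sub_lev_mem : ∀ x ∈ g, p x = 0 → x - lev x ∈ rad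
  neg_mul : C.MulLE neg neg neg
  neg_le_g : neg ≤ g
  ι_mem : ∀ w, ι w ∈ neg
  l_mul_neg : C.MulLE l neg neg
  neg_mul_l : C.MulLE neg l neg
  p_neg_mul : ∀ x ∈ neg, ∀ y ∈ neg, p y = 0 → p (C.mul x y) = 0
  p_fil : ∀ i, ∀ z ∈ C.fil i, ι (p z) ∈ C.fil i
  ξ_neg : ∀ x ∈ neg, ξ x = 0
  ξ_lie : ∀ Y, p Y = 0 → ∀ x ∈ rad, ξ (C.lie Y x) = 0
  graded : ∀ m, 1 ≤ m → ∀ γ : N →L[ℂ] ℂ, (∀ Y, p Y = 0 → γ Y = 0) →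
    (∀ Y ∈ C.fil (m + 1), γ Y = 0) → ∃ x ∈ rad, ∀ Y ∈ C.fil m, -ξ (C.lie x Y) = γ Y

/-- A parametrization `Φ` of the orbit of `ξ` under `1 + g` by `V / K`, for which the symplectic
form becomes `Ω`; the map `Ψ` computes the parameters from a group element. -/
structure OrbitChart (C : NilIdeal A N) (ξ : N →L[ℂ] ℂ) (g : Submodule ℂ N) {V : Type*}
    [NormedAddCommGroup V] [NormedSpace ℂ V] (K : Submodule ℂ V) (Ω : V → V → ℂ)
    (Φ : V → N →L[ℂ] ℂ) (Ψ : N → V) : Prop where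
  analytic : ∀ v, AnalyticAt ℂ Φ v
  mem : ∀ v, ∃ x ∈ g, Φ v = C.coad (C.unip x) ξ
  eq_iff : ∀ v v', Φ v = Φ v' ↔ v - v' ∈ K
  symplectic : ∀ v u₁ u₂, ∃ Y₁ ∈ g, ∃ Y₂ ∈ g, C.IsAdStar (Φ v) Y₁ (fderiv ℂ Φ v u₁) ∧
    C.IsAdStar (Φ v) Y₂ (fderiv ℂ Φ v u₂) ∧ Ω u₁ u₂ = -Φ v (C.lie Y₁ Y₂)
  analytic_symm : ∀ x, AnalyticAt ℂ Ψ x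
  right_inv : ∀ x ∈ g, Φ (Ψ x) = C.coad (C.unip x) ξ

namespace Polarization

variable {C : NilIdeal A N} {ξ : N →L[ℂ] ℂ} {W : Type*} [NormedAddCommGroup W]
  [NormedSpace ℂ W] (D : C.Polarization ξ W)

/-- The kernel of the projection `p`. -/
noncomputable def ker : Submodule ℂ N := LinearMap.ker (D.p : N →ₗ[ℂ] W)

theorem mem_ker {x : N} : x ∈ D.ker ↔ D.p x = 0 := Iff.rfl

/-- The parabolic subalgebra `g ⊓ ker p`. -/
noncomputable def par : Submodule ℂ N := D.g ⊓ D.ker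

theorem par_mul_ker : C.MulLE D.par D.ker D.ker := fun x hx y hy => D.mul_ker x hx.1 hx.2 y hy

theorem ker_mul_par : C.MulLE D.ker D.par D.ker := fun y hy x hx => D.ker_mul x hx.1 hx.2 y hy

theorem par_mul : C.MulLE D.par D.par D.par := fun x hx y hy =>
  ⟨D.g_mul x hx.1 y hy.1, D.par_mul_ker x hx y hy.2⟩

theorem par_mul_rad : C.MulLE D.par D.rad D.rad := fun x hx y hy => D.mul_rad x hx.1 hx.2 y hy

theorem rad_mul_par : C.MulLE D.rad D.par D.rad := fun y hy x hx => D.rad_mul x hx.1 hx.2 y hy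

theorem l_le_par : D.l ≤ D.par := fun x hx => ⟨D.l_le_g hx, D.p_l x hx⟩

theorem rad_le_par : D.rad ≤ D.par := fun x hx => ⟨D.rad_le_g hx, D.p_rad x hx⟩

theorem coad_eq_zero_of_ker {g : Aˣ} (hg : g ∈ grp D.par D.par_mul) {γ : N →L[ℂ] ℂ}
    (hγ : ∀ Y ∈ D.ker, γ Y = 0) : ∀ Y ∈ D.ker, C.coad g γ Y = 0 := fun _ hY =>
  hγ _ (Ad_mem_of_mem_grp D.par_mul D.par_mul_ker D.ker_mul_par (inv_mem hg) hY)

/-- The vector `(1 + x)⁻¹ Y` stays in `ker p`, where `ξ` kills commutators with `x`. The radical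
therefore moves `ξ` only in the directions dual to the image of `ι`. -/
theorem coad_unip_rad {x : N} (hx : x ∈ D.rad) : ∀ Y ∈ D.ker, C.coad (C.unip x) ξ Y = ξ Y := by
  intro Y hY
  rw [coad_unip_apply, D.ξ_lie _ (lmul_mem D.par_mul_ker
    (quasi_mem D.par_mul (D.rad_le_par hx)) hY) x hx, add_zero]

/-- Successive approximation along the filtration: `graded` matches `γ` on the last step where it is
nonzero, and the remainder vanishes one step earlier. Subtracting `ad^*(x) ξ` keeps the remainder
zero on `ker p` because `x` is in `rad`. -/
theorem exists_isAdStar {γ : N →L[ℂ] ℂ} (hγ : ∀ Y ∈ D.ker, γ Y = 0) :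
    ∃ x ∈ D.rad, C.IsAdStar ξ x γ := by
  have key : ∀ m, ∀ γ : N →L[ℂ] ℂ, (∀ Y ∈ D.ker, γ Y = 0) → (∀ Y ∈ C.fil (m + 1), γ Y = 0) →
      ∃ x ∈ D.rad, C.IsAdStar ξ x γ := by
    intro m
    induction m with
    | zero =>
      intro γ _ h
      refine ⟨0, zero_mem _, fun Z => ?_⟩
      rw [h Z (C.mem_fil_one Z), ← adStar_apply]
      simp [adStar]
    | succ m ih =>
      intro γ h1 h2
      obtain ⟨x, hx, hx'⟩ := D.graded (m + 1) (by omega) γ h1 h2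
      obtain ⟨y, hy, hy'⟩ := ih (γ - C.adStar ξ x)
        (fun Y hY => by
          rw [sub_apply, h1 Y hY, adStar_apply, lie_skew, map_neg, D.ξ_lie Y hY x hx]
          simp)
        (fun Y hY => by rw [sub_apply, adStar_apply, hx' Y hY, sub_self])
      refine ⟨x + y, add_mem hx hy, fun Z => ?_⟩
      have := hy' Z
      rw [sub_apply, adStar_apply] at this
      rw [lie_add_left, map_add, neg_add, ← this]
      ring
  refine key C.len γ hγ fun Y hY => ?_
  have := C.fil_anti (Nat.le_succ C.len) hY
  rw [C.fil_len, Submodule.mem_bot] at this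
  rw [this, map_zero]

/-- The group version of `exists_isAdStar`, by the same approximation: the parabolic orbit of `ξ`
contains the whole affine space of `ξ` plus functionals vanishing on `ker p`. These functionals will
be the cotangent fibres. -/
theorem exists_coad_eq_add {γ : N →L[ℂ] ℂ} (hγ : ∀ Y ∈ D.ker, γ Y = 0) :
    ∃ g ∈ grp D.par D.par_mul, C.coad g ξ = ξ + γ := by
  have key : ∀ m, ∀ γ : N →L[ℂ] ℂ, (∀ Y ∈ D.ker, γ Y = 0) → (∀ Y ∈ C.fil (m + 1), γ Y = 0) →
      ∃ g ∈ grp D.par D.par_mul, C.coad g ξ = ξ + γ := by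
    intro m
    induction m with
    | zero =>
      intro γ _ h
      refine ⟨1, one_mem _, ?_⟩
      have : γ = 0 := by ext Z; exact h Z (C.mem_fil_one Z)
      rw [coad_one, this, add_zero]
    | succ m ih =>
      intro γ h1 h2
      obtain ⟨x, hx, hx'⟩ := D.graded (m + 1) (by omega) γ h1 h2
      have hg : C.unip x ∈ grp D.par D.par_mul := unip_mem_grp _ (D.rad_le_par hx)
      set γ₁ := C.coad (C.unip x) ξ - ξ with hγ₁
      have h3 : ∀ Y ∈ D.ker, (γ - γ₁) Y = 0 := fun Y hY => by
        rw [sub_apply, h1 Y hY, hγ₁, sub_apply, D.coad_unip_rad hx Y hY]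
        simp
      -- Replacing `Y` by `(1 + x)⁻¹ Y` changes it by an element of the next filtration step, where
      -- `γ` is zero. On this layer the group action and its linearization agree.
      have h4 : ∀ Y ∈ C.fil (m + 1), (γ - γ₁) Y = 0 := fun Y hY => by
        have h5 : C.mul (C.quasi x) Y ∈ C.fil (m + 1 + 1) := C.mul_mem_fil_succ_right _ hY
        rw [sub_apply, hγ₁, sub_apply, coad_unip_apply, add_sub_cancel_left, lie_skew, map_neg,
          lmul, hx' _ (Submodule.add_mem _ hY (C.fil_anti (Nat.le_succ _) h5)), map_add, h2 _ h5]
        ring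
      -- The remainder is pulled back by `1 + x`, so that the later factor `h`, acting before `1 +
      -- x`, produces exactly `γ - γ₁`.
      obtain ⟨h, hh, hh'⟩ := ih (C.coad (C.unip x)⁻¹ (γ - γ₁))
        (D.coad_eq_zero_of_ker (inv_mem hg) h3) (fun Y hY => by
          rw [coad_apply, inv_inv, Ad_unip]
          have h5 := C.mul_mem_fil_succ_right x hY
          refine h4 _ (add_mem (add_mem (add_mem hY (C.fil_anti (Nat.le_succ _) h5))
            (C.fil_anti (Nat.le_succ _) (C.mul_mem_fil_succ_left hY _))) ?_)
          exact C.fil_anti (Nat.le_succ _) (C.mul_mem_fil_succ_left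
            (C.fil_anti (Nat.le_succ _) h5) _))
      refine ⟨C.unip x * h, mul_mem hg hh, ?_⟩
      rw [coad_mul, hh', coad_add, coad_coad_inv, hγ₁]
      abel
  refine key C.len γ hγ fun Y hY => ?_
  have := C.fil_anti (Nat.le_succ C.len) hY
  rw [C.fil_len, Submodule.mem_bot] at this
  rw [this, map_zero]

/-- If `1 + x` fixes `ξ`, then `ξ` kills every commutator with `x`. Any `θ ∘ p` has the form
`ad^*(c) ξ`, hence vanishes at `x`; as `θ` is arbitrary, `p x = 0`. -/
theorem mem_par_of_stabilizes [FiniteDimensional ℂ W] {x : N} (hx : x ∈ D.g)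
    (h : C.coad (C.unip x) ξ = ξ) : x ∈ D.par := by
  refine ⟨hx, D.mem_ker.mpr ?_⟩
  have h0 : ∀ Y, ξ (C.lie Y x) = 0 := fun Y => by
    have := congrArg (fun f => f (C.lmul x Y)) h
    rw [coad_unip_apply, lmul_quasi_lmul] at this
    exact add_eq_left.mp this
  by_contra hne
  obtain ⟨θ, hθ⟩ := SeparatingDual.exists_ne_zero (R := ℂ) hne
  obtain ⟨c, _, hc⟩ := D.exists_isAdStar (γ := θ.comp D.p) fun Y hY => by
    change θ (D.p Y) = 0
    rw [D.mem_ker.mp hY, map_zero]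
  apply hθ
  have := hc x
  rw [h0, neg_zero] at this
  exact this

/-- The image of `ι` need not be closed under multiplication, but `Y - ι(p Y)` lies in `neg ⊓ ker
p`, and left multiplication by `neg` keeps such elements in `ker p`. -/
theorem p_lmul_ι_p {a Y : N} (ha : a ∈ D.neg) (hY : Y ∈ D.neg) :
    D.p (C.mul a (D.ι (D.p Y))) = D.p (C.mul a Y) := by
  have h := D.p_neg_mul a ha (Y - D.ι (D.p Y)) (sub_mem hY (D.ι_mem _))
    (by rw [map_sub, D.p_ι, sub_self])
  rw [map_sub, map_sub, sub_eq_zero] at h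
  exact h.symm

/-- The functional `Y ↦ P(p((1 + X) Y))`, the covector `P` at `X` in the left trivialization,
extended by zero. -/
noncomputable def beta (t : Cotangent W) : N →L[ℂ] ℂ :=
  t.2.comp (D.p.comp ((ContinuousLinearMap.id ℂ N + C.mul (D.ι t.1)).comp (D.ι.comp D.p)))

theorem beta_apply (t : Cotangent W) (Y : N) :
    D.beta t Y = t.2 (D.p (C.lmul (D.ι t.1) (D.ι (D.p Y)))) := rfl

theorem beta_ker (t : Cotangent W) : ∀ Y ∈ D.ker, D.beta t Y = 0 := fun Y hY => by
  rw [beta_apply, D.mem_ker.mp hY, lmul]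
  simp

theorem beta_neg (t : Cotangent W) {Y : N} (hY : Y ∈ D.neg) :
    D.beta t Y = t.2 (D.p (C.lmul (D.ι t.1) Y)) := by
  rw [beta_apply, lmul, lmul, map_add, map_add, D.p_lmul_ι_p (D.ι_mem _) hY, D.p_ι,
    map_add D.p, map_add t.2]

/-! ### One extension step: the new parametrization, its injectivity and its derivative. -/

section Step

variable {V : Type*} [NormedAddCommGroup V] [NormedSpace ℂ V]
  (Φ : V → N →L[ℂ] ℂ) (Ψ : N → V) (q : V →L[ℂ] Cotangent W) (s : Cotangent W →L[ℂ] V)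

theorem hasFDerivAt_beta_apply (v : V) (Y : N) :
    HasFDerivAt (fun v => D.beta (q v) Y)
      (((q v).2.comp (D.p.comp ((C.mul.flip (D.ι (D.p Y))).comp
        (D.ι.comp ((ContinuousLinearMap.fst ℂ W (W →L[ℂ] ℂ)).comp q))))) +
        (((ContinuousLinearMap.snd ℂ W (W →L[ℂ] ℂ)).comp q).flip
          (D.p (C.lmul (D.ι (q v).1) (D.ι (D.p Y)))))) v := by
  have h1 := ((ContinuousLinearMap.snd ℂ W (W →L[ℂ] ℂ)).comp q).hasFDerivAt (x := v)
  have h2 := (D.p.hasFDerivAt (x := C.lmul (D.ι (q v).1) (D.ι (D.p Y)))).comp v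
    ((((C.mul.flip (D.ι (D.p Y))).comp
      (D.ι.comp ((ContinuousLinearMap.fst ℂ W (W →L[ℂ] ℂ)).comp q))).hasFDerivAt (x := v)).const_add
        (D.ι (D.p Y)))
  exact h1.clm_apply h2

theorem analyticAt_beta (v : V) : AnalyticAt ℂ (fun v => D.beta (q v)) v := by
  refine analyticAt_clm_of_apply fun Y => ?_
  have h1 := ((ContinuousLinearMap.snd ℂ W (W →L[ℂ] ℂ)).comp q).analyticAt v
  have h2 := (D.ι.comp ((ContinuousLinearMap.fst ℂ W (W →L[ℂ] ℂ)).comp q)).analyticAt v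
  exact analyticAt_clm_apply (f := fun v => (q v).2) h1 ((D.p.analyticAt _).fun_comp
    (analyticAt_const.add (C.analyticAt_mul h2 analyticAt_const)))

theorem fderiv_beta_apply (v u : V) (Y : N) :
    fderiv ℂ (fun v => D.beta (q v)) v u Y =
      (q u).2 (D.p (C.lmul (D.ι (q v).1) (D.ι (D.p Y)))) +
        (q v).2 (D.p (C.mul (D.ι (q u).1) (D.ι (D.p Y)))) := by
  have h1 := ((D.analyticAt_beta q v).differentiableAt.hasFDerivAt.clm_apply
    (hasFDerivAt_const Y v)).unique (D.hasFDerivAt_beta_apply q v Y)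
  have h2 := congrArg (fun f => f u) h1
  simp only [ContinuousLinearMap.comp_zero, zero_add] at h2
  refine h2.trans ?_
  rw [add_comm]
  rfl

theorem fderiv_beta_neg (v u : V) {Y : N} (hY : Y ∈ D.neg) :
    fderiv ℂ (fun v => D.beta (q v)) v u Y =
      (q u).2 (D.p (C.lmul (D.ι (q v).1) Y)) + (q v).2 (D.p (C.mul (D.ι (q u).1) Y)) := by
  rw [fderiv_beta_apply, lmul, lmul, map_add, map_add D.p, D.p_lmul_ι_p (D.ι_mem _) hY, D.p_ι,
    D.p_lmul_ι_p (D.ι_mem _) hY]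

theorem fderiv_beta_ker (v u : V) : ∀ Y ∈ D.ker, fderiv ℂ (fun v => D.beta (q v)) v u Y = 0 := by
  intro Y hY
  rw [fderiv_beta_apply, D.mem_ker.mp hY, lmul]
  simp

/-- The parametrization `v ↦ Ad^*(1 + X)(Φ(v) + β)`, with `(X, P) = q(v)`. -/
noncomputable def stepMap (v : V) : N →L[ℂ] ℂ :=
  C.coad (C.unip (D.ι (q v).1)) (Φ v + D.beta (q v))

/-- The parameters of a group element. -/
noncomputable def stepInv (x : N) : V :=
  let z := C.factor (D.ι.comp D.p) x
  let c := z - D.ι (D.p z)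
  s (D.p z, (C.coad (C.unip c) ξ - C.coad (C.unip (D.lev c)) ξ).comp
    ((ContinuousLinearMap.id ℂ N + C.mul (C.quasi (D.ι (D.p z)))).comp D.ι)) +
    (Ψ (D.lev c) - s (q (Ψ (D.lev c))))

variable {Φ Ψ q s}

/-- The group `1 + l` normalizes `neg`, and `ξ` vanishes there. This vanishing is what separates the
old coordinates from the new ones. -/
theorem eq_zero_of_neg {η : N →L[ℂ] ℂ} {x : N} (hx : x ∈ D.l) (hη : η = C.coad (C.unip x) ξ) :
    ∀ Y ∈ D.neg, η Y = 0 := by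
  rintro Y hY
  rw [hη, coad_apply, unip_inv]
  exact D.ξ_neg _ (Ad_unip_mem D.l_mul D.l_mul_neg D.neg_mul_l (quasi_mem D.l_mul hx) hY)

theorem exists_coad_eq_add' {γ η : N →L[ℂ] ℂ} (hγ : ∀ Y ∈ D.ker, γ Y = 0) {x : N} (hx : x ∈ D.l)
    (hη : η = C.coad (C.unip x) ξ) :
    ∃ g ∈ grp D.par D.par_mul, η + γ = C.coad g ξ := by
  have hl : C.unip x ∈ grp D.par D.par_mul := unip_mem_grp _ (D.l_le_par hx)
  obtain ⟨g, hg, hg'⟩ := D.exists_coad_eq_add (D.coad_eq_zero_of_ker (inv_mem hl) hγ)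
  exact ⟨C.unip x * g, mul_mem hl hg, by rw [coad_mul, hg', coad_add, coad_coad_inv, hη]⟩

theorem analyticAt_stepMap (hΦ : ∀ v, AnalyticAt ℂ Φ v) (v : V) :
    AnalyticAt ℂ (D.stepMap Φ q) v :=
  C.analyticAt_coad ((hΦ v).add (D.analyticAt_beta q v))
    ((D.ι.comp ((ContinuousLinearMap.fst ℂ W (W →L[ℂ] ℂ)).comp q)).analyticAt v)

theorem stepMap_mem (hΦ : ∀ v, ∃ x ∈ D.l, Φ v = C.coad (C.unip x) ξ) (v : V) :
    ∃ x ∈ D.g, D.stepMap Φ q v = C.coad (C.unip x) ξ := by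
  obtain ⟨x, hx, hx'⟩ := hΦ v
  obtain ⟨g, hg, hg'⟩ := D.exists_coad_eq_add' (D.beta_ker (q v)) hx hx'
  have h : C.unip (D.ι (q v).1) * g ∈ grp D.g D.g_mul :=
    mul_mem (unip_mem_grp _ (D.neg_le_g (D.ι_mem _)))
      (grp_mono _ D.g_mul inf_le_left hg)
  obtain ⟨y, hy, hy'⟩ := h
  exact ⟨y, hy, by rw [hy', coad_mul, ← hg']; rfl⟩

/-- The base point `X` is recovered because the stabilizer of `ξ` lies in the parabolic group, which
meets `1 + neg` only in elements that do not change `X`. Then `P` is read off on `neg`, and `Φ(v)`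
is what remains. -/
theorem eq_of_stepMap_eq [FiniteDimensional ℂ W]
    (hΦ : ∀ v, ∃ x ∈ D.l, Φ v = C.coad (C.unip x) ξ) {v v' : V}
    (h : D.stepMap Φ q v = D.stepMap Φ q v') : q v = q v' ∧ Φ v = Φ v' := by
  obtain ⟨x, hx, hη⟩ := hΦ v
  obtain ⟨x', hx', hη'⟩ := hΦ v'
  obtain ⟨b, hb, hb'⟩ := D.exists_coad_eq_add' (D.beta_ker (q v)) hx hη
  obtain ⟨b', hb₁, hb₁'⟩ := D.exists_coad_eq_add' (D.beta_ker (q v')) hx' hη'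
  have hu : C.unip (D.ι (q v).1) ∈ grp D.neg D.neg_mul := unip_mem_grp _ (D.ι_mem _)
  have hu' : C.unip (D.ι (q v').1) ∈ grp D.neg D.neg_mul := unip_mem_grp _ (D.ι_mem _)
  have h0 := h
  unfold stepMap at h
  rw [hb', hb₁'] at h
  have h1 : (q v).1 = (q v').1 := by
    set u := C.unip (D.ι (q v).1) with hu_def
    set u' := C.unip (D.ι (q v').1) with hu'_def
    have hle := grp_mono D.par_mul D.g_mul (inf_le_left : D.par ≤ D.g)
    have hle' := grp_mono D.neg_mul D.g_mul D.neg_le_g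
    -- Both sides are written as translates of `ξ`; their quotient stabilizes `ξ`, so it lies in the
    -- parabolic group, and so does `u'⁻¹ * u`.
    obtain ⟨y, hy, hy'⟩ : b'⁻¹ * u'⁻¹ * u * b ∈ grp D.g D.g_mul :=
      mul_mem (mul_mem (mul_mem (inv_mem (hle hb₁)) (inv_mem (hle' hu'))) (hle' hu)) (hle hb)
    have hst : C.coad (C.unip y) ξ = ξ := by
      rw [hy', coad_mul, coad_mul, coad_mul, h, coad_inv_coad, coad_inv_coad]
    have hy2 := unip_mem_grp D.par_mul (D.mem_par_of_stabilizes hy hst)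
    rw [hy'] at hy2
    have hw : u'⁻¹ * u ∈ grp D.par D.par_mul := by
      have := mul_mem (mul_mem hb₁ hy2) (inv_mem hb)
      simpa [mul_assoc] using this
    obtain ⟨w, hw1, hw2⟩ := hw
    obtain ⟨w', hw1', hw2'⟩ := mul_mem (inv_mem hu') hu
    have hww : w' = w := C.unip_injective (hw2'.trans hw2.symm)
    rw [hww] at hw1'
    have e1 : u = u' * C.unip w := by rw [hw2, mul_inv_cancel_left]
    rw [hu_def, hu'_def, unip_mul] at e1
    have e2 := congrArg D.p (C.unip_injective e1)
    rw [map_add, map_add, D.p_ι, D.p_ι, D.mem_ker.mp hw1.2,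
      D.p_neg_mul _ (D.ι_mem _) _ hw1' hw1.2] at e2
    simpa using e2
  have h2 : (q v).2 = (q v').2 := by
    ext w
    unfold stepMap at h0
    rw [h1] at h0
    -- On the test vector `(1 + X)⁻¹ ι(w)`, which lies in `neg`, the functional `Φ` vanishes and `β`
    -- takes the value `P(w)`.
    have h3 := congrArg (fun f => f (C.lmul (C.quasi (D.ι (q v').1)) (D.ι w)))
      (C.coad_injective _ h0)
    have hm : C.lmul (C.quasi (D.ι (q v').1)) (D.ι w) ∈ D.neg :=
      lmul_mem D.neg_mul (quasi_mem D.neg_mul (D.ι_mem _)) (D.ι_mem _)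
    simp only [add_apply] at h3
    rw [D.eq_zero_of_neg hx hη _ hm, D.eq_zero_of_neg hx' hη' _ hm, D.beta_neg _ hm,
      D.beta_neg _ hm, h1, lmul_lmul_quasi, D.p_ι, zero_add, zero_add] at h3
    exact h3
  have h3 : q v = q v' := Prod.ext h1 h2
  refine ⟨h3, ?_⟩
  unfold stepMap at h0
  rw [h3] at h0
  exact add_right_cancel (C.coad_injective _ h0)

/-- This is `d(Ad^*(u) ζ) = Ad^*(u)(dζ + ad^*(u⁻¹ du) ζ)` for `u = 1 + X`. -/
theorem fderiv_stepMap_apply (hΦ : ∀ v, AnalyticAt ℂ Φ v) (v u : V) :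
    fderiv ℂ (D.stepMap Φ q) v u = C.coad (C.unip (D.ι (q v).1))
      (fderiv ℂ Φ v u + fderiv ℂ (fun v => D.beta (q v)) v u +
        C.adStar (Φ v + D.beta (q v)) (C.lmul (C.quasi (D.ι (q v).1)) (D.ι (q u).1))) := by
  set L := D.ι.comp ((ContinuousLinearMap.fst ℂ W (W →L[ℂ] ℂ)).comp q) with hL
  have hζ : HasFDerivAt (fun v => Φ v + D.beta (q v))
      (fderiv ℂ Φ v + fderiv ℂ (fun v => D.beta (q v)) v) v :=
    (hΦ v).differentiableAt.hasFDerivAt.add (D.analyticAt_beta q v).differentiableAt.hasFDerivAt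
  have hstep := (D.analyticAt_stepMap (q := q) hΦ v).differentiableAt.hasFDerivAt
  -- Differentiating an inverse is avoided: evaluation at `(1 + X)Y` gives `ζ(Y(1 + X))`, where both
  -- arguments are affine in `X`. The product rule on the two sides gives the identity.
  have key : ∀ Y, fderiv ℂ (D.stepMap Φ q) v u (Y + C.mul (L v) Y) +
      D.stepMap Φ q v (C.mul (L u) Y) =
      (fderiv ℂ Φ v u + fderiv ℂ (fun v => D.beta (q v)) v u) (Y + C.mul Y (L v)) +
      (Φ v + D.beta (q v)) (C.mul Y (L u)) := by
    intro Y
    have e : (fun v => D.stepMap Φ q v (Y + C.mul (L v) Y)) =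
        fun v => (Φ v + D.beta (q v)) (Y + C.mul Y (L v)) := by
      funext v
      change (Φ v + D.beta (q v)) (C.Ad (C.unip (L v))⁻¹ (Y + C.mul (L v) Y)) = _
      congr 1
      apply C.e_injective
      rw [e_Ad, inv_inv, ← lmul, e_lmul, Units.inv_mul_cancel_left, map_add, e_mul, unip_val]
      noncomm_ring
    have h1 := hstep.clm_apply (((C.mul.flip Y).comp L).hasFDerivAt (x := v) |>.const_add Y)
    have h2 := hζ.clm_apply (((C.mul Y).comp L).hasFDerivAt (x := v) |>.const_add Y)
    have e' : (fun v => D.stepMap Φ q v (Y + ((C.mul.flip Y).comp L) v)) =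
        fun v => (Φ v + D.beta (q v)) (Y + ((C.mul Y).comp L) v) := e
    rw [e'] at h1
    have h3 := congrArg (fun f => f u) (h1.unique h2)
    simp only [add_apply, ContinuousLinearMap.comp_apply, ContinuousLinearMap.flip_apply] at h3 ⊢
    linear_combination h3
  ext Z
  have k := key (C.lmul (C.quasi (L v)) Z)
  have e0 : ((C.unip (L v))⁻¹ : Aˣ).val = C.unip (C.quasi (L v)) := by rw [unip_inv]
  have e1 : C.lmul (C.quasi (L v)) Z + C.mul (L v) (C.lmul (C.quasi (L v)) Z) = Z :=
    C.lmul_lmul_quasi _ _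
  have e2 : C.lmul (C.quasi (L v)) Z + C.mul (C.lmul (C.quasi (L v)) Z) (L v) =
      C.Ad (C.unip (L v))⁻¹ Z := by
    apply C.e_injective
    rw [e_Ad, inv_inv, map_add, e_mul, e_lmul, ← unip_inv, unip_val]
    noncomm_ring
  have e3 : C.mul (C.lmul (C.quasi (L v)) Z) (L u) =
      C.mul (C.Ad (C.unip (L v))⁻¹ Z) (C.lmul (C.quasi (L v)) (L u)) := by
    apply C.e_injective
    rw [e_mul, e_mul, e_Ad, inv_inv, e_lmul, e_lmul, ← unip_inv]
    simp only [mul_assoc, Units.mul_inv_cancel_left]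
  have e4 : C.Ad (C.unip (L v))⁻¹ (C.mul (L u) (C.lmul (C.quasi (L v)) Z)) =
      C.mul (C.lmul (C.quasi (L v)) (L u)) (C.Ad (C.unip (L v))⁻¹ Z) := by
    apply C.e_injective
    rw [e_mul, e_Ad, e_Ad, inv_inv, e_lmul, e_mul, e_lmul, ← unip_inv]
    simp only [mul_assoc]
  rw [e1, e2, e3] at k
  have e5 : D.stepMap Φ q v (C.mul (L u) (C.lmul (C.quasi (L v)) Z)) =
      (Φ v + D.beta (q v)) (C.mul (C.lmul (C.quasi (L v)) (L u))
        (C.Ad (C.unip (L v))⁻¹ Z)) := by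
    rw [← e4]; rfl
  rw [e5] at k
  change _ = (fderiv ℂ Φ v u + fderiv ℂ (fun v => D.beta (q v)) v u +
    C.adStar (Φ v + D.beta (q v)) (C.lmul (C.quasi (L v)) (L u))) (C.Ad (C.unip (L v))⁻¹ Z)
  rw [add_apply _ (C.adStar _ _), adStar_apply, lie, map_sub]
  linear_combination k

end Step

end Polarization

end NilIdeal

/-! ## The inductive step for charts of coadjoint orbits -/

namespace NilIdeal

namespace Polarization

variable {A N : Type*} [Ring A] [Algebra ℂ A] [NormedAddCommGroup N] [NormedSpace ℂ N]
  [FiniteDimensional ℂ N] {C : NilIdeal A N} {ξ : N →L[ℂ] ℂ} {W : Type*} [NormedAddCommGroup W]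
  [NormedSpace ℂ W] (D : C.Polarization ξ W) {V : Type*} [NormedAddCommGroup V]
  [NormedSpace ℂ V] {Φ : V → N →L[ℂ] ℂ} {Ψ : N → V} {q : V →L[ℂ] Cotangent W}
  {s : Cotangent W →L[ℂ] V}

theorem exists_isAdStar' {η β γ : N →L[ℂ] ℂ} {x : N} (hx : x ∈ D.l)
    (hη : η = C.coad (C.unip x) ξ) (hβ : ∀ Y ∈ D.ker, β Y = 0) (hγ : ∀ Y ∈ D.ker, γ Y = 0) :
    ∃ c ∈ D.rad, C.IsAdStar (η + β) c γ := by
  obtain ⟨g, hg, hg'⟩ := D.exists_coad_eq_add' hβ hx hη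
  obtain ⟨c, hc, hc'⟩ := D.exists_isAdStar (D.coad_eq_zero_of_ker (inv_mem hg) hγ)
  refine ⟨C.Ad g c, Ad_mem_of_mem_grp D.par_mul D.par_mul_rad D.rad_mul_par hg hc, ?_⟩
  have := hc'.coad g
  rwa [coad_coad_inv, ← hg'] at this

/-- Commutators with the parabolic subalgebra preserve `ker p`, so its annihilator is stable. -/
theorem adStar_ker {β : N →L[ℂ] ℂ} (hβ : ∀ Y ∈ D.ker, β Y = 0) {x : N} (hx : x ∈ D.par) :
    ∀ Y ∈ D.ker, C.adStar β x Y = 0 := fun Y hY => by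
  rw [adStar_apply, lie, hβ _ (sub_mem (D.par_mul_ker x hx Y hY) (D.ker_mul_par Y hY x hx)), neg_zero]

/-- After conjugation by `1 + X`, a tangent vector is realized by `A + l + c`: `A = (1 + X)⁻¹ dX`
moves the base point, `l` realizes the derivative of `Φ`, and `c` in the radical realizes the change
of the covector. The form is the value of `Φ(v) + β` on the commutator of two such sums. -/
theorem stepMap_symplectic {Ω : V → V → ℂ} {K : Submodule ℂ V}
    (h : C.OrbitChart ξ D.l K Ω Φ Ψ) (v u₁ u₂ : V) :
    ∃ Y₁ ∈ D.g, ∃ Y₂ ∈ D.g, C.IsAdStar (D.stepMap Φ q v) Y₁ (fderiv ℂ (D.stepMap Φ q) v u₁) ∧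
      C.IsAdStar (D.stepMap Φ q v) Y₂ (fderiv ℂ (D.stepMap Φ q) v u₂) ∧
      Ω u₁ u₂ + cotangentForm W (q u₁) (q u₂) = -D.stepMap Φ q v (C.lie Y₁ Y₂) := by
  obtain ⟨x, hx, hη⟩ := h.mem v
  obtain ⟨l₁, hl₁, l₂, hl₂, hd₁, hd₂, hΩ⟩ := h.symplectic v u₁ u₂
  set a := D.ι (q v).1 with ha
  set β := D.beta (q v) with hβ
  have ham : a ∈ D.neg := D.ι_mem _
  -- Besides realizing `dΦ`, the element `l` moves `β` by `ad^*(l) β`; the radical element `c` must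
  -- produce `dβ` with this excess removed.
  have ex : ∀ u : V, ∀ l ∈ D.l, C.IsAdStar (Φ v) l (fderiv ℂ Φ v u) → ∃ c ∈ D.rad,
      C.IsAdStar (Φ v + β) (l + c) (fderiv ℂ Φ v u + fderiv ℂ (fun v => D.beta (q v)) v u) := by
    intro u l hl hd
    obtain ⟨c, hc, hc'⟩ := D.exists_isAdStar' hx hη (D.beta_ker (q v))
      (γ := fderiv ℂ (fun v => D.beta (q v)) v u - C.adStar β l) fun Y hY => by
        rw [sub_apply, D.fderiv_beta_ker q v u Y hY,
          D.adStar_ker (D.beta_ker _) (D.l_le_par hl) Y hY, sub_zero]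
    refine ⟨c, hc, fun Z => ?_⟩
    have e1 := hc' Z
    rw [sub_apply, adStar_apply] at e1
    rw [lie_add_left, map_add, neg_add, ← e1, add_apply, hd Z, add_apply]
    ring
  obtain ⟨c₁, hc₁, hb₁⟩ := ex u₁ l₁ hl₁ hd₁
  obtain ⟨c₂, hc₂, hb₂⟩ := ex u₂ l₂ hl₂ hd₂
  have hneg : ∀ u, C.lmul (C.quasi a) (D.ι (q u).1) ∈ D.neg := fun u =>
    lmul_mem D.neg_mul (quasi_mem D.neg_mul ham) (D.ι_mem _)
  have hg : ∀ u, ∀ l ∈ D.l, ∀ c ∈ D.rad,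
      C.Ad (C.unip a) (C.lmul (C.quasi a) (D.ι (q u).1) + (l + c)) ∈ D.g := fun u l hl c hc =>
    Ad_unip_mem D.g_mul D.g_mul D.g_mul (D.neg_le_g ham)
      (add_mem (D.neg_le_g (hneg u)) (add_mem (D.l_le_g hl) (D.rad_le_g hc)))
  have hstar : ∀ u l c, C.IsAdStar (Φ v + β) (l + c)
      (fderiv ℂ Φ v u + fderiv ℂ (fun v => D.beta (q v)) v u) →
      C.IsAdStar (D.stepMap Φ q v) (C.Ad (C.unip a) (C.lmul (C.quasi a) (D.ι (q u).1) + (l + c)))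
        (fderiv ℂ (D.stepMap Φ q) v u) := by
    intro u l c hb
    rw [D.fderiv_stepMap_apply h.analytic, ← ha, ← hβ]
    refine IsAdStar.coad (fun Z => ?_) _
    rw [add_apply, hb Z, adStar_apply, C.lie_add_left _ (l + c) Z, map_add]
    ring
  refine ⟨_, hg u₁ l₁ hl₁ c₁ hc₁, _, hg u₂ l₂ hl₂ c₂ hc₂, hstar u₁ l₁ c₁ hb₁,
    hstar u₂ l₂ c₂ hb₂, ?_⟩
  set A₁ := C.lmul (C.quasi a) (D.ι (q u₁).1) with hA₁
  set A₂ := C.lmul (C.quasi a) (D.ι (q u₂).1) with hA₂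
  have hA₁m : A₁ ∈ D.neg := hneg u₁
  have hA₂m : A₂ ∈ D.neg := hneg u₂
  have hη0 := D.eq_zero_of_neg hx hη
  have key : D.stepMap Φ q v (C.lie (C.Ad (C.unip a) (A₁ + (l₁ + c₁)))
      (C.Ad (C.unip a) (A₂ + (l₂ + c₂)))) = (Φ v + β) (C.lie (A₁ + (l₁ + c₁)) (A₂ + (l₂ + c₂))) := by
    rw [← Ad_lie]
    change (Φ v + β) (C.Ad (C.unip a)⁻¹ _) = _
    rw [Ad_inv_Ad]
  have hlA₁ : C.lmul a A₁ = D.ι (q u₁).1 := C.lmul_lmul_quasi _ _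
  have hlA₂ : C.lmul a A₂ = D.ι (q u₂).1 := C.lmul_lmul_quasi _ _
  have hAA : C.lie A₁ A₂ ∈ D.neg :=
    sub_mem (D.neg_mul _ hA₁m _ hA₂m) (D.neg_mul _ hA₂m _ hA₁m)
  -- Left multiplication by `1 + X` turns `A_i` back into `dX_i`, so `β` of the commutator involves
  -- `P` only through products `dX · A`.
  have e1 : (Φ v + β) (C.lie A₁ A₂) = (q v).2 (D.p (C.mul (D.ι (q u₁).1) A₂)) -
      (q v).2 (D.p (C.mul (D.ι (q u₂).1) A₁)) := by
    have : C.lmul a (C.lie A₁ A₂) = C.mul (D.ι (q u₁).1) A₂ - C.mul (D.ι (q u₂).1) A₁ := by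
      rw [← hlA₁, ← hlA₂]
      apply C.e_injective
      simp only [e_lmul, e_lie, map_sub, e_mul, mul_sub, mul_assoc]
    rw [add_apply, hη0 _ hAA, zero_add, hβ, D.beta_neg _ hAA, ← ha, this, map_sub, map_sub]
  have hl0 : ∀ l ∈ D.l, ∀ Y ∈ D.neg, Φ v (C.lie l Y) = 0 := fun l hl Y hY =>
    hη0 _ (sub_mem (D.l_mul_neg l hl Y hY) (D.neg_mul_l Y hY l hl))
  have e2 : (Φ v + β) (C.lie (l₁ + c₁) A₂) = -((q u₁).2 (q u₂).1 +
      (q v).2 (D.p (C.mul (D.ι (q u₁).1) A₂))) := by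
    have := hb₁ A₂
    rw [add_apply, hd₁, hl0 l₁ hl₁ _ hA₂m, D.fderiv_beta_neg q v u₁ hA₂m, ← ha, hlA₂, D.p_ι] at this
    linear_combination this
  have e3 : (Φ v + β) (C.lie (l₂ + c₂) A₁) = -((q u₂).2 (q u₁).1 +
      (q v).2 (D.p (C.mul (D.ι (q u₂).1) A₁))) := by
    have := hb₂ A₁
    rw [add_apply, hd₂, hl0 l₂ hl₂ _ hA₁m, D.fderiv_beta_neg q v u₂ hA₁m, ← ha, hlA₁, D.p_ι] at this
    linear_combination this
  -- Carried back from `Φ(v)` to `ξ` by the level group, this is the vanishing of `ξ` on commutators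
  -- of `ker p` with the radical.
  have e4 : Φ v (C.lie l₁ c₂) = 0 := by
    have hxi : C.quasi x ∈ D.par := D.l_le_par (quasi_mem D.l_mul hx)
    rw [hη, coad_apply, Ad_lie, unip_inv]
    exact D.ξ_lie _ (Ad_unip_mem D.par_mul D.par_mul_ker D.ker_mul_par hxi (D.p_l _ hl₁)) _
      (Ad_unip_mem D.par_mul D.par_mul_rad D.rad_mul_par hxi hc₂)
  have e5 : (Φ v + β) (C.lie (l₁ + c₁) (l₂ + c₂)) = -Ω u₁ u₂ := by
    have := hb₁ (l₂ + c₂)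
    rw [add_apply, hd₁, lie_add_right, map_add, e4, D.fderiv_beta_ker q v u₁ _
      (add_mem (D.p_l _ hl₂) (D.p_rad _ hc₂))] at this
    rw [hΩ]
    linear_combination this
  have e6 : (Φ v + β) (C.lie A₁ (l₂ + c₂)) = -(Φ v + β) (C.lie (l₂ + c₂) A₁) := by
    rw [lie_skew, map_neg]
  -- The terms `P(p(dX · A))` in `e1` cancel against those in `e2` and `e3`; only the old form and
  -- `dP₁(dX₂) - dP₂(dX₁)` survive.
  rw [key, lie_add_left, C.lie_add_right A₁ A₂, C.lie_add_right (l₁ + c₁) A₂, map_add, map_add, map_add, e1, e2, e6, e3,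
    e5, cotangentForm_apply]
  ring

theorem stepInv_fst (hqs : ∀ t, q (s t) = t) (x : N) :
    q (D.stepInv Ψ q s x) =
      (D.p (C.factor (D.ι.comp D.p) x), ((C.coad (C.unip (C.factor (D.ι.comp D.p) x -
        D.ι (D.p (C.factor (D.ι.comp D.p) x)))) ξ - C.coad (C.unip (D.lev
          (C.factor (D.ι.comp D.p) x - D.ι (D.p (C.factor (D.ι.comp D.p) x))))) ξ).comp
    ((ContinuousLinearMap.id ℂ N + C.mul (C.quasi (D.ι (D.p (C.factor (D.ι.comp D.p) x))))).comp
      D.ι))) := by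
  unfold stepInv
  simp only [map_add, map_sub, hqs, sub_self, add_zero]

/-- Factor `1 + c = (1 + lev c)(1 + r)` with `r` in the radical. The second factor changes `ξ` only
off `ker p`, and the first preserves `ker p`. -/
theorem coad_unip_par {c : N} (hc : c ∈ D.par) :
    ∀ Y ∈ D.ker, C.coad (C.unip c) ξ Y = C.coad (C.unip (D.lev c)) ξ Y := by
  have hl := D.lev_mem c hc.1 hc.2
  have hl' := D.l_le_par hl
  have hr := D.sub_lev_mem c hc.1 hc.2
  have hi : C.lmul (C.quasi (D.lev c)) (c - D.lev c) ∈ D.rad :=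
    lmul_mem D.par_mul_rad (quasi_mem D.par_mul hl') hr
  have e : C.unip c = C.unip (D.lev c) * C.unip (C.lmul (C.quasi (D.lev c)) (c - D.lev c)) := by
    rw [unip_mul, add_assoc]
    congr 1
    have := C.lmul_lmul_quasi (D.lev c) (c - D.lev c)
    rw [lmul] at this
    rw [this, add_sub_cancel]
  intro Y hY
  rw [e, coad_mul, coad_apply, D.coad_unip_rad hi]
  · rfl
  · exact Ad_mem_of_mem_grp D.par_mul D.par_mul_ker D.ker_mul_par
      (inv_mem (unip_mem_grp _ hl')) hY

/-- Write `1 + x = (1 + X)(1 + c)` with `c` in the parabolic. Then `Ad^*(1 + c) ξ` is the level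
point `Ad^*(1 + lev c) ξ` plus a functional vanishing on `ker p`; the first is handled by `Ψ`, the
second is `β` for a unique covector. -/
theorem stepMap_stepInv {Ω : V → V → ℂ} {K : Submodule ℂ V}
    (h : C.OrbitChart ξ D.l K Ω Φ Ψ) (hqs : ∀ t, q (s t) = t) (hs : ∀ t, s t ∈ K) {x : N}
    (hx : x ∈ D.g) : D.stepMap Φ q (D.stepInv Ψ q s x) = C.coad (C.unip x) ξ := by
  unfold stepMap
  rw [D.stepInv_fst hqs]
  have hfac := C.unip_factor (π := D.ι.comp D.p) D.p_fil x
  have hz : C.factor (D.ι.comp D.p) x ∈ D.g :=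
    factor_mem C D.g_mul (fun z _ => D.neg_le_g (D.ι_mem _)) hx
  -- Overwriting the `q`-component only adds vectors from the image of `s`, which lies in `K` and is
  -- invisible to `Φ`.
  have hΦ : Φ (D.stepInv Ψ q s x) = Φ (Ψ (D.lev (C.factor (D.ι.comp D.p) x -
      D.ι (D.p (C.factor (D.ι.comp D.p) x))))) := by
    rw [h.eq_iff]
    unfold stepInv
    simp only
    rw [← add_sub_assoc, sub_right_comm, add_sub_cancel_right]
    exact sub_mem (hs _) (hs _)
  rw [hΦ]
  set z := C.factor (D.ι.comp D.p) x with hzdef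
  have hc : z - D.ι (D.p z) ∈ D.par :=
    ⟨sub_mem hz (D.neg_le_g (D.ι_mem _)), by
      rw [SetLike.mem_coe, D.mem_ker, map_sub, D.p_ι, sub_self]⟩
  change C.unip (D.ι (D.p z)) * C.unip (z - D.ι (D.p z)) = _ at hfac
  set c := z - D.ι (D.p z)
  rw [h.right_inv _ (D.lev_mem c hc.1 hc.2), ← hfac, coad_mul]
  congr 1
  rw [← eq_sub_iff_add_eq']
  set a := D.ι (D.p z) with ha
  set δ := C.coad (C.unip c) ξ - C.coad (C.unip (D.lev c)) ξ with hδ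
  have hδ0 : ∀ Y ∈ D.ker, δ Y = 0 := fun Y hY => by
    rw [hδ, sub_apply, D.coad_unip_par hc Y hY, sub_self]
  have ham : a ∈ D.neg := D.ι_mem _
  ext Y
  rw [beta_apply]
  change δ (C.lmul (C.quasi a) (D.ι (D.p (C.lmul a (D.ι (D.p Y)))))) = δ Y
  -- The covector of `stepInv` is `δ((1 + a)⁻¹ ι(·))`, and `β` evaluates it at `p(T)`. Truncating
  -- `T` to `ι(p T)` costs only an element of `neg ⊓ ker p`, which `δ` still kills after
  -- multiplication by `(1 + a)⁻¹`.
  set T := C.lmul a (D.ι (D.p Y)) with hT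
  have hTm : T ∈ D.neg := lmul_mem D.neg_mul ham (D.ι_mem _)
  have hT0 : D.p (T - D.ι (D.p T)) = 0 := by rw [map_sub, D.p_ι, sub_self]
  have e1 : δ (C.lmul (C.quasi a) (T - D.ι (D.p T))) = 0 := by
    refine hδ0 _ (D.mem_ker.mpr ?_)
    rw [lmul, map_add, hT0, D.p_neg_mul _ (quasi_mem D.neg_mul ham) _
      (sub_mem hTm (D.ι_mem _)) hT0, add_zero]
  rw [lmul_sub_right, map_sub, hT, lmul_quasi_lmul, sub_eq_zero] at e1
  rw [← e1]
  have e2 := hδ0 (Y - D.ι (D.p Y)) (by rw [D.mem_ker, map_sub, D.p_ι, sub_self])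
  rw [map_sub, sub_eq_zero] at e2
  exact e2.symm

theorem analyticAt_stepInv [FiniteDimensional ℂ W] (hΨ : ∀ x, AnalyticAt ℂ Ψ x) (x : N) :
    AnalyticAt ℂ (D.stepInv Ψ q s) x := by
  unfold stepInv
  have hz := C.analyticAt_factor (D.ι.comp D.p) x
  have hpz := (D.p.analyticAt _).fun_comp hz
  have ha := (D.ι.analyticAt _).fun_comp hpz
  have hl := (D.lev.analyticAt _).fun_comp (hz.sub ha)
  have hP : AnalyticAt ℂ (fun x => (C.coad (C.unip (C.factor (D.ι.comp D.p) x -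
        D.ι (D.p (C.factor (D.ι.comp D.p) x)))) ξ - C.coad (C.unip (D.lev
          (C.factor (D.ι.comp D.p) x - D.ι (D.p (C.factor (D.ι.comp D.p) x))))) ξ).comp
    ((ContinuousLinearMap.id ℂ N + C.mul (C.quasi (D.ι (D.p (C.factor (D.ι.comp D.p) x))))).comp
      D.ι)) x := by
    refine analyticAt_clm_of_apply fun w => ?_
    have h1 := (C.analyticAt_coad (f := fun _ => ξ) analyticAt_const (hz.sub ha)).sub
      (C.analyticAt_coad (f := fun _ => ξ) analyticAt_const hl)
    have h2 := (analyticAt_const (v := D.ι w)).add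
      (C.analyticAt_mul (C.analyticAt_quasi ha) (analyticAt_const (v := D.ι w)))
    have h3 := analyticAt_clm_apply h1 h2
    exact h3
  have hΨl := (hΨ _).fun_comp hl
  exact ((s.analyticAt _).fun_comp (hpz.prod hP)).add
    (hΨl.sub ((s.analyticAt _).fun_comp ((q.analyticAt _).fun_comp hΨl)))

/-- One step of the construction: a parametrization of the orbit under `1 + l` extends to one of
the orbit under `1 + g`, with a further factor `T^*W`. -/
theorem orbitChart_step [FiniteDimensional ℂ W] {Ω : V → V → ℂ} {K : Submodule ℂ V}
    (h : C.OrbitChart ξ D.l K Ω Φ Ψ) (hqs : ∀ t, q (s t) = t) (hs : ∀ t, s t ∈ K) :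
    C.OrbitChart ξ D.g (K ⊓ LinearMap.ker (q : V →ₗ[ℂ] Cotangent W))
      (fun u₁ u₂ => Ω u₁ u₂ + cotangentForm W (q u₁) (q u₂)) (D.stepMap Φ q)
      (D.stepInv Ψ q s) where
  analytic := D.analyticAt_stepMap h.analytic
  mem := D.stepMap_mem h.mem
  eq_iff v v' := by
    rw [Submodule.mem_inf, ← h.eq_iff, LinearMap.mem_ker, map_sub, sub_eq_zero]
    refine ⟨fun e => (D.eq_of_stepMap_eq h.mem e).symm, fun ⟨e1, e2⟩ => ?_⟩
    have e2 : q v = q v' := e2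
    unfold stepMap
    rw [e1, e2]
  symplectic := D.stepMap_symplectic h
  analytic_symm := D.analyticAt_stepInv h.analytic_symm
  right_inv _ hx := D.stepMap_stepInv h hqs hs hx

end Polarization

end NilIdeal

/-! ## The Lie algebra of `GL_n(ℂ[z]_k)¹` as a nilpotent ideal -/

theorem structureConst_zero_param (i j t : ℕ) :
    structureConst 0 i j t = if i + j = t then 1 else 0 := by
  induction i generalizing t with
  | zero => simp [structureConst, eq_comm]
  | succ i ih =>
    cases t with
    | zero => simp [structureConst]
    | succ t =>
      simp only [structureConst, Pi.zero_apply, sub_zero, zero_mul, add_zero, ih]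
      simp only [Nat.add_right_comm i 1 j, Nat.add_right_cancel_iff]

variable {n k : ℕ}

/-- The `(p, q)`-entry of the coefficient of `z ^ (i + 1)`. -/
def LieGL1.entry (i : Fin k) (p q : Fin n) : LieGL1 n k →ₗ[ℂ] ℂ where
  toFun x := x i p q
  map_add' _ _ := rfl
  map_smul' _ _ := rfl

theorem LieGL1.ext_entry {x y : LieGL1 n k} (h : ∀ i p q, entry i p q x = entry i p q y) :
    x = y :=
  _root_.funext fun i => Matrix.ext fun p q => h i p q

/-- The tuple with given entries. -/
def LieGL1.mk (f : Fin k → Fin n → Fin n → ℂ) : LieGL1 n k := fun i => Matrix.of (f i)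

@[simp]
theorem LieGL1.entry_mk (f : Fin k → Fin n → Fin n → ℂ) (i : Fin k) (p q : Fin n) :
    entry i p q (mk f) = f i p q := rfl

theorem LieGL1.ofMat_toMat (x : LieGL1 n k) : ofMat (toMat x) = x :=
  newtonCoeff_newtonMat 0 k x

/-- The product in coordinates. -/
noncomputable def LieGL1.coordMul (x y : LieGL1 n k) : LieGL1 n k := newtonMulCoord 0 k x y

theorem LieGL1.toMat_mul_toMat (x y : LieGL1 n k) :
    toMat x * toMat y = toMat (coordMul x y) :=
  newtonMat_mul 0 k x y

theorem newtonClass_zero (c : ℕ → ℂ) (m : ℕ) : newtonClass c m 0 = 1 := by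
  simp only [newtonClass, newton, Finset.range_zero, Finset.prod_empty]; rfl

/-- The constant coefficient of a matrix over `ℂ[z] / ⟨z^{k+1}⟩`. -/
noncomputable def constMat (a : Matrix (Fin n) (Fin n) (DefRing 0 (k + 1))) : Mat n :=
  Matrix.of fun p q => (newtonBasis 0 (k + 1)).repr (a p q) 0

/-- The splitting into constant term and multiple of `z` reduces the two-sided ideal property to
products with constant matrices and products inside the ideal. -/
theorem eq_constMat_add (a : Matrix (Fin n) (Fin n) (DefRing 0 (k + 1))) :
    a = (constMat a).map (algebraMap ℂ (DefRing 0 (k + 1))) + LieGL1.toMat (LieGL1.ofMat a) := by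
  ext p q
  have h := (newtonBasis 0 (k + 1)).sum_repr (a p q)
  rw [Fin.sum_univ_succ] at h
  simp only [newtonBasis_apply, Fin.val_zero, newtonClass_zero, Fin.val_succ] at h
  rw [Matrix.add_apply, Matrix.map_apply, Algebra.algebraMap_eq_smul_one]
  exact h.symm

theorem map_mul_toMat (b : Mat n) (x : LieGL1 n k) :
    b.map (algebraMap ℂ (DefRing 0 (k + 1))) * LieGL1.toMat x =
      LieGL1.toMat (fun i => b * x i : LieGL1 n k) := by
  ext p q
  simp only [LieGL1.toMat, newtonMat, LinearMap.coe_mk, AddHom.coe_mk, Matrix.mul_apply,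
    Matrix.of_apply, Matrix.map_apply, Finset.mul_sum, Finset.sum_smul]
  rw [Finset.sum_comm]
  refine Finset.sum_congr rfl fun i _ => Finset.sum_congr rfl fun r _ => ?_
  rw [← Algebra.smul_def, smul_smul]

theorem toMat_mul_map (b : Mat n) (x : LieGL1 n k) :
    LieGL1.toMat x * b.map (algebraMap ℂ (DefRing 0 (k + 1))) =
      LieGL1.toMat (fun i => x i * b : LieGL1 n k) := by
  ext p q
  simp only [LieGL1.toMat, newtonMat, LinearMap.coe_mk, AddHom.coe_mk, Matrix.mul_apply,
    Matrix.of_apply, Matrix.map_apply, Finset.sum_mul, Finset.sum_smul]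
  rw [Finset.sum_comm]
  refine Finset.sum_congr rfl fun i _ => Finset.sum_congr rfl fun r _ => ?_
  rw [mul_comm, ← Algebra.smul_def, smul_smul, mul_comm]

theorem exists_mul_toMat (a : Matrix (Fin n) (Fin n) (DefRing 0 (k + 1))) (x : LieGL1 n k) :
    ∃ y : LieGL1 n k, a * LieGL1.toMat x = LieGL1.toMat y := by
  rw [eq_constMat_add a, add_mul, map_mul_toMat, LieGL1.toMat_mul_toMat]
  exact ⟨_, (LieGL1.toMat.map_add _ _).symm⟩

theorem exists_toMat_mul (a : Matrix (Fin n) (Fin n) (DefRing 0 (k + 1))) (x : LieGL1 n k) :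
    ∃ y : LieGL1 n k, LieGL1.toMat x * a = LieGL1.toMat y := by
  rw [eq_constMat_add a, mul_add, toMat_mul_map, LieGL1.toMat_mul_toMat]
  exact ⟨_, (LieGL1.toMat.map_add _ _).symm⟩

theorem entry_coordMul (x y : LieGL1 n k) (t : Fin k) (p q : Fin n) :
    LieGL1.entry t p q (LieGL1.coordMul x y) =
      ∑ i : Fin k, ∑ j : Fin k, if (i + 1 : ℕ) + (j + 1) = t + 1 then
        ∑ r, LieGL1.entry i p r x * LieGL1.entry j r q y else 0 := by
  change newtonMulCoord 0 k x y t p q = ∑ i : Fin k, ∑ j : Fin k,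
    if (i + 1 : ℕ) + (j + 1) = t + 1 then ∑ r, x i p r * y j r q else 0
  simp only [newtonMulCoord, Matrix.sum_apply, structureConst_zero_param, ite_smul, one_smul,
    zero_smul]
  refine Finset.sum_congr rfl fun i _ => Finset.sum_congr rfl fun j _ => ?_
  split_ifs
  · exact Matrix.mul_apply
  · rfl

/-- The filtration by the order of vanishing at `z = 0`. -/
def LieGL1.fil (m : ℕ) : Submodule ℂ (LieGL1 n k) where
  carrier := {x | ∀ (i : Fin k) p q, (i + 1 : ℕ) < m → entry i p q x = 0}
  add_mem' hx hy i p q h := by rw [map_add, hx i p q h, hy i p q h, add_zero]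
  zero_mem' i p q _ := map_zero _
  smul_mem' a x hx i p q h := by rw [map_smul, hx i p q h, smul_zero]

variable (n k) in
/-- The Lie algebra of `GL_n(ℂ[z]_k)¹`, as the ideal generated by `z` in the algebra of matrices
over `ℂ[z] / ⟨z^{k+1}⟩`. -/
noncomputable def nilIdeal :
    NilIdeal (Matrix (Fin n) (Fin n) (DefRing 0 (k + 1))) (LieGL1 n k) where
  e := LieGL1.toMat
  r := LieGL1.ofMat
  r_e := LieGL1.ofMat_toMat
  e_r_mul a x := by
    obtain ⟨y, hy⟩ := exists_mul_toMat a x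
    rw [hy, LieGL1.ofMat_toMat]
  e_r_mul' a x := by
    obtain ⟨y, hy⟩ := exists_toMat_mul a x
    rw [hy, LieGL1.ofMat_toMat]
  fil := LieGL1.fil
  len := k + 1
  fil_one := by
    refine eq_top_iff.mpr fun x _ i p q h => ?_
    omega
  fil_len := by
    refine eq_bot_iff.mpr fun x hx => ?_
    exact LieGL1.ext_entry fun i p q => (hx i p q (by omega)).trans (map_zero _).symm
  fil_anti a b hab x hx i p q h := hx i p q (h.trans_le hab)
  fil_mul {a b x y} hx hy t p q ht := by
    rw [LieGL1.toMat_mul_toMat, LieGL1.ofMat_toMat, entry_coordMul]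
    refine Finset.sum_eq_zero fun i _ => Finset.sum_eq_zero fun j _ => ?_
    split_ifs with h
    · refine Finset.sum_eq_zero fun r _ => ?_
      by_cases hi : (i + 1 : ℕ) < a
      · rw [hx i p r hi, zero_mul]
      · rw [hy j r q (by omega), mul_zero]
    · rfl

theorem entry_mul (x y : LieGL1 n k) (t : Fin k) (p q : Fin n) :
    LieGL1.entry t p q ((nilIdeal n k).mul x y) =
      ∑ i : Fin k, ∑ j : Fin k, if (i + 1 : ℕ) + (j + 1) = t + 1 then
        ∑ r, LieGL1.entry i p r x * LieGL1.entry j r q y else 0 := by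
  rw [← entry_coordMul]
  congr 1
  rw [NilIdeal.mul_apply]
  change LieGL1.ofMat (LieGL1.toMat x * LieGL1.toMat y) = _
  rw [LieGL1.toMat_mul_toMat, LieGL1.ofMat_toMat]

/-- The tuples whose `(p, q)`-entry in degree `i` vanishes unless `T i p q`. -/
def LieGL1.supp (T : ℕ → Fin n → Fin n → Prop) : Submodule ℂ (LieGL1 n k) where
  carrier := {x | ∀ (i : Fin k) p q, ¬ T (i + 1) p q → entry i p q x = 0}
  add_mem' hx hy i p q h := by rw [map_add, hx i p q h, hy i p q h, add_zero]
  zero_mem' i p q _ := map_zero _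
  smul_mem' a x hx i p q h := by rw [map_smul, hx i p q h, smul_zero]

theorem LieGL1.supp_mono {T T' : ℕ → Fin n → Fin n → Prop} (h : ∀ i p q, T i p q → T' i p q) :
    (supp T : Submodule ℂ (LieGL1 n k)) ≤ supp T' := fun _ hx i p q hT =>
  hx i p q fun hT' => hT (h _ _ _ hT')

/-- Degrees add and indices chain, so every multiplicative axiom of a polarization turns into a
statement about pairs of indices and their degrees. -/
theorem mulLE_supp {T T' T'' : ℕ → Fin n → Fin n → Prop}
    (h : ∀ i j p r q, T i p r → T' j r q → T'' (i + j) p q) :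
    (nilIdeal n k).MulLE (LieGL1.supp T) (LieGL1.supp T') (LieGL1.supp T'') := by
  intro x hx y hy t p q ht
  rw [entry_mul]
  refine Finset.sum_eq_zero fun i _ => Finset.sum_eq_zero fun j _ => ?_
  split_ifs with hij
  · refine Finset.sum_eq_zero fun r _ => ?_
    by_cases h1 : T (i + 1) p r
    · by_cases h2 : T' (j + 1) r q
      · exact (ht (hij ▸ h _ _ _ _ _ h1 h2)).elim
      · rw [hy j r q h2, mul_zero]
    · rw [hx i p r h1, zero_mul]
  · rfl

open Classical in
/-- The projection onto the tuples supported on `T`. -/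
noncomputable def LieGL1.restrict (T : ℕ → Fin n → Fin n → Prop) :
    LieGL1 n k →L[ℂ] LieGL1 n k :=
  LinearMap.toContinuousLinearMap
    { toFun := fun x => mk fun i p q => if T (i + 1) p q then entry i p q x else 0
      map_add' := fun x y => ext_entry fun i p q => by
        simp only [entry_mk, map_add]; split_ifs <;> simp
      map_smul' := fun a x => ext_entry fun i p q => by
        simp only [entry_mk, map_smul, RingHom.id_apply]; split_ifs <;> simp }

open Classical in
theorem LieGL1.entry_restrict (T : ℕ → Fin n → Fin n → Prop) (x : LieGL1 n k) (i : Fin k)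
    (p q : Fin n) : entry i p q (restrict T x) = if T (i + 1) p q then entry i p q x else 0 := rfl

/-! ## The irregular type -/

namespace HTLNormalForm

variable (H : HTLNormalForm n k)

/-- The diagonal entries of `S_m`, extended by zero to all indices `m`. -/
def diag (m : ℕ) (p : Fin n) : ℂ := if h : m < k + 1 then H.S ⟨m, h⟩ p else 0

variable {H}

theorem SameBlock.diag_eq {i m : ℕ} {p q : Fin n} (h : H.SameBlock i p q) (him : i ≤ m) :
    H.diag m p = H.diag m q := by
  unfold diag
  split_ifs with hm
  · exact h ⟨m, hm⟩ him
  · rfl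

variable (H)

theorem irregularType_apply (x : LieGL1 n k) :
    H.irregularType x = ∑ i : Fin k, ∑ p, LieGL1.entry i p p x * H.diag (i + 1) p := by
  change ∑ i : Fin k, (x i * Matrix.diagonal (H.S i.succ)).trace = _
  refine Finset.sum_congr rfl fun i _ => ?_
  rw [Matrix.trace]
  refine Finset.sum_congr rfl fun p _ => ?_
  rw [Matrix.diag_apply, Matrix.mul_diagonal]
  have : H.diag (i + 1) p = H.S i.succ p := dif_pos (by omega)
  rw [this]
  rfl

theorem irregularType_mul (x y : LieGL1 n k) :
    H.irregularType ((nilIdeal n k).mul x y) = ∑ i : Fin k, ∑ j : Fin k, ∑ p, ∑ r,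
      LieGL1.entry i p r x * LieGL1.entry j r p y * H.diag (i + j + 2) p := by
  -- Indices start at `0`, so the index `i` carries degree `i + 1` and the product degree `i + j +
  -- 2`. If this exceeds `k` the product is truncated, in agreement with the zero default of `diag`.
  have key : ∀ (i j : Fin k) (p : Fin n) (a : ℂ),
      ∑ t : Fin k, (if (i + 1 : ℕ) + (j + 1) = t + 1 then a else 0) * H.diag (t + 1) p =
        a * H.diag (i + j + 2) p := by
    intro i j p a
    by_cases h : (i + j + 2 : ℕ) < k + 1
    · rw [Finset.sum_eq_single ⟨i + j + 1, by omega⟩]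
      · rw [if_pos (by simp only; omega)]
      · intro t _ ht
        rw [if_neg, zero_mul]
        intro h'
        exact ht (Fin.ext (by simp only; omega))
      · intro h'; exact (h' (Finset.mem_univ _)).elim
    · have : H.diag (i + j + 2) p = 0 := dif_neg h
      rw [this, mul_zero]
      refine Finset.sum_eq_zero fun t _ => ?_
      rw [if_neg (by omega), zero_mul]
  rw [irregularType_apply]
  simp only [entry_mul, Finset.sum_mul]
  rw [Finset.sum_comm]
  have e : ∀ p, ∑ t : Fin k, ∑ i : Fin k, ∑ j : Fin k, (if (i + 1 : ℕ) + (j + 1) = t + 1 then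
        ∑ r, LieGL1.entry i p r x * LieGL1.entry j r p y else 0) * H.diag (t + 1) p =
      ∑ i : Fin k, ∑ j : Fin k, ∑ r, LieGL1.entry i p r x * LieGL1.entry j r p y *
        H.diag (i + j + 2) p := by
    intro p
    rw [Finset.sum_comm]
    refine Finset.sum_congr rfl fun i _ => ?_
    rw [Finset.sum_comm]
    refine Finset.sum_congr rfl fun j _ => ?_
    rw [key, Finset.sum_mul]
  simp only [e]
  rw [Finset.sum_comm]
  refine Finset.sum_congr rfl fun i _ => ?_
  rw [Finset.sum_comm]

/-- Exchanging the factors exchanges `p` and `r`, so only differences of eigenvalues remain as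
weights. -/
theorem irregularType_lie (x y : LieGL1 n k) :
    H.irregularType ((nilIdeal n k).lie x y) = ∑ i : Fin k, ∑ j : Fin k, ∑ p, ∑ r,
      LieGL1.entry i p r x * LieGL1.entry j r p y *
        (H.diag (i + j + 2) p - H.diag (i + j + 2) r) := by
  rw [NilIdeal.lie, map_sub, irregularType_mul, irregularType_mul]
  rw [Finset.sum_comm (f := fun i j => ∑ p, ∑ r, LieGL1.entry i p r y * LieGL1.entry j r p x *
    H.diag (i + j + 2) p)]
  rw [← Finset.sum_sub_distrib]
  refine Finset.sum_congr rfl fun i _ => ?_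
  rw [← Finset.sum_sub_distrib]
  refine Finset.sum_congr rfl fun j _ => ?_
  rw [Finset.sum_comm (f := fun p r => LieGL1.entry j p r y * LieGL1.entry i r p x *
    H.diag (j + i + 2) p), ← Finset.sum_sub_distrib]
  refine Finset.sum_congr rfl fun p _ => ?_
  rw [← Finset.sum_sub_distrib]
  refine Finset.sum_congr rfl fun r _ => ?_
  rw [add_comm (j : ℕ) i]
  ring

theorem irregularType_lie_eq_zero {T T' : ℕ → Fin n → Fin n → Prop} {x y : LieGL1 n k}
    (hx : x ∈ LieGL1.supp T) (hy : y ∈ LieGL1.supp T')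
    (h : ∀ i j p r, 1 ≤ i → 1 ≤ j → T i p r → T' j r p → H.diag (i + j) p = H.diag (i + j) r) :
    H.irregularType ((nilIdeal n k).lie x y) = 0 := by
  rw [irregularType_lie]
  refine Finset.sum_eq_zero fun i _ => Finset.sum_eq_zero fun j _ => Finset.sum_eq_zero fun p _ =>
    Finset.sum_eq_zero fun r _ => ?_
  by_cases h1 : T (i + 1) p r
  · by_cases h2 : T' (j + 1) r p
    · have := h (i + 1) (j + 1) p r (by omega) (by omega) h1 h2
      rw [show (i + 1 + (j + 1) : ℕ) = i + j + 2 by omega] at this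
      rw [this, sub_self, mul_zero]
    · rw [hy j r p h2, mul_zero, zero_mul]
  · rw [hx i p r h1, zero_mul, zero_mul]

end HTLNormalForm

/-! ## The polarization attached to the blocks of `𝐦_j` -/

section BlockPolarization

variable {n k : ℕ} {H : HTLNormalForm n k}

theorem HTLNormalForm.SameBlock.symm {i : ℕ} {p q : Fin n} (h : H.SameBlock i p q) :
    H.SameBlock i q p := fun l hl => (h l hl).symm

theorem HTLNormalForm.SameBlock.trans {i : ℕ} {p q r : Fin n} (h : H.SameBlock i p q)
    (h' : H.SameBlock i q r) : H.SameBlock i p r := fun l hl => (h l hl).trans (h' l hl)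

theorem HTLNormalForm.SameBlock.succ {i : ℕ} {p q : Fin n} (h : H.SameBlock i p q) :
    H.SameBlock (i + 1) p q := fun l hl => h l (by omega)

namespace BlockOrdering

variable {o : BlockOrdering H} {j : ℕ}

theorem Below.not_sameBlock (h1 : 1 ≤ j) (hk : j ≤ k) {p q : Fin n} (h : o.Below j p q) :
    ¬ H.SameBlock j p q := fun h' => h.2.2 ((o.antisymm_iff j h1 hk p q).mpr h').2

/-- The eigenvalues of all higher `S_l` agree already; equality for `S_j` too would put `p` and `q`
in one block of `𝐦_j`. This provides the nonzero denominators below. -/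
theorem Below.diag_ne (h1 : 1 ≤ j) (hk : j ≤ k) {p q : Fin n} (h : o.Below j p q) :
    H.diag j p ≠ H.diag j q := by
  intro e
  refine h.not_sameBlock h1 hk fun l hl => ?_
  rcases Nat.eq_or_lt_of_le hl with h' | h'
  · have e' : ∀ p, H.diag j p = H.S l p := fun p => by
      unfold HTLNormalForm.diag
      rw [dif_pos (by omega)]
      congr 1
      exact Fin.ext h'
    rw [e', e'] at e
    exact e
  · exact h.1 l h'

theorem below_or (h1 : 1 ≤ j) (hk : j ≤ k) {p q : Fin n} (h : H.SameBlock (j + 1) p q) :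
    o.Below j p q ∨ o.Below j q p ∨ H.SameBlock j p q := by
  by_cases h3 : o.le j p q
  · by_cases h4 : o.le j q p
    · exact Or.inr (Or.inr ((o.antisymm_iff j h1 hk p q).mp ⟨h3, h4⟩))
    · exact Or.inl ⟨h, h3, h4⟩
  · exact Or.inr (Or.inl ⟨h.symm, (o.total j h1 hk p q).resolve_left h3, h3⟩)

theorem le_of_not_below (h1 : 1 ≤ j) (hk : j ≤ k) {p q : Fin n} (h : H.SameBlock (j + 1) p q)
    (h' : ¬ o.Below j p q) : o.le j q p := by
  rcases o.total j h1 hk p q with h2 | h2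
  · by_contra h3
    exact h' ⟨h, h2, h3⟩
  · exact h2

theorem Below.trans_le (h1 : 1 ≤ j) (hk : j ≤ k) {p q r : Fin n} (h : o.Below j p q)
    (hs : H.SameBlock (j + 1) q r) (hl : o.le j q r) : o.Below j p r :=
  ⟨h.1.trans hs, o.trans j h1 hk _ _ _ h.2.1 hl,
    fun h' => h.2.2 (o.trans j h1 hk _ _ _ hl h')⟩

theorem Below.le_trans (h1 : 1 ≤ j) (hk : j ≤ k) {p q r : Fin n} (hs : H.SameBlock (j + 1) p q)
    (hl : o.le j p q) (h : o.Below j q r) : o.Below j p r :=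
  ⟨hs.trans h.1, o.trans j h1 hk _ _ _ hl h.2.1,
    fun h' => h.2.2 (o.trans j h1 hk _ _ _ h' hl)⟩

theorem not_below_trans (h1 : 1 ≤ j) (hk : j ≤ k) {p q r : Fin n}
    (hpq : H.SameBlock (j + 1) p q) (hqr : H.SameBlock (j + 1) q r) (h : ¬ o.Below j p q)
    (h' : ¬ o.Below j q r) : ¬ o.Below j p r := fun hb =>
  hb.2.2 (o.trans j h1 hk _ _ _ (o.le_of_not_below h1 hk hqr h') (o.le_of_not_below h1 hk hpq h))

theorem sameBlock_le (h1 : 1 ≤ j) (hk : j ≤ k) {p q : Fin n} (h : H.SameBlock j p q) :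
    o.le j p q := ((o.antisymm_iff j h1 hk p q).mpr h).1

end BlockOrdering

variable (o : BlockOrdering H) {j : ℕ}

open Classical in
/-- The projection of `𝔤𝔩_n(ℂ[z]_k)¹` onto `𝔫^{(j)}`. -/
noncomputable def LieGL1.toNil (hk : j ≤ k) : LieGL1 n k →L[ℂ] NilTuple o j :=
  LinearMap.toContinuousLinearMap
    { toFun := fun x => NilTuple.ofMat o
        (fun i => Matrix.of fun p q =>
          if o.Below j p q then entry ⟨i, by omega⟩ p q x else 0)
        (fun i p q h => by
          by_contra hb
          exact h (if_neg hb))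
      map_add' := fun x y => NilTuple.toMat_injective <| _root_.funext fun i => Matrix.ext
        fun p q => by
          change (if o.Below j p q then entry ⟨i, by omega⟩ p q (x + y) else 0) =
            (if o.Below j p q then entry ⟨i, by omega⟩ p q x else 0) +
              if o.Below j p q then entry ⟨i, by omega⟩ p q y else 0
          split_ifs <;> simp
      map_smul' := fun a x => NilTuple.toMat_injective <| _root_.funext fun i => Matrix.ext
        fun p q => by
          change (if o.Below j p q then entry ⟨i, by omega⟩ p q (a • x) else 0) =
            a * if o.Below j p q then entry ⟨i, by omega⟩ p q x else 0
          split_ifs <;> simp }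

open Classical in
theorem LieGL1.toMat_toNil (hk : j ≤ k) (x : LieGL1 n k) (i : Fin (j - 1)) (p q : Fin n) :
    (toNil o hk x).toMat i p q =
      if o.Below j p q then entry ⟨i, by omega⟩ p q x else 0 := rfl

/-- The inclusion of `𝔫^{(j)}` into `𝔤𝔩_n(ℂ[z]_k)¹`. -/
noncomputable def LieGL1.ofNil (j : ℕ) : NilTuple o j →L[ℂ] LieGL1 n k :=
  LinearMap.toContinuousLinearMap
    { toFun := fun X => mk fun i p q => if h : (i : ℕ) < j - 1 then X.toMat ⟨i, h⟩ p q else 0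
      map_add' := fun x y => ext_entry fun i p q => by
        simp only [entry_mk, map_add, Pi.add_apply, Matrix.add_apply]; split_ifs <;> simp
      map_smul' := fun a x => ext_entry fun i p q => by
        simp only [entry_mk, map_smul, Pi.smul_apply, Matrix.smul_apply, RingHom.id_apply]
        split_ifs <;> simp }

theorem LieGL1.entry_ofNil (X : NilTuple o j) (i : Fin k) (p q : Fin n) :
    entry i p q (ofNil o j X) = if h : (i : ℕ) < j - 1 then X.toMat ⟨i, h⟩ p q else 0 := rfl

theorem NilTuple.toMat_eq_zero {o : BlockOrdering H} (X : NilTuple o j) (i : Fin (j - 1))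
    {p q : Fin n} (h : ¬ o.Below j p q) : X.toMat i p q = 0 :=
  by_contra fun h' => h (X.toMat_mem i p q h')

theorem LieGL1.toNil_ofNil (hk : j ≤ k) (X : NilTuple o j) : toNil o hk (ofNil o j X) = X := by
  refine NilTuple.toMat_injective <| _root_.funext fun i => Matrix.ext fun p q => ?_
  rw [toMat_toNil, entry_ofNil, dif_pos i.2]
  split_ifs with h
  · rfl
  · exact (X.toMat_eq_zero i h).symm

/-- In `supp` the degree is counted from `1`, so `i < j` marks precisely the `j - 1` coefficients of
`𝔫^{(j)}`. -/
theorem LieGL1.toNil_eq_zero_iff (hk : j ≤ k) (x : LieGL1 n k) :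
    toNil o hk x = 0 ↔ x ∈ supp fun i p q => ¬ (i < j ∧ o.Below j p q) := by
  constructor
  · intro h i p q hi
    rw [not_not] at hi
    have := toMat_toNil o hk x ⟨i, by omega⟩ p q
    rw [h, if_pos hi.2, map_zero] at this
    exact this.symm
  · intro h
    refine NilTuple.toMat_injective <| _root_.funext fun i => Matrix.ext fun p q => ?_
    rw [toMat_toNil, map_zero]
    split_ifs with hb
    · exact h _ p q (by rw [not_not]; exact ⟨by simp only; omega, hb⟩)
    · rfl

theorem LieGL1.mem_supp_and {T T' : ℕ → Fin n → Fin n → Prop} {x : LieGL1 n k} (h : x ∈ supp T)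
    (h' : x ∈ supp T') : x ∈ supp fun i p q => T i p q ∧ T' i p q := by
  intro i p q hT
  by_cases h1 : T (i + 1) p q
  · exact h' i p q fun h2 => hT ⟨h1, h2⟩
  · exact h i p q h1

open Classical in
/-- The matrix with the single entry `1`, at `(p, q)` in degree `i + 1`. -/
noncomputable def LieGL1.single (i : Fin k) (p q : Fin n) : LieGL1 n k :=
  mk fun i' p' q' => if i' = i ∧ p' = p ∧ q' = q then 1 else 0

theorem LieGL1.entry_single_of_ne {i i' : Fin k} {p p' q q' : Fin n}
    (h : ¬ (i' = i ∧ p' = p ∧ q' = q)) : entry i' p' q' (single i p q) = 0 := if_neg h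

theorem LieGL1.eq_sum_single (x : LieGL1 n k) :
    x = ∑ i, ∑ p, ∑ q, entry i p q x • single i p q := by
  refine ext_entry fun i p q => ?_
  simp only [map_sum, map_smul, smul_eq_mul]
  rw [Finset.sum_eq_single i, Finset.sum_eq_single p, Finset.sum_eq_single q]
  · have : entry i p q (single i p q) = 1 := if_pos ⟨rfl, rfl, rfl⟩
    rw [this, mul_one]
  · intro q' _ h
    rw [entry_single_of_ne fun h' => h h'.2.2.symm, mul_zero]
  · intro h; exact (h (Finset.mem_univ _)).elim
  · intro p' _ h
    exact Finset.sum_eq_zero fun q' _ => by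
      rw [entry_single_of_ne fun h' => h h'.2.1.symm, mul_zero]
  · intro h; exact (h (Finset.mem_univ _)).elim
  · intro i' _ h
    exact Finset.sum_eq_zero fun p' _ => Finset.sum_eq_zero fun q' _ => by
      rw [entry_single_of_ne fun h' => h h'.1.symm, mul_zero]
  · intro h; exact (h (Finset.mem_univ _)).elim

theorem LieGL1.apply_eq_sum (γ : LieGL1 n k →L[ℂ] ℂ) (x : LieGL1 n k) :
    γ x = ∑ i, ∑ p, ∑ q, entry i p q x * γ (single i p q) := by
  conv_lhs => rw [eq_sum_single x]
  simp only [map_sum, map_smul, smul_eq_mul]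

open Classical in
-- Degree `m` pairs with degree `j - m` through the eigenvalue differences of `S_j`, which are
-- nonzero across blocks of `𝐦_j`; higher degrees of `Y` meet only `S_l` with `l > j`, whose
-- differences vanish inside a block of `𝐦_{j+1}`.
theorem irregularType_graded (h1 : 1 ≤ j) (hk : j ≤ k) (m : ℕ) (hm : 1 ≤ m)
    (γ : LieGL1 n k →L[ℂ] ℂ) (hγ : ∀ Y, LieGL1.toNil o hk Y = 0 → γ Y = 0)
    (hγ' : ∀ Y ∈ LieGL1.fil (m + 1), γ Y = 0) :
    ∃ x ∈ LieGL1.supp (fun i p q => o.Below j q p ∨ (H.SameBlock (j + 1) p q ∧ j ≤ i)),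
      ∀ Y ∈ LieGL1.fil m, -H.irregularType ((nilIdeal n k).lie x Y) = γ Y := by
  rcases Nat.lt_or_ge m j with hmj | hmj
  -- The opposite entry that solves the equation in degree `m`. The index `m - 1` stands for degree
  -- `m`, and `j - m - 1` for degree `j - m`.
  · let f : Fin n → Fin n → ℂ := fun q p => if o.Below j p q then
      γ (LieGL1.single ⟨m - 1, by omega⟩ p q) / (H.diag j p - H.diag j q) else 0
    refine ⟨LieGL1.mk fun i q p => if (i + 1 : ℕ) = j - m then f q p else 0,
      fun i q p h => ?_, fun Y hY => ?_⟩
    · rw [LieGL1.entry_mk]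
      split_ifs with hi
      · exact if_neg fun hb => h (Or.inl hb)
      · rfl
    · rw [H.irregularType_lie, LieGL1.apply_eq_sum γ Y, Finset.sum_eq_single ⟨j - m - 1, by omega⟩]
      · rw [← Finset.sum_neg_distrib]
        refine Finset.sum_congr rfl fun i _ => ?_
        rw [Finset.sum_comm, ← Finset.sum_neg_distrib]
        refine Finset.sum_congr rfl fun p _ => ?_
        rw [← Finset.sum_neg_distrib]
        refine Finset.sum_congr rfl fun q _ => ?_
        rw [LieGL1.entry_mk, if_pos (by simp only; omega)]
        -- Below degree `m` the entry of `Y` is zero, in degree `m` the denominator of `f` cancels,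
        -- and above it both sides vanish.
        rcases Nat.lt_trichotomy (i + 1) m with hi | hi | hi
        · rw [hY i p q hi]
          ring
        · have hi' : i = ⟨m - 1, by omega⟩ := Fin.ext (by simp only; omega)
          by_cases hb : o.Below j p q
          · have hne := sub_ne_zero.mpr (hb.diag_ne h1 hk)
            have hf : f q p = γ (LieGL1.single i p q) / (H.diag j p - H.diag j q) := by
              rw [hi']; exact if_pos hb
            rw [hf, show (j - m - 1 + i + 2 : ℕ) = j by omega]
            field_simp
            ring
          · have hf : f q p = 0 := if_neg hb
            rw [hf, hγ (LieGL1.single i p q)]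
            · ring
            · rw [LieGL1.toNil_eq_zero_iff]
              intro i' p' q' h'
              rw [not_not] at h'
              refine LieGL1.entry_single_of_ne ?_
              rintro ⟨rfl, rfl, rfl⟩
              exact hb h'.2
        · rw [hγ' (LieGL1.single i p q)]
          · by_cases hb : o.Below j p q
            · rw [hb.1.diag_eq (m := j - m - 1 + i + 2) (by omega)]
              ring
            · have hf : f q p = 0 := if_neg hb
              rw [hf]
              ring
          · intro i' p' q' h'
            refine LieGL1.entry_single_of_ne ?_
            rintro ⟨rfl, _, _⟩
            omega
      · intro i _ hi
        refine Finset.sum_eq_zero fun i' _ => Finset.sum_eq_zero fun p _ =>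
          Finset.sum_eq_zero fun q _ => ?_
        rw [LieGL1.entry_mk, if_neg]
        · ring
        · intro h
          exact hi (Fin.ext (by simp only; omega))
      · intro h; exact (h (Finset.mem_univ _)).elim
  -- All tuples starting in degree `j` or later lie in `ker p`, so `γ` already vanishes on `fil m`.
  · refine ⟨0, Submodule.zero_mem _, fun Y hY => ?_⟩
    rw [hγ Y]
    · simp [NilIdeal.lie]
    · rw [LieGL1.toNil_eq_zero_iff]
      intro i p q h
      rw [not_not] at h
      exact hY i p q (by omega)

/-- The polarization of `𝔤 = 𝔩_{𝐦_{j+1}}(ℂ[z]_k)¹` modulo `𝔩_{𝐦_j}(ℂ[z]_k)¹`. -/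
noncomputable def blockPolarization (h1 : 1 ≤ j) (hk : j ≤ k) :
    (nilIdeal n k).Polarization H.irregularType (NilTuple o j) where
  g := LieGL1.supp fun _ p q => H.SameBlock (j + 1) p q
  l := LieGL1.supp fun _ p q => H.SameBlock j p q
  rad := LieGL1.supp fun i p q => o.Below j q p ∨ (H.SameBlock (j + 1) p q ∧ j ≤ i)
  neg := LieGL1.supp fun _ p q => o.Below j p q
  ι := LieGL1.ofNil o j
  p := LieGL1.toNil o hk
  lev := LieGL1.restrict fun _ p q => H.SameBlock j p q
  p_ι := LieGL1.toNil_ofNil o hk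
  g_mul := mulLE_supp fun _ _ _ _ _ h h' => h.trans h'
  l_mul := mulLE_supp fun _ _ _ _ _ h h' => h.trans h'
  l_le_g := LieGL1.supp_mono fun _ _ _ h => h.succ
  p_l x hx := by
    rw [LieGL1.toNil_eq_zero_iff]
    exact LieGL1.supp_mono (fun _ _ _ h h' => h'.2.not_sameBlock h1 hk h) hx
  rad_le_g := LieGL1.supp_mono fun _ _ _ h => h.elim (fun h => h.1.symm) fun h => h.1
  p_rad x hx := by
    rw [LieGL1.toNil_eq_zero_iff]
    refine LieGL1.supp_mono (fun i _ _ h h' => ?_) hx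
    rcases h with h | h
    · exact h.2.2 h'.2.2.1
    · omega
  -- A product in degree less than `j` has both factors in degree less than `j`, where `ker p`
  -- allows only pairs that are not strictly increasing; such pairs compose.
  mul_ker x hx hx' y hy := by
    rw [LieGL1.toNil_eq_zero_iff] at hx' hy ⊢
    refine mulLE_supp (fun a b p r q h h' => ?_) x (LieGL1.mem_supp_and hx hx') y hy
    rintro ⟨hab, hb⟩
    exact o.not_below_trans h1 hk h.1 (h.1.symm.trans hb.1) (fun h2 => h.2 ⟨by omega, h2⟩)
      (fun h2 => h' ⟨by omega, h2⟩) hb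
  ker_mul x hx hx' y hy := by
    rw [LieGL1.toNil_eq_zero_iff] at hx' hy ⊢
    refine mulLE_supp (fun a b p r q h h' => ?_) y hy x (LieGL1.mem_supp_and hx hx')
    rintro ⟨hab, hb⟩
    exact o.not_below_trans h1 hk (hb.1.trans h'.1.symm) h'.1 (fun h2 => h ⟨by omega, h2⟩)
      (fun h2 => h'.2 ⟨by omega, h2⟩) hb
  -- A factor of degree at least `j` puts the product in the high-degree part of `rad`. Otherwise
  -- the parabolic factor is weakly decreasing and keeps a strictly decreasing pair strictly
  -- decreasing.
  mul_rad x hx hx' y hy := by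
    rw [LieGL1.toNil_eq_zero_iff] at hx'
    refine mulLE_supp (fun a b p r q h h' => ?_) x (LieGL1.mem_supp_and hx hx') y hy
    rcases h' with h' | h'
    · by_cases ha : a < j
      · exact Or.inl (h'.trans_le h1 hk h.1.symm
          (o.le_of_not_below h1 hk h.1 fun h2 => h.2 ⟨ha, h2⟩))
      · exact Or.inr ⟨h.1.trans h'.1.symm, by omega⟩
    · exact Or.inr ⟨h.1.trans h'.1, by omega⟩
  rad_mul x hx hx' y hy := by
    rw [LieGL1.toNil_eq_zero_iff] at hx'
    refine mulLE_supp (fun a b p r q h h' => ?_) y hy x (LieGL1.mem_supp_and hx hx')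
    rcases h with h | h
    · by_cases ha : b < j
      · exact Or.inl (BlockOrdering.Below.le_trans h1 hk h'.1.symm
          (o.le_of_not_below h1 hk h'.1 fun h2 => h'.2 ⟨ha, h2⟩) h)
      · exact Or.inr ⟨h.1.symm.trans h'.1, by omega⟩
    · exact Or.inr ⟨h.1.trans h'.1, by omega⟩
  lev_mem x _ _ i p q h := if_neg h
  -- A pair in one block of `𝐦_{j+1}` is increasing, decreasing, or inside a block of `𝐦_j`. The
  -- last kind is removed by `lev`, and in `ker p` the first occurs only in degree at least `j`.
  sub_lev_mem x hx hx' := by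
    rw [LieGL1.toNil_eq_zero_iff] at hx'
    intro i p q h
    rw [map_sub, LieGL1.entry_restrict]
    split_ifs with hs
    · exact sub_self _
    · rw [sub_zero]
      by_contra hne
      have hg : H.SameBlock (j + 1) p q := by_contra fun h2 => hne (hx i p q h2)
      have hn : ¬ ((i + 1 : ℕ) < j ∧ o.Below j p q) := fun h2 =>
        hne (hx' i p q (not_not.mpr h2))
      rcases BlockOrdering.below_or (o := o) h1 hk hg with h2 | h2 | h2
      · exact h (Or.inr ⟨hg, not_lt.mp fun h3 => hn ⟨h3, h2⟩⟩)
      · exact h (Or.inl h2)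
      · exact hs h2
  neg_mul := mulLE_supp fun _ _ _ _ _ h h' => h.trans o h1 hk h'
  neg_le_g := LieGL1.supp_mono fun _ _ _ h => h.1
  ι_mem X i p q h := by
    rw [LieGL1.entry_ofNil]
    split_ifs
    · exact X.toMat_eq_zero _ h
    · rfl
  l_mul_neg := mulLE_supp fun _ _ _ _ _ h h' =>
    BlockOrdering.Below.le_trans h1 hk h.succ (o.sameBlock_le h1 hk h) h'
  neg_mul_l := mulLE_supp fun _ _ _ _ _ h h' =>
    h.trans_le h1 hk h'.succ (o.sameBlock_le h1 hk h')
  -- An element of `neg` killed by `p` has only degrees at least `j`, and multiplication raises the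
  -- degree further.
  p_neg_mul x hx y hy hy' := by
    rw [LieGL1.toNil_eq_zero_iff] at hy' ⊢
    refine mulLE_supp (fun a b p r q h h' => ?_) x hx y (LieGL1.mem_supp_and hy hy')
    rintro ⟨hab, hb⟩
    exact h'.2 ⟨by omega, h'.1⟩
  p_fil m z hz i p q hi := by
    rw [LieGL1.entry_ofNil]
    split_ifs with h
    · rw [LieGL1.toMat_toNil]
      split_ifs
      · exact hz _ p q hi
      · rfl
    · rfl
  ξ_neg x hx := by
    rw [H.irregularType_apply]
    refine Finset.sum_eq_zero fun i _ => Finset.sum_eq_zero fun p _ => ?_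
    rw [hx i p p fun h => h.2.2 h.2.1, zero_mul]
  -- In each contributing pair one of the two factors has degree at least `j`, so the total degree
  -- exceeds `j`, and the eigenvalues agree on blocks of `𝐦_{j+1}`.
  ξ_lie Y hY x hx := by
    rw [LieGL1.toNil_eq_zero_iff] at hY
    refine H.irregularType_lie_eq_zero hY hx fun a b p r ha hb h h' => ?_
    rcases h' with h' | h'
    · exact h'.1.diag_eq (by
        by_contra hab
        exact h ⟨by omega, h'⟩)
    · exact (h'.1.diag_eq (by omega)).symm
  graded m hm γ hγ hγ' := irregularType_graded o h1 hk m hm γ hγ hγ'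

end BlockPolarization

/-! ## Darboux coordinates on the coadjoint orbit -/

section Orbit

variable {n k : ℕ} {H : HTLNormalForm n k} (o : BlockOrdering H)

/-- The vectors of `⨁ T^*𝔫^{(l)}` whose components with `l ≤ j` vanish. -/
def highPart (j : ℕ) : Submodule ℂ (DeformationFibre o) where
  carrier := {v | ∀ l : Finset.Icc 2 k, (l : ℕ) ≤ j → v l = 0}
  add_mem' hv hw l hl := by rw [Pi.add_apply, hv l hl, hw l hl, add_zero]
  zero_mem' _ _ := rfl
  smul_mem' a v hv l hl := by rw [Pi.smul_apply, hv l hl, smul_zero]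

/-- The sum of the symplectic forms of the `T^*𝔫^{(l)}` with `l ≤ j`. -/
noncomputable def lowForm (j : ℕ) (u v : DeformationFibre o) : ℂ :=
  ∑ l : Finset.Icc 2 k, if (l : ℕ) ≤ j then cotangentForm (NilTuple o l) (u l) (v l) else 0

/-- The projection onto `T^*𝔫^{(l)}`. -/
noncomputable def fibreProj {l : ℕ} (hl : l ∈ Finset.Icc 2 k) :
    DeformationFibre o →L[ℂ] Cotangent (NilTuple o l) :=
  ContinuousLinearMap.proj (R := ℂ) (φ := fun l : Finset.Icc 2 k => Cotangent (NilTuple o l))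
    ⟨l, hl⟩

/-- The inclusion of `T^*𝔫^{(l)}`. -/
noncomputable def fibreIncl {l : ℕ} (hl : l ∈ Finset.Icc 2 k) :
    Cotangent (NilTuple o l) →L[ℂ] DeformationFibre o :=
  ContinuousLinearMap.single ℂ (fun l : Finset.Icc 2 k => Cotangent (NilTuple o l)) ⟨l, hl⟩

theorem fibreIncl_apply {l : ℕ} (hl : l ∈ Finset.Icc 2 k) (t : Cotangent (NilTuple o l)) :
    fibreIncl o hl t =
      Pi.single (M := fun l : Finset.Icc 2 k => Cotangent (NilTuple o l)) ⟨l, hl⟩ t := rfl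

theorem fibreProj_fibreIncl {l : ℕ} (hl : l ∈ Finset.Icc 2 k) (t : Cotangent (NilTuple o l)) :
    fibreProj o hl (fibreIncl o hl t) = t := by
  rw [fibreIncl_apply]
  exact Pi.single_eq_same (M := fun l : Finset.Icc 2 k => Cotangent (NilTuple o l)) ⟨l, hl⟩ t

theorem fibreIncl_mem {j : ℕ} (hj : j + 1 ∈ Finset.Icc 2 k)
    (t : Cotangent (NilTuple o (j + 1))) : fibreIncl o hj t ∈ highPart o j := fun l hl => by
  rw [fibreIncl_apply]
  have hne : l ≠ ⟨j + 1, hj⟩ := by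
    rintro rfl
    simp only at hl
    omega
  exact Pi.single_eq_of_ne (M := fun l : Finset.Icc 2 k => Cotangent (NilTuple o l))
    (i := ⟨j + 1, hj⟩) hne t

theorem highPart_succ {j : ℕ} (hj : j + 1 ∈ Finset.Icc 2 k) :
    highPart o (j + 1) = highPart o j ⊓ LinearMap.ker
      (fibreProj o hj : DeformationFibre o →ₗ[ℂ] Cotangent (NilTuple o (j + 1))) := by
  ext v
  rw [Submodule.mem_inf, LinearMap.mem_ker]
  refine ⟨fun h => ⟨fun l hl => h l (by omega), h ⟨j + 1, hj⟩ le_rfl⟩, fun ⟨h1, h2⟩ l hl => ?_⟩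
  rcases Nat.lt_or_ge j l with h3 | h3
  · obtain rfl : l = ⟨j + 1, hj⟩ := Subtype.ext (by simp only; omega)
    exact h2
  · exact h1 l h3

theorem lowForm_succ {j : ℕ} (hj : j + 1 ∈ Finset.Icc 2 k) (u v : DeformationFibre o) :
    lowForm o (j + 1) u v = lowForm o j u v +
      cotangentForm (NilTuple o (j + 1)) (u ⟨j + 1, hj⟩) (v ⟨j + 1, hj⟩) := by
  unfold lowForm
  have h : ∀ l : Finset.Icc 2 k,
      (if (l : ℕ) ≤ j + 1 then cotangentForm (NilTuple o l) (u l) (v l) else 0) =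
      (if (l : ℕ) ≤ j then cotangentForm (NilTuple o l) (u l) (v l) else 0) +
        if l = ⟨j + 1, hj⟩ then cotangentForm (NilTuple o l) (u l) (v l) else 0 := by
    intro l
    by_cases h1 : l = ⟨j + 1, hj⟩
    · subst h1
      simp
    · have : (l : ℕ) ≠ j + 1 := fun h2 => h1 (Subtype.ext h2)
      rw [if_neg h1, add_zero]
      exact if_congr (by omega) rfl rfl
  rw [Finset.sum_congr rfl fun l _ => h l, Finset.sum_add_distrib, Finset.sum_ite_eq']
  simp

/-- The parametrization of the orbit of `H_irr` under `1 + 𝔩_{𝐦_{j+1}}(ℂ[z]_k)¹`. -/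
theorem exists_orbitChart {j : ℕ} (h1 : 1 ≤ j) (hk : j ≤ max 1 k) :
    ∃ Φ Ψ, (nilIdeal n k).OrbitChart H.irregularType
      (LieGL1.supp fun _ p q => H.SameBlock (j + 1) p q) (highPart o j) (lowForm o j) Φ Ψ := by
  -- The bound `max 1 k` keeps the base case `j = 1` available when `k = 0`.
  induction j, h1 using Nat.le_induction with
  | base =>
    have hform : ∀ u v, lowForm o 1 u v = 0 := fun u v => Finset.sum_eq_zero fun l _ =>
      if_neg (by have := (Finset.mem_Icc.mp l.2).1; omega)
    have hK : ∀ v, v ∈ highPart o 1 := fun v l hl => by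
      have := (Finset.mem_Icc.mp l.2).1
      omega
    refine ⟨fun _ => H.irregularType, fun _ => 0, fun v => analyticAt_const,
      fun v => ⟨0, Submodule.zero_mem _, ?_⟩, fun v v' => ⟨fun _ => hK _, fun _ => rfl⟩,
      fun v u₁ u₂ => ⟨0, Submodule.zero_mem _, 0, Submodule.zero_mem _, fun Z => ?_, fun Z => ?_, ?_⟩,
      fun x => analyticAt_const, fun x hx => ?_⟩
    · rw [NilIdeal.unip_zero, NilIdeal.coad_one]
    · simp [NilIdeal.lie]
    · simp [NilIdeal.lie]
    · rw [hform]
      simp [NilIdeal.lie]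
    · ext Y
      -- Degrees of a commutator are at least `2`, and the `S_l` with `l ≥ 2` are scalar on blocks
      -- of `𝐦_2`: the point `ξ` is fixed.
      rw [NilIdeal.coad_unip_apply, H.irregularType_lie_eq_zero (T := fun _ _ _ => True) _ hx,
        add_zero]
      · intro a b p r ha hb _ h
        exact (h.diag_eq (by omega)).symm
      · exact fun i p q h => (h trivial).elim
  | succ j h1 ih =>
    obtain ⟨Φ, Ψ, h⟩ := ih (by omega)
    have hj : j + 1 ≤ k := by omega
    have hmem : j + 1 ∈ Finset.Icc 2 k := Finset.mem_Icc.mpr ⟨by omega, hj⟩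
    -- Level `j + 1` of the blocks is used, so the subalgebra `l` of the polarization is the one
    -- whose orbit is charted by the induction hypothesis.
    let D := blockPolarization o (j := j + 1) (by omega) hj
    have hstep := D.orbitChart_step h (fibreProj_fibreIncl o hmem) (fibreIncl_mem o hmem)
    refine ⟨D.stepMap Φ (fibreProj o hmem),
      D.stepInv Ψ (fibreProj o hmem) (fibreIncl o hmem), ?_⟩
    rw [highPart_succ o hmem]
    have e : lowForm o (j + 1) = fun u v => lowForm o j u v +
        cotangentForm (NilTuple o (j + 1)) (fibreProj o hmem u)
          (fibreProj o hmem v) :=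
      _root_.funext fun u => _root_.funext fun v => lowForm_succ o hmem u v
    rw [e]
    exact hstep

/-- The parametrization of the whole orbit. -/
theorem exists_orbitChart_top : ∃ Φ Ψ, (nilIdeal n k).OrbitChart H.irregularType ⊤ ⊥
    (fun u v => productForm (fun l : Finset.Icc 2 k => NilTuple o l) u v) Φ Ψ := by
  obtain ⟨Φ, Ψ, h⟩ := exists_orbitChart o (le_max_left 1 k) le_rfl
  refine ⟨Φ, Ψ, ?_⟩
  -- No index of an `S_l` exceeds `k`, so all basis vectors share one block and the subalgebra is
  -- everything.
  have e1 : (LieGL1.supp fun _ p q => H.SameBlock (max 1 k + 1) p q : Submodule ℂ (LieGL1 n k)) =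
      ⊤ := by
    refine eq_top_iff.mpr fun x _ i p q h => (h fun l hl => ?_).elim
    have := l.2
    omega
  have e2 : highPart o (max 1 k) = ⊥ := by
    refine eq_bot_iff.mpr fun v hv => ?_
    exact _root_.funext fun l => hv l (by have := (Finset.mem_Icc.mp l.2).2; omega)
  have e3 : lowForm o (max 1 k) =
      fun u v => productForm (fun l : Finset.Icc 2 k => NilTuple o l) u v := by
    funext u v
    rw [productForm_apply]
    refine Finset.sum_congr rfl fun l _ => if_pos ?_
    have := (Finset.mem_Icc.mp l.2).2
    omega
  rwa [e1, e2, e3] at h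

/-! ### The group `GL1` as the group of units `1 + x`, and the final isomorphism. -/

theorem evalZero_toMat (x : LieGL1 n k) :
    (evalZero k).mapMatrix (LieGL1.toMat x) = 0 := by
  ext p q
  rw [RingHom.mapMatrix_apply, Matrix.map_apply]
  change evalZero k (∑ i : Fin k, x i p q • newtonClass 0 (k + 1) (i + 1)) = 0
  rw [map_sum]
  refine Finset.sum_eq_zero fun i _ => ?_
  have h : evalZero k (newtonClass 0 (k + 1) (i + 1)) = 0 := by
    change evalRingHom 0 (newton 0 (i + 1)) = 0
    simp [newton]
  rw [Algebra.smul_def, map_mul, h, mul_zero]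

theorem evalZero_map_algebraMap (b : Mat n) :
    (evalZero k).mapMatrix (b.map (algebraMap ℂ (DefRing 0 (k + 1)))) = b := by
  ext p q
  rw [RingHom.mapMatrix_apply, Matrix.map_apply, Matrix.map_apply]
  change evalRingHom 0 (C (b p q)) = b p q
  simp

theorem unip_mem_GL1 (x : LieGL1 n k) : (nilIdeal n k).unip x ∈ GL1 n k := by
  rw [GL1, MonoidHom.mem_ker]
  ext1
  change (evalZero k).mapMatrix (1 + LieGL1.toMat x) = 1
  rw [map_add, map_one, evalZero_toMat, add_zero]

/-- The constant coefficient of `g` is the identity matrix, so `g` is `1` plus its higher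
coefficients. Hence every group element is reached by the coordinates. -/
theorem unip_ofMat (g : GL1 n k) :
    (nilIdeal n k).unip (LieGL1.ofMat (g : (Matrix (Fin n) (Fin n) (DefRing 0 (k + 1)))ˣ).1) =
      g := by
  ext1
  have h := eq_constMat_add (g : (Matrix (Fin n) (Fin n) (DefRing 0 (k + 1)))ˣ).1
  have h1 : (evalZero k).mapMatrix (g : (Matrix (Fin n) (Fin n) (DefRing 0 (k + 1)))ˣ).1 = 1 :=
    congrArg Units.val (MonoidHom.mem_ker.mp g.2)
  have h2 := congrArg (evalZero k).mapMatrix h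
  rw [map_add, evalZero_toMat, evalZero_map_algebraMap, add_zero, h1] at h2
  rw [← h2, Matrix.map_one _ (map_zero _) (map_one _)] at h
  exact h.symm

theorem coadGL1_eq (g : GL1 n k) (ξ : LieGL1 n k →L[ℂ] ℂ) :
    coadGL1 g ξ = (nilIdeal n k).coad g ξ := rfl

theorem lieGL1_eq (Y Z : LieGL1 n k) : lieGL1 Y Z = (nilIdeal n k).lie Y Z := map_sub _ _ _

/-- The fibre `θ⁻¹(c)` is isomorphic to the coadjoint orbit of `H_irr`. -/
theorem exists_isSymplecticIso (c : H.deformationSpace) :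
    ∃ Φ : fibre o c ≃ coadjointOrbit H.irregularType,
      IsSymplecticIso o c H.irregularType Φ := by
  obtain ⟨Φ, Ψ, h⟩ := exists_orbitChart_top o
  have hmem : ∀ v, Φ v ∈ coadjointOrbit H.irregularType := fun v => by
    obtain ⟨x, _, hx⟩ := h.mem v
    exact ⟨⟨_, unip_mem_GL1 x⟩, hx.symm⟩
  have hinv : ∀ g : GL1 n k,
      Φ (Ψ (LieGL1.ofMat (g : (Matrix (Fin n) (Fin n) (DefRing 0 (k + 1)))ˣ).1)) =
        coadGL1 g H.irregularType := fun g => by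
    rw [h.right_inv _ trivial, unip_ofMat, coadGL1_eq]
  -- Injectivity is `eq_iff` with trivial kernel; surjectivity is `right_inv`, since every group
  -- element has the form `1 + x`.
  have hbij : Function.Bijective (fun y : fibre o c =>
      (⟨Φ y.1.1, hmem _⟩ : coadjointOrbit H.irregularType)) := by
    constructor
    · rintro ⟨y, hy⟩ ⟨y', hy'⟩ e
      have e1 := (h.eq_iff y.1 y'.1).mp (congrArg Subtype.val e)
      rw [Submodule.mem_bot, sub_eq_zero] at e1
      rw [fibre_eq] at hy hy'
      exact Subtype.ext (Prod.ext e1 (hy.trans hy'.symm))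
    · rintro ⟨_, g, rfl⟩
      exact ⟨⟨_, mem_fibre o c (Ψ _)⟩, Subtype.ext (hinv g)⟩
  refine ⟨Equiv.ofBijective _ hbij, fun v _ => h.analytic v, ?_, fun v u₁ u₂ => ?_⟩
  -- The map `Ψ` is analytic on all group coordinates, so it is itself the lift required for
  -- holomorphy on the orbit.
  · refine ⟨fun x => (Ψ x, c), fun x _ => (h.analytic_symm x).prod analyticAt_const, fun g => ?_⟩
    have : (Equiv.ofBijective _ hbij).symm ⟨coadGL1 g H.irregularType, g, rfl⟩ =
        ⟨_, mem_fibre o c (Ψ (LieGL1.ofMat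
          (g : (Matrix (Fin n) (Fin n) (DefRing 0 (k + 1)))ˣ).1))⟩ := by
      rw [Equiv.symm_apply_eq]
      exact Subtype.ext (hinv g).symm
    exact (congrArg Subtype.val this).symm
  · obtain ⟨Y₁, _, Y₂, _, e1, e2, e3⟩ := h.symplectic v u₁ u₂
    refine ⟨Y₁, Y₂, fun Z => ?_, fun Z => ?_, ?_⟩
    · rw [lieGL1_eq]
      exact e1 Z
    · rw [lieGL1_eq]
      exact e2 Z
    · rw [lieGL1_eq]
      exact e3

end Orbit

end Unfolding

theorem mainTheorem5 {n k : ℕ} (H : Unfolding.HTLNormalForm n k) (o : Unfolding.BlockOrdering H) :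
    Unfolding.IsSymplecticFoliation (Unfolding.deformationPoisson o) (Unfolding.fibre o)
      (Unfolding.fibreForm o) ∧
    ∃ Φ : Unfolding.fibre o ⟨0, H.zero_mem_deformationSpace⟩ ≃
        Unfolding.coadjointOrbit H.irregularType,
      Unfolding.IsSymplecticIso o ⟨0, H.zero_mem_deformationSpace⟩ H.irregularType Φ :=
  ⟨Unfolding.isSymplecticFoliation_fibre o, Unfolding.exists_isSymplecticIso o _⟩
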